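/- Let $T\subset SL_2=SL_2(\mathbb C)$ be the torus of diagonal matrices, identified with $\mathbb C^*$ via $t\mapsto \mathrm{diag}(t,t^{-1})$, and let $H=\mathrm{diag}(1,-1)\in\mathfrak{sl}_2$. Let $X$ be a smooth quasi-projective variety over $\mathbb C$ (not necessarily irreducible), and let $\mathrm{Vect}(X)$ be the Lie algebra of algebraic vector fields on $X$, i.e. of $\mathbb C$-linear derivations of the structure sheaf. An $(\mathfrak{sl}_2,T)$-action on $X$ is an algebraic action of $T$ on $X$ together with a homomorphism of Lie algebras $\rho:\mathfrak{sl}_2\to\mathrm{Vect}(X)$ that intertwines the $T$-action on $\mathfrak{sl}_2$ by conjugation with the induced $T$-action on $\mathrm{Vect}(X)$, and such that $\rho(H)$ is the vector field given by the differential of the $T$-action (with $T$ acting on functions by $(t\cdot f)(y)=f(t^{-1}y)$). Let $X^{\mathfrak{sl}_2}$ be the set of points of $X$ at which all the vector fields $\rho(\xi)$, $\xi\in\mathfrak{sl}_2$, vanish. (i) For every $(\mathfrak{sl}_2,T)$-action on $X$ and every isolated point $x$ of the fixed point set $X^T$, one has $x\in X^{\mathfrak{sl}_2}$ if and only if all the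 weights of $T$ on the tangent space $T_xX$ are odd. (ii) For every nontrivial algebraic $SL_2$-action on $X$ with a dense orbit, the fixed point set $X^{SL_2}$ is finite. -/

import Mathlib

open CategoryTheory AlgebraicGeometry

noncomputable section

namespace SLTwoVariety

/-! ### Schemes over `ℂ` -/

/-- The category of schemes over `Spec ℂ`. -/
abbrev Sch : Type 1 := Over (Spec (CommRingCat.of ℂ))

/-- The structure map `ℂ → Γ(S, ⊤)` of a `ℂ`-scheme `S`. -/
def structureMap (S : Sch) : CommRingCat.of ℂ ⟶ Γ(S.left, ⊤) :=
  (Scheme.ΓSpecIso (CommRingCat.of ℂ)).inv ≫ S.hom.appTop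

/-- Regular functions on an open subset of a `ℂ`-scheme form a `ℂ`-algebra. -/
instance sectionAlgebra (X : Sch) (U : X.left.Opens) : Algebra ℂ Γ(X.left, U) :=
  (structureMap X ≫ X.left.presheaf.map (homOfLE le_top).op).hom.toAlgebra

/-- `Spec A` as a `ℂ`-scheme, for a `ℂ`-algebra `A`. -/
def specOver (A : Type) [CommRing A] [Algebra ℂ A] : Sch :=
  Over.mk (Spec.map (CommRingCat.ofHom (algebraMap ℂ A)))

/-- The morphism `Spec B ⟶ Spec A` of `ℂ`-schemes given by a homomorphism `A → B`. -/
def specMap {A B : Type} [CommRing A] [Algebra ℂ A] [CommRing B] [Algebra ℂ B]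
    (f : A →ₐ[ℂ] B) : specOver B ⟶ specOver A :=
  Over.homMk (Spec.map (CommRingCat.ofHom f.toRingHom)) (by
    simp only [specOver, Over.mk_left, Over.mk_hom]
    rw [← Spec.map_comp, ← CommRingCat.ofHom_comp]
    congr 2
    exact f.comp_algebraMap)

/-- The set `X(ℂ)` of `ℂ`-points of `X`. -/
abbrev Pt (X : Sch) : Type := specOver ℂ ⟶ X

/-- The (closed) point of the topological space of `X` underlying a `ℂ`-point. -/
def Pt.pos {X : Sch} (x : Pt X) : X.left :=
  x.left (IsLocalRing.closedPoint ℂ : PrimeSpectrum ℂ)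

open MvPolynomial in
/-- Projective space `ℙⁿ` over `ℂ`. -/
def projectiveSpace (n : ℕ) : Sch :=
  letI := MvPolynomial.gradedAlgebra (σ := Fin (n + 1)) (R := ℂ)
  Over.mk (Proj.toSpecZero (homogeneousSubmodule (Fin (n + 1)) ℂ) ≫
    Spec.map (CommRingCat.ofHom (algebraMap ℂ (homogeneousSubmodule (Fin (n + 1)) ℂ 0))))

/-- `X` is quasi-projective: it is isomorphic to a locally closed subscheme of some `ℙⁿ`. -/
def IsQuasiProjective (X : Sch) : Prop :=
  ∃ (n : ℕ) (i : X ⟶ projectiveSpace n), IsImmersion i.left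

/-! ### Algebraic group actions -/

/-- The multiplicative group `𝔾ₘ`, as a group functor `A ↦ Aˣ`. -/
def Gm : CommRingCat.{0} ⥤ GrpCat.{0} where
  obj A := GrpCat.of Aˣ
  map f := GrpCat.ofHom (Units.map f.hom)

/-- The group `SL₂`, as a group functor `A ↦ SL₂(A)`. -/
def SLTwo : CommRingCat.{0} ⥤ GrpCat.{0} where
  obj A := GrpCat.of (Matrix.SpecialLinearGroup (Fin 2) A)
  map f := GrpCat.ofHom (Matrix.SpecialLinearGroup.map f.hom)

/-- An algebraic (left) action on the `ℂ`-scheme `X` of the algebraic group `G`, in terms of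
functors of points: an action of `G(S) = G(Γ(S, ⊤))` on `X(S)` for each `ℂ`-scheme `S`, natural
in `S`. By the Yoneda lemma, for affine `G` this is the same as a morphism `G × X ⟶ X`
of `ℂ`-schemes that satisfies the axioms of a left action. -/
structure GroupAction (G : CommRingCat.{0} ⥤ GrpCat.{0}) (X : Sch) where
  /-- the action of `G(S)` on `X(S)` -/
  act (S : Sch) : MulAction (G.obj Γ(S.left, ⊤)) (S ⟶ X)
  act_natural {S S' : Sch} (φ : S' ⟶ S) (g : G.obj Γ(S.left, ⊤)) (p : S ⟶ X) :
    φ ≫ (act S).smul g p = (act S').smul ((G.map φ.left.appTop).hom g) (φ ≫ p)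

namespace GroupAction

variable {G : CommRingCat.{0} ⥤ GrpCat.{0}} {X : Sch}

/-- `g • p`, for `g ∈ G(S)` and an `S`-point `p` of `X`. -/
def smulPt (a : GroupAction G X) {S : Sch} (g : G.obj Γ(S.left, ⊤)) (p : S ⟶ X) : S ⟶ X :=
  (a.act S).smul g p

/-- `g • p`, for `g ∈ G(ℂ)` and an `S`-point `p` of `X`. -/
def smulConst (a : GroupAction G X) {S : Sch} (g : G.obj (CommRingCat.of ℂ)) (p : S ⟶ X) :
    S ⟶ X :=
  a.smulPt ((G.map (structureMap S)).hom g) p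

/-- The automorphism `x ↦ g • x` of `X` for `g ∈ G(ℂ)`. -/
def translate (a : GroupAction G X) (g : G.obj (CommRingCat.of ℂ)) : X ⟶ X :=
  a.smulConst g (𝟙 X)

/-- The fixed point set `X^G` (as a set of `ℂ`-points). -/
def fixedPoints (a : GroupAction G X) : Set (Pt X) :=
  {x | ∀ g : G.obj (CommRingCat.of ℂ), a.smulConst g x = x}

/-- `x` is an isolated point of `X^G`: it lies in `X^G`, and is the only point of `X^G` in some
Zariski open neighbourhood. -/
def IsIsolatedFixedPoint (a : GroupAction G X) (x : Pt X) : Prop :=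
  x ∈ a.fixedPoints ∧
    ∃ U : X.left.Opens, x.pos ∈ U ∧ ∀ y ∈ a.fixedPoints, y.pos ∈ U → y = x

/-- Some group element moves some point. -/
def IsNontrivial (a : GroupAction G X) : Prop :=
  ∃ (g : G.obj (CommRingCat.of ℂ)) (x : Pt X), a.smulConst g x ≠ x

/-- Some orbit is (Zariski) dense. -/
def HasDenseOrbit (a : GroupAction G X) : Prop :=
  ∃ x : Pt X, Dense (Set.range fun g : G.obj (CommRingCat.of ℂ) ↦ Pt.pos (a.smulConst g x))

end GroupAction

/-! ### Tangent spaces and weights -/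

/-- The `ℂ`-algebra endomorphism `ε ↦ c ε` of `ℂ[ε]`. -/
def scaleEps (c : ℂ) : DualNumber ℂ →ₐ[ℂ] DualNumber ℂ :=
  TrivSqZeroExt.map (c • (LinearMap.id : ℂ →ₗ[ℂ] ℂ))

/-- The tangent space `T_x X`: the `ℂ[ε]`-points of `X` that specialize to `x` at `ε = 0`. -/
def TangentSpace {X : Sch} (x : Pt X) : Set (specOver (DualNumber ℂ) ⟶ X) :=
  {v | specMap (TrivSqZeroExt.fstHom ℂ ℂ ℂ) ≫ v = x}

/-- The zero vector of `T_x X`. -/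
def zeroTangent {X : Sch} (x : Pt X) : specOver (DualNumber ℂ) ⟶ X :=
  specMap (TrivSqZeroExt.inlAlgHom ℂ ℂ ℂ) ≫ x

/-- `n` is a weight of `𝔾ₘ` on `T_x X` (for a fixed point `x`): there is a nonzero `v ∈ T_x X`
with `t • v = tⁿ v` for all `t ∈ ℂˣ`. Here the scalar multiplication of `T_x X` is induced
by `ε ↦ c ε`. -/
def IsTangentWeight {X : Sch} (a : GroupAction Gm X) (x : Pt X) (n : ℤ) : Prop :=
  ∃ v ∈ TangentSpace x, v ≠ zeroTangent x ∧
    ∀ t : ℂˣ, a.smulConst (G := Gm) t v = specMap (scaleEps ((t ^ n : ℂˣ) : ℂ)) ≫ v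

/-! ### Vector fields -/

/-- A product of Lie rings is a Lie ring, with the componentwise bracket. -/
instance piLieRing {ι : Type*} (L : ι → Type*) [∀ i, LieRing (L i)] : LieRing (∀ i, L i) where
  bracket x y i := ⁅x i, y i⁆
  add_lie x y z := funext fun i ↦ add_lie (x i) (y i) (z i)
  lie_add x y z := funext fun i ↦ lie_add (x i) (y i) (z i)
  lie_self x := funext fun i ↦ lie_self (x i)
  leibniz_lie x y z := funext fun i ↦ leibniz_lie (x i) (y i) (z i)

/-- A product of Lie algebras is a Lie algebra. -/
instance piLieAlgebra {ι : Type*} (L : ι → Type*) [∀ i, LieRing (L i)]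
    [∀ i, LieAlgebra ℂ (L i)] : LieAlgebra ℂ (∀ i, L i) where
  lie_smul c x y := funext fun i ↦ lie_smul c (x i) (y i)

/-- The Lie algebra `Vect(X)` of algebraic vector fields on `X`, i.e. of `ℂ`-linear derivations
of the structure sheaf, with the commutator bracket. -/
def Vect (X : Sch) :
    LieSubalgebra ℂ (∀ U : X.left.Opens, Derivation ℂ Γ(X.left, U) Γ(X.left, U)) where
  carrier := {D | ∀ ⦃U V : X.left.Opens⦄ (h : U ≤ V) (f : Γ(X.left, V)),
    X.left.presheaf.map (homOfLE h).op (D V f) = D U (X.left.presheaf.map (homOfLE h).op f)}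
  add_mem' {D D'} hD hD' U V h f := by simp [hD h f, hD' h f]
  zero_mem' U V h f := by simp
  smul_mem' c D hD U V h f := by
    have key : X.left.presheaf.map (homOfLE h).op (algebraMap ℂ Γ(X.left, V) c) =
        algebraMap ℂ Γ(X.left, U) c := by
      change (X.left.presheaf.map (homOfLE le_top).op ≫ X.left.presheaf.map (homOfLE h).op)
        (structureMap X c) = X.left.presheaf.map (homOfLE le_top).op (structureMap X c)
      rw [← Functor.map_comp]
      rfl
    simp [Algebra.smul_def, key, hD h f]
  lie_mem' {D D'} hD hD' U V h f := by
    have e (D D' : ∀ U : X.left.Opens, Derivation ℂ Γ(X.left, U) Γ(X.left, U))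
        (W : X.left.Opens) (g : Γ(X.left, W)) :
        ⁅D, D'⁆ W g = D W (D' W g) - D' W (D W g) := Derivation.commutator_apply ..
    rw [e, e, map_sub, hD h, hD' h, hD' h, hD h]

/-- The value of the vector field `D` on a regular function `f` on the open set `U`. -/
def applyField {X : Sch} (D : Vect X) (U : X.left.Opens) (f : Γ(X.left, U)) : Γ(X.left, U) :=
  D.1 U f

/-- The vector field `D` vanishes at `x`: the function `D f` vanishes at `x` for every regular
function `f` on a neighbourhood of `x`. -/
def VanishesAt {X : Sch} (D : Vect X) (x : Pt X) : Prop :=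
  ∀ (U : X.left.Opens) (f : Γ(X.left, U)), x.pos ∈ U →
    x.pos ∉ X.left.basicOpen (applyField D U f)

/-- `g • D = D'`, where `g ∈ G(ℂ)` acts on functions by `(g • f)(y) = f (g⁻¹ • y)`, and hence
on vector fields by `(g • D) (g • f) = g • (D f)`. -/
def IsTranslate {G : CommRingCat.{0} ⥤ GrpCat.{0}} {X : Sch} (a : GroupAction G X)
    (g : G.obj (CommRingCat.of ℂ)) (D D' : Vect X) : Prop :=
  ∀ (U : X.left.Opens) (f : Γ(X.left, U)),
    applyField D' _ ((a.translate g⁻¹).left.app U f) =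
      (a.translate g⁻¹).left.app U (applyField D U f)

/-- The inclusion `U ⟶ X` of an affine open set `U = Spec Γ(X, U)`. -/
def affineIncl {X : Sch} {U : X.left.Opens} (hU : IsAffineOpen U) :
    specOver Γ(X.left, U) ⟶ X :=
  Over.homMk hU.fromSpec (by
    change hU.fromSpec ≫ X.hom = Spec.map (structureMap X ≫ _)
    rw [Spec.map_comp, ← hU.fromSpec_toSpecΓ, structureMap, Spec.map_comp, Category.assoc]
    congr 1
    rw [← Scheme.toSpecΓ_naturality_assoc]
    simp)

/-- An element of `A`, as a regular function on an open subset of `Spec A`. -/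
def toSection (A : Type) [CommRing A] [Algebra ℂ A] (V : (specOver A).left.Opens) :
    A →+* Γ((specOver A).left, V) :=
  ((Scheme.ΓSpecIso (CommRingCat.of A)).inv ≫
    (Spec (CommRingCat.of A)).presheaf.map (homOfLE le_top).op).hom

/-- The element `1 - ε = (1 + ε)⁻¹` of `𝔾ₘ(A[ε])`. -/
def oneSubEps (A : Type) [CommRing A] : (DualNumber A)ˣ where
  val := 1 - DualNumber.eps
  inv := 1 + DualNumber.eps
  val_inv := by ring_nf; simp [pow_two]
  inv_val := by ring_nf; simp [pow_two]

/-- The vector field `D` is the differential of the `𝔾ₘ`-action at the basis vector of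
`Lie 𝔾ₘ = ℂ`: `f ((1 + ε)⁻¹ • y) = f (y) + ε (D f) (y)` for every regular function `f` on an
affine open set `U`. Here `y` is the tautological `U`-point `U ⟶ X` of `X`, regarded as a point
with values in `Γ(X, U)[ε]`. -/
def IsDifferential {X : Sch} (a : GroupAction Gm X) (D : Vect X) : Prop :=
  ∀ (U : X.left.Opens) (hU : IsAffineOpen U) (f : Γ(X.left, U)),
    let y : specOver (DualNumber Γ(X.left, U)) ⟶ X :=
      specMap (TrivSqZeroExt.inlAlgHom ℂ Γ(X.left, U) Γ(X.left, U)) ≫ affineIncl hU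
    let z : specOver (DualNumber Γ(X.left, U)) ⟶ X :=
      a.smulPt (G := Gm)
        (Units.map (toSection (DualNumber Γ(X.left, U)) ⊤).toMonoidHom (oneSubEps Γ(X.left, U))) y
    z.left.app U f =
      toSection (DualNumber Γ(X.left, U)) (z.left ⁻¹ᵁ U)
        (TrivSqZeroExt.inl f + TrivSqZeroExt.inr (applyField D U f))

/-! ### `(𝔰𝔩₂, T)`-varieties -/

/-- The Lie algebra `𝔰𝔩₂(ℂ)`. -/
abbrev slTwo : Type := LieAlgebra.SpecialLinear.sl (Fin 2) ℂ

/-- The basis element `H = diag(1, -1)` of `𝔰𝔩₂`. -/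
def slH : slTwo :=
  ⟨!![1, 0; 0, -1], by simp [LieAlgebra.SpecialLinear.sl, Matrix.trace_fin_two]⟩

/-- The element `diag(t, t⁻¹)` of the maximal torus `T ⊂ SL₂`. This identifies `T`
with `𝔾ₘ`. -/
def torus (t : ℂˣ) : Matrix (Fin 2) (Fin 2) ℂ :=
  !![(t : ℂ), 0; 0, ((t⁻¹ : ℂˣ) : ℂ)]

/-- The adjoint action of `T` on `𝔰𝔩₂`: conjugation by `diag(t, t⁻¹)`. -/
def conj (t : ℂˣ) (ξ : slTwo) : slTwo :=
  ⟨torus t * ξ.1 * torus t⁻¹, by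
    have h : Matrix.trace ξ.1 = 0 := ξ.2
    change Matrix.trace (torus t * ξ.1 * torus t⁻¹) = 0
    have e : torus t⁻¹ * torus t = 1 := by
      ext i j
      fin_cases i <;> fin_cases j <;> simp [torus, Matrix.mul_apply, Fin.sum_univ_two]
    rw [Matrix.trace_mul_comm, ← Matrix.mul_assoc, e, Matrix.one_mul, h]⟩

/-- An `(𝔰𝔩₂, T)`-action on `X`: an algebraic action of `T = {diag(t, t⁻¹)} = 𝔾ₘ` and a
homomorphism `𝔰𝔩₂ → Vect(X)` of Lie algebras that intertwines the `T`-actions on `𝔰𝔩₂` and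
on `Vect(X)` and that agrees on `Lie T = ℂ H` with the differential of the `T`-action. -/
structure SLTwoTAction (X : Sch) where
  /-- the action of the torus -/
  torusAction : GroupAction Gm X
  /-- the infinitesimal action of `𝔰𝔩₂` -/
  lieHom : slTwo →ₗ⁅ℂ⁆ Vect X
  equivariant (t : ℂˣ) (ξ : slTwo) :
    IsTranslate (G := Gm) torusAction t (lieHom ξ) (lieHom (conj t ξ))
  differential : IsDifferential torusAction (lieHom slH)

/-- The zero locus `X^{𝔰𝔩₂}` (as a set of `ℂ`-points) of the vector fields in the image of
`𝔰𝔩₂`. -/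
def SLTwoTAction.zeroLocus {X : Sch} (a : SLTwoTAction X) : Set (Pt X) :=
  {x | ∀ ξ : slTwo, VanishesAt (a.lieHom ξ) x}

end SLTwoVariety

end

/-! All geometry takes place on points with values in `ℂ`-algebras. An `A`-valued point landing in
an affine open `U` is a homomorphism `Γ(X, U) → A`. Dual numbers encode tangent vectors and vector
fields, and the variable of a Laurent polynomial ring is the universal element of the torus. Let `𝔪`
be the ideal of `x` in `Γ(X, U)`.

(i), odd weights imply vanishing: at a `T`-fixed point, equivariance makes the values of `ρ(H)`,
`ρ(E)`, `ρ(F)` tangent vectors of weights 0, 2, -2. They must vanish if every weight is odd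
(`mem_zeroLocus_of_odd`).

(i), vanishing implies odd weights: if all the fields vanish at `x`, then `𝔰𝔩₂` acts on `T_xX`, and
`T`-weights are eigenvalues of `H`. An even weight forces the weight 0 (`exists_weight_zero`), hence
a nonzero tangent vector killed by `D = ρ(H)`. As `X` is smooth and `D` is semisimple modulo each
`𝔪ᵏ` (`apply_field_mem_pow`), this vector extends to arcs of any finite order along which `D`
vanishes (`exists_lift_trunc`). Zeros of `D` are `T`-fixed (`mem_fixedPoints_of_field_eq_zero`), so
if `x` is isolated the Nullstellensatz puts a power of `𝔪` into the ideal generated by the image of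
`D`. A long arc with nonzero velocity does not kill that power, a contradiction
(`not_ker_pow_le_span_range`).

(ii): `X` is Noetherian, so it suffices to isolate each fixed point (`finite_of_isolated`). There
`𝔰𝔩₂` acts on all quotients by `𝔪ᵏ`. Suppose `v` is a nonzero invariant of `𝔪/𝔪²`. The Fitting
decomposition of the Casimir operator, which stands in for complete reducibility, lifts `v` to
functions `g` invariant modulo `𝔪ᵏ`, for every `k` (`exists_invariant_mod_pow`). Smoothness gives a
vector field `D` with `D v` nonzero at `x`, and the dense orbit gives `δ D = a₀ H + a₁ E + a₂ F`
modulo nilpotents with `δ ≠ 0` (`exists_eq_combination`, `exists_relation`). Applied to the `g`,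
this puts `δ` into all powers of the maximal ideal, against Krull's theorem (`mem_sq_of_generic`).
So `𝔪/𝔪²` has no nonzero invariants. Then `𝔪 = I + 𝔪²`, where `I` is generated by the images of the
fields, and by Nakayama `x` is the only zero of the fields nearby (`exists_sub_one_mem_smul_le`). -/

noncomputable section

namespace SLTwoVariety

/-! ### Points with values in algebras -/

section Points

variable {A B C : Type} [CommRing A] [Algebra ℂ A] [CommRing B] [Algebra ℂ B]
  [CommRing C] [Algebra ℂ C] {X : Sch}

lemma specMap_left (f : A →ₐ[ℂ] B) :
    (specMap f).left = Spec.map (CommRingCat.ofHom f.toRingHom) := rfl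

lemma specMap_comp (f : A →ₐ[ℂ] B) (g : B →ₐ[ℂ] C) :
    specMap g ≫ specMap f = specMap (g.comp f) := by
  ext1
  exact (Spec.map_comp (CommRingCat.ofHom f.toRingHom) (CommRingCat.ofHom g.toRingHom)).symm

lemma specMap_comp_assoc (f : A →ₐ[ℂ] B) (g : B →ₐ[ℂ] C) (z : specOver A ⟶ X) :
    specMap g ≫ specMap f ≫ z = specMap (g.comp f) ≫ z := by
  rw [← Category.assoc, specMap_comp]

lemma specMap_id : specMap (AlgHom.id ℂ A) = 𝟙 (specOver A) := by
  ext1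
  rw [specMap_left]
  exact Spec.map_id _

/-- The point of `X` underlying an `A`-valued point and a prime ideal of `A`. -/
def ptAt (z : specOver A ⟶ X) (s : PrimeSpectrum A) : X.left := z.left s

lemma ptAt_specMap_comp (f : A →ₐ[ℂ] B) (z : specOver A ⟶ X) (s : PrimeSpectrum B) :
    ptAt (specMap f ≫ z) s = ptAt z (PrimeSpectrum.comap f.toRingHom s) := rfl

lemma pos_eq_ptAt (x : Pt X) (s : PrimeSpectrum ℂ) : x.pos = ptAt x s := by
  rw [Pt.pos, ptAt, Subsingleton.elim s (IsLocalRing.closedPoint ℂ)]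

lemma continuous_ptAt (z : specOver A ⟶ X) : Continuous (ptAt z) := z.left.continuous

variable {U : X.left.Opens} (hU : IsAffineOpen U)

/-- The `A`-valued point of an affine open subset given by a homomorphism. -/
def chart (φ : Γ(X.left, U) →ₐ[ℂ] A) : specOver A ⟶ X := specMap φ ≫ affineIncl hU

lemma specMap_chart (f : A →ₐ[ℂ] B) (φ : Γ(X.left, U) →ₐ[ℂ] A) :
    specMap f ≫ chart hU φ = chart hU (f.comp φ) := by
  rw [chart, specMap_comp_assoc, chart]

lemma chart_left (φ : Γ(X.left, U) →ₐ[ℂ] A) :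
    (chart hU φ).left = Spec.map (CommRingCat.ofHom φ.toRingHom) ≫ hU.fromSpec := rfl

lemma chart_injective {φ ψ : Γ(X.left, U) →ₐ[ℂ] A} (h : chart hU φ = chart hU ψ) : φ = ψ := by
  have h' : Spec.map (CommRingCat.ofHom φ.toRingHom) ≫ hU.fromSpec =
      Spec.map (CommRingCat.ofHom ψ.toRingHom) ≫ hU.fromSpec :=
    congrArg (fun z : specOver A ⟶ X ↦ z.left) h
  rw [cancel_mono, Spec.map_inj] at h'
  ext f
  exact congrArg (fun g : Γ(X.left, U) ⟶ CommRingCat.of A ↦ g.hom f) h'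

lemma ptAt_chart_mem (φ : Γ(X.left, U) →ₐ[ℂ] A) (s : PrimeSpectrum A) :
    ptAt (chart hU φ) s ∈ U := by
  change hU.fromSpec _ ∈ (U : Set X.left)
  rw [← hU.range_fromSpec]
  exact ⟨_, rfl⟩

lemma exists_eq_chart (z : specOver A ⟶ X) (h : ∀ s, ptAt z s ∈ U) :
    ∃ φ : Γ(X.left, U) →ₐ[ℂ] A, z = chart hU φ := by
  have hr : Set.range z.left ⊆ Set.range hU.fromSpec := by
    rw [hU.range_fromSpec]
    rintro _ ⟨s, rfl⟩
    exact h s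
  let l : Spec (CommRingCat.of A) ⟶ Spec Γ(X.left, U) := IsOpenImmersion.lift hU.fromSpec z.left hr
  have hl : l ≫ hU.fromSpec = z.left := IsOpenImmersion.lift_fac _ _ _
  have hw : CommRingCat.ofHom (algebraMap ℂ Γ(X.left, U)) ≫ Spec.preimage l =
      CommRingCat.ofHom (algebraMap ℂ A) := by
    apply Spec.map_injective
    rw [Spec.map_comp, Spec.map_preimage]
    have h1 : hU.fromSpec ≫ X.hom =
      Spec.map (CommRingCat.ofHom (algebraMap ℂ Γ(X.left, U))) := Over.w (affineIncl hU)
    rw [← h1, ← Category.assoc, hl]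
    exact Over.w z
  let φ : Γ(X.left, U) →ₐ[ℂ] A :=
    { (Spec.preimage l).hom with
      commutes' := fun c ↦ congrArg (fun g : CommRingCat.of ℂ ⟶ CommRingCat.of A ↦ g.hom c) hw }
  refine ⟨φ, ?_⟩
  ext1
  rw [chart_left, ← hl]
  congr 1
  exact (Spec.map_preimage l).symm

lemma ptAt_chart_mem_basicOpen (φ : Γ(X.left, U) →ₐ[ℂ] A) (s : PrimeSpectrum A)
    (f : Γ(X.left, U)) : ptAt (chart hU φ) s ∈ X.left.basicOpen f ↔ φ f ∉ s.asIdeal := by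
  have h := hU.fromSpec_preimage_basicOpen f
  change (Spec.map (CommRingCat.ofHom φ.toRingHom)) s ∈ hU.fromSpec ⁻¹ᵁ X.left.basicOpen f ↔ _
  rw [h]
  rfl

/-- If a point lies in an affine open set, it is given by a homomorphism. -/
lemma exists_pt_eq_chart (x : Pt X) (hx : x.pos ∈ U) :
    ∃ φ : Γ(X.left, U) →ₐ[ℂ] ℂ, x = chart hU φ :=
  exists_eq_chart hU x fun s ↦ by rwa [← pos_eq_ptAt]

lemma pos_chart_mem (φ : Γ(X.left, U) →ₐ[ℂ] ℂ) : Pt.pos (chart hU φ) ∈ U :=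
  ptAt_chart_mem hU φ _

lemma pos_chart_mem_basicOpen (φ : Γ(X.left, U) →ₐ[ℂ] ℂ) (f : Γ(X.left, U)) :
    Pt.pos (chart hU φ) ∈ X.left.basicOpen f ↔ φ f ≠ 0 := by
  rw [pos_eq_ptAt _ ⊥, ptAt_chart_mem_basicOpen]
  simp

lemma exists_affine_nhds (x : X.left) (W : X.left.Opens) (hx : x ∈ W) :
    ∃ U : X.left.Opens, IsAffineOpen U ∧ x ∈ U ∧ U ≤ W := by
  obtain ⟨_, ⟨U, hU, rfl⟩, hxU, h⟩ :=
    X.left.isBasis_affineOpens.exists_subset_of_mem_open hx W.2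
  exact ⟨U, hU, hxU, h⟩

/-- An `A`-valued point lands in `U` if its restriction along a nilpotent thickening does. -/
lemma exists_eq_chart_of_nilpotent (z : specOver A ⟶ X) (f : A →ₐ[ℂ] B)
    (hf : Function.Surjective f) (hn : ∀ a, f a = 0 → IsNilpotent a)
    (ψ : Γ(X.left, U) →ₐ[ℂ] B) (hψ : specMap f ≫ z = chart hU ψ) :
    ∃ φ : Γ(X.left, U) →ₐ[ℂ] A, z = chart hU φ ∧ f.comp φ = ψ := by
  obtain ⟨φ, rfl⟩ := exists_eq_chart hU z fun s ↦ by
    -- Primes contain all nilpotents, so `Spec B → Spec A` is onto.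
    have hs : s ∈ Set.range (PrimeSpectrum.comap f.toRingHom) := by
      rw [range_comap_of_surjective _ f.toRingHom hf]
      intro a ha
      obtain ⟨n, hn⟩ := hn a ha
      exact s.2.mem_of_pow_mem n (hn ▸ s.asIdeal.zero_mem)
    obtain ⟨t, rfl⟩ := hs
    rw [← ptAt_specMap_comp, hψ]
    exact ptAt_chart_mem hU ψ t
  refine ⟨φ, rfl, chart_injective hU ?_⟩
  rw [← hψ, specMap_chart]

/-- A point with values in a local ring lands in every open set containing the image of the
closed point. -/
lemma exists_eq_chart_of_isLocalRing [IsLocalRing A] (z : specOver A ⟶ X) (r : A →ₐ[ℂ] ℂ)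
    (hz : Pt.pos (specMap r ≫ z) ∈ U) :
    ∃ φ : Γ(X.left, U) →ₐ[ℂ] A, z = chart hU φ := by
  refine exists_eq_chart hU z fun s ↦ ?_
  rw [pos_eq_ptAt _ ⊥, ptAt_specMap_comp] at hz
  -- Every point of `Spec A` specializes to the closed point, and open sets are stable under
  -- generization.
  refine Specializes.mem_open ?_ U.2 hz
  refine Specializes.map ?_ (continuous_ptAt z)
  rw [← PrimeSpectrum.le_iff_specializes]
  have : (PrimeSpectrum.comap r.toRingHom ⊥).asIdeal = IsLocalRing.maximalIdeal A := by
    apply IsLocalRing.eq_maximalIdeal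
    refine Ideal.comap_isMaximal_of_surjective (f := r.toRingHom)
      (fun c ↦ ⟨algebraMap ℂ A c, by simp⟩)
      (H := ?_)
    exact Ideal.bot_isMaximal
  change s.asIdeal ≤ _
  rw [this]
  exact IsLocalRing.le_maximalIdeal s.2.ne_top

/-- The maximal ideals of a finitely generated `ℂ`-algebra are the kernels of its
`ℂ`-points. -/
lemma exists_ker_eq_of_isMaximal [Algebra.FiniteType ℂ A] (n : Ideal A) [hn : n.IsMaximal] :
    ∃ r : A →ₐ[ℂ] ℂ, RingHom.ker r = n := by
  let := Ideal.Quotient.field n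
  have : Module.Finite ℂ (A ⧸ n) := finite_of_finite_type_of_isJacobsonRing ℂ (A ⧸ n)
  let e : ℂ ≃ₐ[ℂ] (A ⧸ n) := AlgEquiv.ofBijective (Algebra.ofId ℂ (A ⧸ n))
    (IsAlgClosed.algebraMap_bijective_of_isIntegral (k := ℂ) (K := A ⧸ n))
  refine ⟨(e.symm : (A ⧸ n) →ₐ[ℂ] ℂ).comp (Ideal.Quotient.mkₐ ℂ n), ?_⟩
  ext a
  simp [RingHom.mem_ker, Ideal.Quotient.eq_zero_iff_mem]

/-- A finitely generated algebra is Jacobson and its maximal ideals are kernels of `ℂ`-points;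
reducedness makes the zero ideal radical. This turns conditions imposed only on `ℂ`-points into
identities over coordinate rings. -/
lemma eq_zero_of_forall_algHom [Algebra.FiniteType ℂ A] [IsReduced A] {a : A}
    (h : ∀ r : A →ₐ[ℂ] ℂ, r a = 0) : a = 0 := by
  have : IsJacobsonRing A := isJacobsonRing_of_finiteType (A := ℂ)
  have h0 : a ∈ (⊥ : Ideal A).jacobson := by
    rw [Ideal.jacobson, Ideal.mem_sInf]
    rintro n ⟨-, hn⟩
    obtain ⟨r, rfl⟩ := exists_ker_eq_of_isMaximal n
    exact h r
  have hr : (⊥ : Ideal A).IsRadical := fun b hb ↦ by simpa [nilradical_eq_zero] using hb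
  rwa [this.out hr] at h0

lemma algHom_eq_of_forall_algHom [Algebra.FiniteType ℂ A] [IsReduced A] {φ ψ : B →ₐ[ℂ] A}
    (h : ∀ r : A →ₐ[ℂ] ℂ, r.comp φ = r.comp ψ) : φ = ψ := by
  ext b
  rw [← sub_eq_zero]
  refine eq_zero_of_forall_algHom fun r ↦ ?_
  rw [map_sub, sub_eq_zero]
  exact DFunLike.congr_fun (h r) b

/-- A point with values in a finitely generated algebra lands in an open set if its
specializations at all `ℂ`-points do. -/
lemma exists_eq_chart_of_finiteType [Algebra.FiniteType ℂ A] (z : specOver A ⟶ X)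
    (hz : ∀ r : A →ₐ[ℂ] ℂ, Pt.pos (specMap r ≫ z) ∈ U) :
    ∃ φ : Γ(X.left, U) →ₐ[ℂ] A, z = chart hU φ := by
  refine exists_eq_chart hU z fun s ↦ ?_
  obtain ⟨n, hn, hsn⟩ := Ideal.exists_le_maximal s.asIdeal s.2.ne_top
  obtain ⟨r, rfl⟩ := exists_ker_eq_of_isMaximal n
  have := hz r
  rw [pos_eq_ptAt _ ⊥, ptAt_specMap_comp] at this
  refine Specializes.mem_open ?_ U.2 this
  refine Specializes.map ?_ (continuous_ptAt z)
  rw [← PrimeSpectrum.le_iff_specializes]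
  exact hsn

/-- A point with values in a reduced finitely generated algebra whose specializations at all
`ℂ`-points equal `x` is constant. -/
lemma eq_const_of_forall_algHom [Algebra.FiniteType ℂ A] [IsReduced A] (z : specOver A ⟶ X)
    (x : Pt X) (hz : ∀ r : A →ₐ[ℂ] ℂ, specMap r ≫ z = x) :
    z = specMap (Algebra.ofId ℂ A) ≫ x := by
  obtain ⟨U, hU, hxU, -⟩ := exists_affine_nhds x.pos ⊤ trivial
  obtain ⟨φ, rfl⟩ := exists_eq_chart_of_finiteType hU z fun r ↦ by rwa [hz r]
  obtain ⟨ψ, rfl⟩ := exists_pt_eq_chart hU x hxU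
  rw [specMap_chart]
  congr 1
  refine algHom_eq_of_forall_algHom fun r ↦ ?_
  have := hz r
  rw [specMap_chart] at this
  rw [chart_injective hU this, ← AlgHom.comp_assoc]
  ext; simp

/-- An injective homomorphism is dominant on spectra, and a morphism from a reduced scheme to a
separated one is determined by its restriction along a dominant morphism. -/
lemma eq_of_injective_of_isSeparated [IsReduced A] [IsSeparated X.hom] (j : A →ₐ[ℂ] B)
    (hj : Function.Injective j) {z w : specOver A ⟶ X}
    (h : specMap j ≫ z = specMap j ≫ w) : z = w := by
  have : IsReduced (CommRingCat.of A) := ‹_›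
  have hd : IsDominant (Spec.map (CommRingCat.ofHom j.toRingHom)) := by
    refine ⟨?_⟩
    change DenseRange (PrimeSpectrum.comap j.toRingHom)
    rw [PrimeSpectrum.denseRange_comap_iff_ker_le_nilRadical,
      (RingHom.injective_iff_ker_eq_bot j.toRingHom).mp hj]
    exact bot_le
  ext1
  refine ext_of_isDominant_of_isSeparated (X := Spec (CommRingCat.of A)) X.hom ?_
    (Spec.map (CommRingCat.ofHom j.toRingHom))
    (congrArg (fun z : specOver B ⟶ X ↦ z.left) h)
  exact (Over.w z).trans (Over.w w).symm

end Points

/-! ### Actions on points with values in algebras -/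

namespace GroupAction

variable {A B : Type} [CommRing A] [Algebra ℂ A] [CommRing B] [Algebra ℂ B]
  {G : CommRingCat.{0} ⥤ GrpCat.{0}} {X : Sch} (a : GroupAction G X)

lemma map_map_apply (G : CommRingCat.{0} ⥤ GrpCat.{0}) {R S T : CommRingCat.{0}} (f : R ⟶ S)
    (h : S ⟶ T) (g : G.obj R) :
    (G.map h).hom ((G.map f).hom g) = (G.map (f ≫ h)).hom g := by
  rw [G.map_comp]
  rfl

/-- The action of `G(A)` on `A`-valued points. -/
def smulAlg (g : G.obj (CommRingCat.of A)) (z : specOver A ⟶ X) : specOver A ⟶ X :=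
  a.smulPt ((G.map (Scheme.ΓSpecIso (CommRingCat.of A)).inv).hom g) z

lemma smulAlg_one (z : specOver A ⟶ X) : a.smulAlg 1 z = z := by
  let := a.act (specOver A)
  rw [smulAlg, map_one]
  exact one_smul (G.obj Γ((specOver A).left, ⊤)) z

lemma smulAlg_mul (g h : G.obj (CommRingCat.of A)) (z : specOver A ⟶ X) :
    a.smulAlg (g * h) z = a.smulAlg g (a.smulAlg h z) := by
  let := a.act (specOver A)
  rw [smulAlg, map_mul]
  exact mul_smul (α := G.obj Γ((specOver A).left, ⊤)) _ _ z

lemma specMap_smulAlg (f : A →ₐ[ℂ] B) (g : G.obj (CommRingCat.of A)) (z : specOver A ⟶ X) :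
    specMap f ≫ a.smulAlg g z =
      a.smulAlg ((G.map (CommRingCat.ofHom f.toRingHom)).hom g) (specMap f ≫ z) := by
  refine (a.act_natural (specMap f) _ z).trans ?_
  change a.smulPt _ _ = a.smulPt _ _
  congr 1
  refine (map_map_apply G _ _ g).trans (Eq.trans ?_ (map_map_apply G _ _ g).symm)
  exact congrArg (fun h ↦ (G.map h).hom g)
    (Scheme.ΓSpecIso_inv_naturality (CommRingCat.ofHom f.toRingHom)).symm

lemma structureMap_specOver : structureMap (specOver A) =
    CommRingCat.ofHom (algebraMap ℂ A) ≫ (Scheme.ΓSpecIso (CommRingCat.of A)).inv :=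
  (Scheme.ΓSpecIso_inv_naturality (CommRingCat.ofHom (algebraMap ℂ A))).symm

lemma smulConst_eq (g : G.obj (CommRingCat.of ℂ)) (z : specOver A ⟶ X) :
    a.smulConst g z =
      a.smulAlg ((G.map (CommRingCat.ofHom (algebraMap ℂ A))).hom g) z := by
  rw [smulConst, smulAlg, structureMap_specOver]
  exact congrArg (a.smulPt · z) (map_map_apply G _ _ g).symm

lemma smulConst_eq_smulAlg (g : G.obj (CommRingCat.of ℂ)) (x : Pt X) :
    a.smulConst g x = a.smulAlg g x := by
  rw [smulConst_eq]
  congr 1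
  have : CommRingCat.ofHom (algebraMap ℂ ℂ) = 𝟙 (CommRingCat.of ℂ) := rfl
  rw [this, G.map_id]
  rfl

/-- The action of a group element on points is composition with its translation. -/
lemma comp_translate (g : G.obj (CommRingCat.of ℂ)) (z : specOver A ⟶ X) :
    z ≫ a.translate g = a.smulConst g z := by
  refine (a.act_natural z _ (𝟙 X)).trans ?_
  rw [Category.comp_id]
  change a.smulPt _ _ = a.smulPt _ _
  congr 1
  refine (map_map_apply G _ _ g).trans (congrArg (fun h ↦ (G.map h).hom g) ?_)
  rw [structureMap, structureMap, Category.assoc, ← Scheme.Hom.comp_appTop, Over.w]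

lemma mem_fixedPoints {x : Pt X} : x ∈ a.fixedPoints ↔
    ∀ g : G.obj (CommRingCat.of ℂ), a.smulAlg g x = x := by
  simp only [fixedPoints, Set.mem_ofPred_eq, smulConst_eq_smulAlg]

/-- A fixed point is fixed by all group elements over a reduced finitely generated algebra. -/
lemma smulAlg_const_eq [Algebra.FiniteType ℂ A] [IsReduced A] {x : Pt X}
    (hx : x ∈ a.fixedPoints) (g : G.obj (CommRingCat.of A)) :
    a.smulAlg g (specMap (Algebra.ofId ℂ A) ≫ x) = specMap (Algebra.ofId ℂ A) ≫ x := by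
  refine eq_const_of_forall_algHom _ x fun r ↦ ?_
  have : r.comp (Algebra.ofId ℂ A) = AlgHom.id ℂ ℂ := by ext; 
  rw [specMap_smulAlg, specMap_comp_assoc, this, specMap_id, Category.id_comp]
  exact a.mem_fixedPoints.mp hx _

end GroupAction

end SLTwoVariety

/-! ### Dual numbers and the differential of a torus action -/

namespace SLTwoVariety

section

variable {A B C : Type} [CommRing A] [Algebra ℂ A] [CommRing B] [Algebra ℂ B]
  [CommRing C] [Algebra ℂ C] {X : Sch}

/-- The homomorphism `ε ↦ 0`. -/
def dualFst (A : Type) [CommRing A] [Algebra ℂ A] : DualNumber A →ₐ[ℂ] A :=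
  TrivSqZeroExt.fstHom ℂ A A

/-- The inclusion of the constants. -/
def dualInl (A : Type) [CommRing A] [Algebra ℂ A] : A →ₐ[ℂ] DualNumber A :=
  TrivSqZeroExt.inlAlgHom ℂ A A

@[simp] lemma dualFst_apply (f : DualNumber A) : dualFst A f = f.fst := rfl

@[simp] lemma fst_dualInl (f : A) : (dualInl A f).fst = f := rfl

@[simp] lemma snd_dualInl (f : A) : (dualInl A f).snd = 0 := rfl

lemma dualFst_surjective : Function.Surjective (dualFst A) := fun f ↦ ⟨dualInl A f, rfl⟩

lemma isNilpotent_of_dualFst_eq_zero {f : DualNumber A} (hf : dualFst A f = 0) :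
    IsNilpotent f := by
  refine ⟨2, ?_⟩
  rw [dualFst_apply] at hf
  ext <;> simp [pow_two, hf]

/-- The homomorphism `f ↦ ψ f + ε d f`, for a derivation `d` along `ψ`. -/
def dualHom (ψ : B →ₐ[ℂ] A) (d : B →ₗ[ℂ] A)
    (h : ∀ f g, d (f * g) = ψ f * d g + ψ g * d f) : B →ₐ[ℂ] DualNumber A :=
  AlgHom.ofLinearMap
    { toFun := fun f ↦ TrivSqZeroExt.inl (ψ f) + TrivSqZeroExt.inr (d f)
      map_add' := fun f g ↦ by ext <;> simp
      map_smul' := fun c f ↦ by ext <;> simp }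
    (by
      have := h 1 1
      ext <;> simp_all)
    (fun f g ↦ by
      ext
      · simp
      · simp [h f g, mul_comm])

@[simp] lemma fst_dualHom (ψ : B →ₐ[ℂ] A) (d : B →ₗ[ℂ] A) (h) (f : B) :
    (dualHom ψ d h f).fst = ψ f := by simp [dualHom]

@[simp] lemma snd_dualHom (ψ : B →ₐ[ℂ] A) (d : B →ₗ[ℂ] A) (h) (f : B) :
    (dualHom ψ d h f).snd = d f := by simp [dualHom]

lemma algHom_dual_ext {φ ψ : B →ₐ[ℂ] DualNumber A} (h1 : ∀ f, (φ f).fst = (ψ f).fst)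
    (h2 : ∀ f, (φ f).snd = (ψ f).snd) : φ = ψ := by
  ext f
  · exact h1 f
  · exact h2 f

/-- The homomorphism `a + ε b ↦ φ a + c ε φ b`. -/
def dualMap (φ : A →ₐ[ℂ] B) (c : B) : DualNumber A →ₐ[ℂ] DualNumber B :=
  dualHom (φ.comp (TrivSqZeroExt.fstHom ℂ A A))
    { toFun := fun f ↦ c * φ f.snd
      map_add' := fun f g ↦ by simp [mul_add]
      map_smul' := fun r f ↦ by simp }
    (fun f g ↦ by simp; ring)

@[simp] lemma fst_dualMap (φ : A →ₐ[ℂ] B) (c : B) (f : DualNumber A) :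
    (dualMap φ c f).fst = φ f.fst := fst_dualHom _ _ _ _

@[simp] lemma snd_dualMap (φ : A →ₐ[ℂ] B) (c : B) (f : DualNumber A) :
    (dualMap φ c f).snd = c * φ f.snd := snd_dualHom _ _ _ _

/-- The homomorphism `f ↦ ψ f + ε ψ (D f)`, for a derivation `D`. -/
def expHom (ψ : B →ₐ[ℂ] A) (D : Derivation ℂ B B) : B →ₐ[ℂ] DualNumber A :=
  dualHom ψ (ψ.toLinearMap ∘ₗ D.toLinearMap) (fun f g ↦ by simp)

@[simp] lemma fst_expHom (ψ : B →ₐ[ℂ] A) (D : Derivation ℂ B B) (f : B) :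
    (expHom ψ D f).fst = ψ f := fst_dualHom _ _ _ _

@[simp] lemma snd_expHom (ψ : B →ₐ[ℂ] A) (D : Derivation ℂ B B) (f : B) :
    (expHom ψ D f).snd = ψ (D f) := snd_dualHom _ _ _ _

variable {U : X.left.Opens} (hU : IsAffineOpen U)

lemma chart_app (φ : Γ(X.left, U) →ₐ[ℂ] A) (f : Γ(X.left, U)) :
    (chart hU φ).left.app U f = toSection A ((chart hU φ).left ⁻¹ᵁ U) (φ f) := by
  have key : (Spec.map (CommRingCat.ofHom φ.toRingHom) ≫ hU.fromSpec).app U =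
      CommRingCat.ofHom φ.toRingHom ≫ (Scheme.ΓSpecIso (CommRingCat.of A)).inv ≫
        (Spec (CommRingCat.of A)).presheaf.map (homOfLE le_top).op := by
    rw [Scheme.Hom.comp_app, hU.fromSpec_app_self, Category.assoc,
      Scheme.ΓSpecIso_inv_naturality_assoc, Scheme.Hom.naturality]
    rfl
  exact congrArg (fun h : Γ(X.left, U) ⟶ _ ↦ h.hom f) key

lemma chart_preimage_self (φ : Γ(X.left, U) →ₐ[ℂ] A) : (chart hU φ).left ⁻¹ᵁ U = ⊤ := by
  ext s
  exact ⟨fun _ ↦ trivial, fun _ ↦ ptAt_chart_mem hU φ s⟩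

lemma toSection_top : toSection A ⊤ = (Scheme.ΓSpecIso (CommRingCat.of A)).inv.hom := by
  have h : (Scheme.ΓSpecIso (CommRingCat.of A)).inv ≫
      (Spec (CommRingCat.of A)).presheaf.map (𝟙 (Opposite.op ⊤)) =
        (Scheme.ΓSpecIso (CommRingCat.of A)).inv := by
    rw [CategoryTheory.Functor.map_id, Category.comp_id]
  exact congrArg CommRingCat.Hom.hom h

lemma toSection_injective {V : (specOver A).left.Opens} (hV : V = ⊤) :
    Function.Injective (toSection A V) := by
  subst hV
  rw [toSection_top]
  exact ((Scheme.ΓSpecIso (CommRingCat.of A)).symm.commRingCatIsoToRingEquiv).injective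

/-- Bridge from identities of sections, as in `IsDifferential`, to identities of comorphisms. -/
lemma apply_eq_of_app_eq {z : specOver A ⟶ X} {φ : Γ(X.left, U) →ₐ[ℂ] A} (hz : z = chart hU φ)
    (f : Γ(X.left, U)) {b : A} (h : z.left.app U f = toSection A (z.left ⁻¹ᵁ U) b) : φ f = b := by
  subst hz
  rw [chart_app] at h
  exact toSection_injective (chart_preimage_self hU φ) h

variable (a : GroupAction Gm X)

/-- The action of `Aˣ = 𝔾ₘ(A)` on `A`-valued points. -/
def gmAct (t : Aˣ) (z : specOver A ⟶ X) : specOver A ⟶ X :=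
  GroupAction.smulAlg (G := Gm) (A := A) a t z

lemma gmAct_one (z : specOver A ⟶ X) : gmAct a 1 z = z := a.smulAlg_one z

lemma gmAct_mul (s t : Aˣ) (z : specOver A ⟶ X) :
    gmAct a (s * t) z = gmAct a s (gmAct a t z) := a.smulAlg_mul s t z

lemma specMap_gmAct (f : A →ₐ[ℂ] B) (t : Aˣ) (z : specOver A ⟶ X) :
    specMap f ≫ gmAct a t z = gmAct a (Units.map (f : A →* B) t) (specMap f ≫ z) :=
  a.specMap_smulAlg f t z

/-- A torus element congruent to 1 modulo `ε` moves points only infinitesimally, so it cannot leave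
`U`. -/
lemma exists_gmAct_eq_chart_of_dual (t : (DualNumber A)ˣ)
    (φ : Γ(X.left, U) →ₐ[ℂ] DualNumber A) (ht : Units.map (dualFst A : DualNumber A →* A) t = 1) :
    ∃ φ' : Γ(X.left, U) →ₐ[ℂ] DualNumber A, gmAct a t (chart hU φ) = chart hU φ' ∧
      (dualFst A).comp φ' = (dualFst A).comp φ := by
  apply exists_eq_chart_of_nilpotent hU _ (dualFst A) dualFst_surjective
    fun _ ↦ isNilpotent_of_dualFst_eq_zero
  rw [specMap_gmAct, ht, gmAct_one, specMap_chart]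

/-- The differential of a `𝔾ₘ`-action on points of an affine open set with values in algebras. -/
lemma gmAct_oneSubEps {D : Vect X} (hD : IsDifferential a D) (ψ : Γ(X.left, U) →ₐ[ℂ] A) :
    gmAct a (oneSubEps A) (chart hU ((dualInl A).comp ψ)) = chart hU (expHom ψ (D.1 U)) := by
  -- The tautological point is universal; base change along `dualMap ψ 1` then gives every `ψ`.
  have h1 : gmAct a (oneSubEps Γ(X.left, U)) (chart hU (dualInl Γ(X.left, U))) =
        chart hU (expHom (AlgHom.id ℂ _) (D.1 U)) := by
    obtain ⟨φ, hφ, -⟩ := exists_gmAct_eq_chart_of_dual hU a (oneSubEps Γ(X.left, U))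
      (dualInl Γ(X.left, U)) (by ext; simp [oneSubEps])
    rw [hφ]
    congr 1
    ext1 f
    have hs : Units.map (toSection (DualNumber Γ(X.left, U)) ⊤).toMonoidHom
        (oneSubEps Γ(X.left, U)) =
        (Gm.map (Scheme.ΓSpecIso (CommRingCat.of (DualNumber Γ(X.left, U)))).inv).hom
          (oneSubEps Γ(X.left, U)) :=
      Units.ext (DFunLike.congr_fun toSection_top _)
    rw [apply_eq_of_app_eq hU ((congrArg (a.smulPt (G := Gm) · _) hs).trans hφ) f (hD U hU f)]
    ext <;> simp [applyField]
  have h2 := congrArg (specMap (dualMap ψ 1) ≫ ·) h1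
  simp only [specMap_gmAct, specMap_chart] at h2
  convert! h2 using 2
  · apply Units.ext
    change _ = dualMap ψ 1 (1 - DualNumber.eps : DualNumber Γ(X.left, U))
    ext <;> simp [oneSubEps]
  · congr 1
    apply algHom_dual_ext <;> simp
  · apply algHom_dual_ext <;> simp

end

end SLTwoVariety

/-! ### Laurent polynomials and the universal element of the torus -/

namespace SLTwoVariety

section Laurent

variable {A C : Type} [CommRing A] [CommRing C]

/-- The variable, as a unit of the ring of Laurent polynomials. -/
def laurentT (A : Type) [CommRing A] : (LaurentPolynomial A)ˣ where
  val := LaurentPolynomial.T 1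
  inv := LaurentPolynomial.T (-1)
  val_inv := by rw [← LaurentPolynomial.T_add]; simp
  inv_val := by rw [← LaurentPolynomial.T_add]; simp

lemma coeff_C_mul_T (a : A) (n j : ℤ) :
    (LaurentPolynomial.C a * LaurentPolynomial.T n).coeff j = if n = j then a else 0 := by
  rw [← LaurentPolynomial.single_eq_C_mul_T]
  exact Finsupp.single_apply

lemma laurentT_zpow (n : ℤ) :
    ((laurentT A ^ n : (LaurentPolynomial A)ˣ) : LaurentPolynomial A) = LaurentPolynomial.T n := by
  induction n using Int.induction_on with
  | zero => simp
  | succ n ih => rw [zpow_add_one, Units.val_mul, ih, LaurentPolynomial.T_add]; rfl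
  | pred n ih => rw [zpow_sub_one, Units.val_mul, ih, LaurentPolynomial.T_sub]; rfl

lemma oneSubEps_zpow (n : ℤ) :
    ((oneSubEps A ^ n : (DualNumber A)ˣ) : DualNumber A) =
      1 - (n : DualNumber A) * DualNumber.eps := by
  induction n using Int.induction_on with
  | zero => simp
  | succ n ih =>
    rw [zpow_add_one, Units.val_mul, ih]
    ext <;> simp [oneSubEps]
  | pred n ih =>
    rw [zpow_sub_one, Units.val_mul, ih]
    ext <;> simp [oneSubEps]

lemma fst_oneSubEps_zpow (n : ℤ) :
    ((oneSubEps A ^ n : (DualNumber A)ˣ) : DualNumber A).fst = 1 := by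
  rw [oneSubEps_zpow]
  simp

lemma snd_oneSubEps_zpow (n : ℤ) :
    ((oneSubEps A ^ n : (DualNumber A)ˣ) : DualNumber A).snd = -(n : A) := by
  rw [oneSubEps_zpow]
  simp

variable [Algebra ℂ A] [Algebra ℂ C]

/-- Evaluation of Laurent polynomials at a unit. -/
def laurentEval (σ : A →ₐ[ℂ] C) (u : Cˣ) : LaurentPolynomial A →ₐ[ℂ] C :=
  { LaurentPolynomial.eval₂ (σ : A →+* C) u with
    commutes' := fun c ↦ by
      rw [LaurentPolynomial.algebraMap_apply]
      simp }

/-- The inclusion of the constants into Laurent polynomials. -/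
def laurentC (A : Type) [CommRing A] [Algebra ℂ A] : A →ₐ[ℂ] LaurentPolynomial A :=
  { LaurentPolynomial.C with
    commutes' := fun c ↦ (LaurentPolynomial.algebraMap_apply c).symm }

lemma laurentEval_C (σ : A →ₐ[ℂ] C) (u : Cˣ) (a : A) :
    laurentEval σ u (laurentC A a) = σ a := LaurentPolynomial.eval₂_C _ _ _

lemma laurentEval_comp_C (σ : A →ₐ[ℂ] C) (u : Cˣ) :
    (laurentEval σ u).comp (laurentC A) = σ := AlgHom.ext (laurentEval_C σ u)

lemma laurentEval_C_mul_T (σ : A →ₐ[ℂ] C) (u : Cˣ) (a : A) (n : ℤ) :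
    laurentEval σ u (LaurentPolynomial.C a * LaurentPolynomial.T n) = σ a * ((u ^ n : Cˣ) : C) :=
  LaurentPolynomial.eval₂_C_mul_T _ _ _ _

lemma laurentEval_zpow (σ : A →ₐ[ℂ] C) (u : Cˣ) (n : ℤ) :
    laurentEval σ u ((laurentT A ^ n : (LaurentPolynomial A)ˣ) : LaurentPolynomial A) =
      ((u ^ n : Cˣ) : C) := by
  have := laurentEval_C_mul_T σ u 1 n
  rwa [map_one, map_one, one_mul, one_mul, ← laurentT_zpow] at this

lemma map_laurentEval_T (σ : A →ₐ[ℂ] C) (u : Cˣ) :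
    Units.map (laurentEval σ u : LaurentPolynomial A →* C) (laurentT A) = u := by
  have := laurentEval_C_mul_T σ u 1 1
  ext
  rw [map_one, map_one, one_mul, one_mul, zpow_one] at this
  exact this

instance finiteType_laurentPolynomial [Algebra.FiniteType ℂ A] :
    Algebra.FiniteType ℂ (LaurentPolynomial A) :=
  Algebra.FiniteType.trans (S := A) ‹_› inferInstance

lemma mem_map_C_of_coeff_mem {I : Ideal A} {p : LaurentPolynomial A}
    (hp : ∀ j, p.coeff j ∈ I) : p ∈ I.map (laurentC A) := by
  have : p = ∑ j ∈ p.coeff.support, laurentC A (p.coeff j) * LaurentPolynomial.T j := by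
    ext i
    rw [AddMonoidAlgebra.coeff_sum, Finsupp.finsetSum_apply]
    simp only [laurentC, AlgHom.coe_mk, coeff_C_mul_T]
    simp
  rw [this]
  exact Ideal.sum_mem _ fun j _ ↦ Ideal.mul_mem_right _ _ (Ideal.mem_map_of_mem _ (hp j))

lemma coeff_laurentEval_C_T (σ : A →ₐ[ℂ] C) (p : LaurentPolynomial A) (j : ℤ) :
    (laurentEval ((laurentC C).comp σ) (laurentT C) p).coeff j = σ (p.coeff j) := by
  induction p using LaurentPolynomial.induction_on' with
  | add p q hp hq => simp [hp, hq]
  | C_mul_T n a =>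
    rw [laurentEval_C_mul_T, laurentT_zpow, coeff_C_mul_T]
    change (LaurentPolynomial.C (σ a) * _).coeff j = _
    rw [coeff_C_mul_T, apply_ite σ, map_zero]

/-- The homomorphism `p(T) ↦ p((1 - ε) T) = p - ε T p'(T)`. -/
def laurentShift (A : Type) [CommRing A] [Algebra ℂ A] :
    LaurentPolynomial A →ₐ[ℂ] DualNumber (LaurentPolynomial A) :=
  laurentEval ((dualInl _).comp (laurentC A))
    (oneSubEps _ * Units.map (dualInl (LaurentPolynomial A) : _ →* _) (laurentT A))

lemma coeff_snd_laurentShift (p : LaurentPolynomial A) (j : ℤ) :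
    (laurentShift A p).snd.coeff j = -(j : A) * p.coeff j := by
  induction p using LaurentPolynomial.induction_on' with
  | add p q hp hq => simp [hp, hq, mul_add]
  | C_mul_T n a =>
    rw [laurentShift, laurentEval_C_mul_T,
      (Commute.all (oneSubEps (LaurentPolynomial A)) _).mul_zpow, ← map_zpow,
      Units.val_mul, oneSubEps_zpow]
    have h1 : ((Units.map (dualInl (LaurentPolynomial A) : _ →* _) (laurentT A ^ n) :
        (DualNumber (LaurentPolynomial A))ˣ) : DualNumber (LaurentPolynomial A)) =
        dualInl _ (LaurentPolynomial.T n) := by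
      rw [← laurentT_zpow]; rfl
    have h2 : (((dualInl _).comp (laurentC A) a) * ((1 - (n : DualNumber (LaurentPolynomial A)) *
        DualNumber.eps) * dualInl _ (LaurentPolynomial.T n))).snd =
        LaurentPolynomial.C (-(n : A) * a) * LaurentPolynomial.T n := by
      change (dualInl _ (LaurentPolynomial.C a) * _ : DualNumber (LaurentPolynomial A)).snd = _
      simp
      ring
    rw [h1, h2, coeff_C_mul_T, coeff_C_mul_T]
    split_ifs with h
    · rw [h]
    · simp

end Laurent

section Fixed

variable {X : Sch} {U : X.left.Opens} (hU : IsAffineOpen U) (a : GroupAction Gm X)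

/-- Being fixed is a condition on `ℂ`-points only. It extends to units of any algebra, reduced or
not, because each unit is a specialization of the variable of `ℂ[T, T⁻¹]`, and that ring is reduced.
-/
lemma gmAct_const_eq {A : Type} [CommRing A] [Algebra ℂ A]
    {χ : Γ(X.left, U) →ₐ[ℂ] ℂ} (hχ : chart hU χ ∈ a.fixedPoints) (t : Aˣ) :
    gmAct a t (chart hU ((Algebra.ofId ℂ A).comp χ)) = chart hU ((Algebra.ofId ℂ A).comp χ) := by
  have h := a.smulAlg_const_eq (A := LaurentPolynomial ℂ) hχ (laurentT ℂ)
  have h2 := congrArg (specMap (laurentEval (Algebra.ofId ℂ A) t) ≫ ·) h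
  change _ ≫ gmAct a _ _ = _ at h2
  rwa [specMap_gmAct, specMap_comp_assoc, map_laurentEval_T, specMap_chart,
    Subsingleton.elim ((laurentEval (Algebra.ofId ℂ A) t).comp _) (Algebra.ofId ℂ A)] at h2

variable {A : Type} [CommRing A] [Algebra ℂ A]

/-- Translating an infinitesimal neighbourhood of a fixed point by the universal element of the
torus. -/
lemma exists_coaction [Algebra.FiniteType ℂ A] {χ : Γ(X.left, U) →ₐ[ℂ] ℂ}
    (hχ : chart hU χ ∈ a.fixedPoints) (π : Γ(X.left, U) →ₐ[ℂ] A)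
    (hπ : ∀ f, χ f = 0 → IsNilpotent (π f)) :
    ∃ φ : Γ(X.left, U) →ₐ[ℂ] LaurentPolynomial A,
      gmAct a (laurentT A) (chart hU ((laurentC A).comp π)) = chart hU φ := by
  refine exists_eq_chart_of_finiteType hU _ fun r ↦ ?_
  -- As `π` makes `ker χ` nilpotent, each `ℂ`-point of `A[T, T⁻¹]` restricts to `χ`. The translate
  -- therefore specializes everywhere to a translate of the fixed point, which lies in `U`.
  have : (r.comp (laurentC A)).comp π = χ := by
    ext1 f
    have h := (hπ (f - algebraMap ℂ _ (χ f)) (by simp)).map (r.comp (laurentC A))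
    rw [map_sub, map_sub, AlgHom.commutes, AlgHom.commutes] at h
    exact sub_eq_zero.mp h.eq_zero
  rw [specMap_gmAct, specMap_chart, ← AlgHom.comp_assoc, this]
  have h := a.mem_fixedPoints.mp hχ (Units.map (r : LaurentPolynomial A →* ℂ) (laurentT A))
  change gmAct a _ _ = _ at h
  rw [h]
  exact pos_chart_mem hU χ

end Fixed

end SLTwoVariety

/-! ### Weights and semisimplicity of the torus vector field at a fixed point -/

namespace SLTwoVariety

section Torus

variable {X : Sch} {U : X.left.Opens} (hU : IsAffineOpen U) (a : GroupAction Gm X)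

variable {A : Type} [CommRing A] [Algebra ℂ A]

lemma smulConst_eq_gmAct (t : ℂˣ) (z : specOver A ⟶ X) :
    a.smulConst (G := Gm) t z = gmAct a (Units.map (algebraMap ℂ A : ℂ →* A) t) z :=
  a.smulConst_eq (G := Gm) t z

@[simp] lemma fst_algebraMap_dual (c : ℂ) :
    (algebraMap ℂ (DualNumber A) c).fst = algebraMap ℂ A c := rfl

@[simp] lemma snd_algebraMap_dual (c : ℂ) : (algebraMap ℂ (DualNumber A) c).snd = 0 := rfl

/-- The homomorphism `g + ε h ↦ σ g + e σ h`, where `e² = 0`. -/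
def dualLift {C : Type} [CommRing C] [Algebra ℂ C] (σ : A →ₐ[ℂ] C) (e : C) (he : e * e = 0) :
    DualNumber A →ₐ[ℂ] C :=
  DualNumber.lift ⟨(σ, e), he, fun _ ↦ Commute.all _ _⟩

lemma dualLift_apply {C : Type} [CommRing C] [Algebra ℂ C] (σ : A →ₐ[ℂ] C) (e : C)
    (he : e * e = 0) (f : DualNumber A) : dualLift σ e he f = σ f.fst + σ f.snd * e := rfl

lemma dualLift_comp_dualInl {C : Type} [CommRing C] [Algebra ℂ C] (σ : A →ₐ[ℂ] C) (e : C)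
    (he : e * e = 0) : (dualLift σ e he).comp (dualInl A) = σ := by
  ext f
  simp [dualLift_apply]

/-- The vector field of a `𝔾ₘ`-action in terms of the universal translate of a point. -/
lemma apply_field_eq_shift {D : Vect X} (hD : IsDifferential a D) (π : Γ(X.left, U) →ₐ[ℂ] A)
    (φ : Γ(X.left, U) →ₐ[ℂ] LaurentPolynomial A)
    (hφ : gmAct a (laurentT A) (chart hU ((laurentC A).comp π)) = chart hU φ)
    (f : Γ(X.left, U)) : φ (D.1 U f) = (laurentShift A (φ f)).snd := by
  -- The translate by `(1 - ε) T` is computed twice: acting by `1 - ε` on `φ` gives `φ + ε φ ∘ D`,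
  -- while substituting `(1 - ε) T` for `T` gives `laurentShift`.
  have h1 := gmAct_oneSubEps hU a hD φ
  rw [← specMap_chart, ← hφ, specMap_gmAct, ← gmAct_mul, specMap_chart] at h1
  have h2 := congrArg (specMap (laurentShift A) ≫ ·) hφ
  simp only [specMap_gmAct, specMap_chart] at h2
  rw [← AlgHom.comp_assoc, laurentShift, map_laurentEval_T, laurentEval_comp_C,
    AlgHom.comp_assoc, h1] at h2
  have := DFunLike.congr_fun (chart_injective hU h2) f
  have h3 := congrArg TrivSqZeroExt.snd this
  rw [snd_expHom] at h3
  exact h3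

/-- The vector field of a `𝔾ₘ`-action is semisimple on the infinitesimal neighbourhoods of a
fixed point. -/
lemma apply_field_mem_pow [Algebra.FiniteType ℂ Γ(X.left, U)] {D : Vect X}
    (hD : IsDifferential a D) {χ : Γ(X.left, U) →ₐ[ℂ] ℂ} (hχ : chart hU χ ∈ a.fixedPoints)
    (k : ℕ) {g : Γ(X.left, U)} (hg : D.1 U (D.1 U g) ∈ RingHom.ker χ ^ k) :
    D.1 U g ∈ RingHom.ker χ ^ k := by
  rcases k.eq_zero_or_pos with rfl | hk
  · simp
  let I : Ideal Γ(X.left, U) := RingHom.ker χ ^ k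
  let A := Γ(X.left, U) ⧸ I
  let π : Γ(X.left, U) →ₐ[ℂ] A := Ideal.Quotient.mkₐ ℂ I
  have hπ (f) (hf : χ f = 0) : IsNilpotent (π f) := by
    refine ⟨k, ?_⟩
    rw [← map_pow]
    exact Ideal.Quotient.eq_zero_iff_mem.mpr (Ideal.pow_mem_pow hf k)
  obtain ⟨φ, hφ⟩ := exists_coaction hU a hχ π hπ
  have hχI (f) (hf : f ∈ I) : χ f = 0 := by
    exact Ideal.pow_le_self hk.ne' hf
  let χ' : A →ₐ[ℂ] ℂ := Ideal.Quotient.liftₐ I χ hχI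
  have hχ' : χ'.comp π = χ := Ideal.Quotient.liftₐ_comp I χ hχI
  -- Modulo the maximal ideal of `A` the translate is the constant point `χ`, so all coefficients of
  -- `φ f` lie in that ideal.
  have hJ (f) (hf : f ∈ RingHom.ker χ) :
      φ f ∈ ((RingHom.ker χ).map π).map (laurentC A) := by
    refine mem_map_C_of_coeff_mem fun j ↦ ?_
    have h1 := congrArg
      (specMap (laurentEval ((laurentC ℂ).comp χ') (laurentT ℂ)) ≫ ·) hφ
    simp only [specMap_gmAct, specMap_chart] at h1
    have h2 : (laurentC ℂ).comp χ = (Algebra.ofId ℂ (LaurentPolynomial ℂ)).comp χ := by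
      rw [Subsingleton.elim (Algebra.ofId ℂ _) (laurentC ℂ)]
    rw [map_laurentEval_T, ← AlgHom.comp_assoc, laurentEval_comp_C, AlgHom.comp_assoc, hχ', h2,
      gmAct_const_eq hU a hχ, ← h2] at h1
    have h3 := DFunLike.congr_fun (chart_injective hU h1) f
    rw [AlgHom.comp_apply, AlgHom.comp_apply, (show χ f = 0 from hf), map_zero] at h3
    have h4 := coeff_laurentEval_C_T χ' (φ f) j
    rw [← h3] at h4
    obtain ⟨g, hg⟩ : ∃ g, π g = (φ f).coeff j := Ideal.Quotient.mk_surjective _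
    rw [← hg] at h4 ⊢
    refine Ideal.mem_map_of_mem _ ?_
    have h5 : χ' (π g) = χ g := DFunLike.congr_fun hχ' g
    rw [RingHom.mem_ker, ← h5, ← h4]
    rfl
  have hφ0 (f) (hf : f ∈ I) : φ f = 0 := by
    have h1 : I.map φ ≤ ⊥ := by
      rw [Ideal.map_pow]
      have h0 : (RingHom.ker χ).map φ ≤ ((RingHom.ker χ).map π).map (laurentC A) :=
        Ideal.map_le_of_le_comap hJ
      refine (Ideal.pow_right_mono h0 k).trans ?_
      rw [← Ideal.map_pow, ← Ideal.map_pow]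
      have : (RingHom.ker χ ^ k).map π = ⊥ := Ideal.map_quotient_self I
      rw [this, Ideal.map_bot]
    exact h1 (Ideal.mem_map_of_mem φ hf)
  have hcoeff (f) (j : ℤ) : (φ (D.1 U f)).coeff j = -(j : A) * (φ f).coeff j := by
    rw [apply_field_eq_shift hU a hD π φ hφ, coeff_snd_laurentShift]
  -- Since `D` multiplies the coefficient of `T ^ j` by `-j`, the hypothesis reads `j² (φ g)_j = 0`,
  -- whence `j (φ g)_j = 0` in characteristic zero.
  have h0 : φ (D.1 U g) = 0 := by
    ext j
    have h := hcoeff (D.1 U g) j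
    rw [hφ0 _ hg, hcoeff] at h
    rw [hcoeff]
    rcases eq_or_ne j 0 with rfl | hj
    · simp
    have hu : IsUnit (-(j : A)) := by
      have : IsUnit (-(j : ℂ)) := by simpa using hj
      simpa using this.map (algebraMap ℂ A)
    have h' : -(j : A) * (-(j : A) * (φ g).coeff j) = 0 := h.symm
    rw [hu.mul_right_eq_zero] at h'
    exact h'
  -- Setting `T = 1` recovers `π` from `φ`.
  have h1 := congrArg (specMap (laurentEval (AlgHom.id ℂ A) 1) ≫ ·) hφ
  simp only [specMap_gmAct, specMap_chart] at h1
  rw [map_laurentEval_T, gmAct_one, ← AlgHom.comp_assoc, laurentEval_comp_C] at h1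
  have := DFunLike.congr_fun (chart_injective hU h1) (D.1 U g)
  rw [AlgHom.comp_apply, AlgHom.comp_apply, h0, map_zero] at this
  exact Ideal.Quotient.eq_zero_iff_mem.mp this

/-- Differentiating `T ^ n` at `T = 1` along `1 - ε` produces the factor `-n`. The element `e` is
the image of the infinitesimal of `w`, kept distinct from the `ε` of the differentiation. -/
lemma apply_field_of_universal_translate {D : Vect X} (hD : IsDifferential a D)
    {w : Γ(X.left, U) →ₐ[ℂ] DualNumber ℂ} {φ : Γ(X.left, U) →ₐ[ℂ] DualNumber (LaurentPolynomial ℂ)}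
    (hφ : gmAct a (Units.map (dualInl (LaurentPolynomial ℂ) : LaurentPolynomial ℂ →* _)
      (laurentT ℂ)) (chart hU ((dualMap (Algebra.ofId ℂ (LaurentPolynomial ℂ)) 1).comp w)) =
        chart hU φ) {n : ℤ}
    (hφ1 : ∀ f, (φ f).fst = algebraMap ℂ _ (w f).fst)
    (hφ2 : ∀ f, (φ f).snd = algebraMap ℂ _ (w f).snd * (laurentT ℂ ^ n : (LaurentPolynomial ℂ)ˣ))
    {e : A} (he : e * e = 0) {ψ : Γ(X.left, U) →ₐ[ℂ] A}
    (hψ : ∀ f, ψ f = algebraMap ℂ A (w f).fst + algebraMap ℂ A (w f).snd * e)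
    (f : Γ(X.left, U)) : ψ (D.1 U f) = algebraMap ℂ A (-n * (w f).snd) * e := by
  have he' : dualInl A e * dualInl A e = 0 := by rw [← map_mul, he, map_zero]
  let σ : LaurentPolynomial ℂ →ₐ[ℂ] DualNumber A :=
    laurentEval (Algebra.ofId ℂ (DualNumber A)) (oneSubEps A)
  have hσ : Units.map (σ : LaurentPolynomial ℂ →* DualNumber A) (laurentT ℂ) = oneSubEps A :=
    map_laurentEval_T _ _
  -- `τ` substitutes `1 - ε` for `T` and `e` for the infinitesimal of the tangent vector.
  let τ : DualNumber (LaurentPolynomial ℂ) →ₐ[ℂ] DualNumber A := dualLift σ (dualInl A e) he'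
  have h1 := congrArg (specMap τ ≫ ·) hφ
  simp only [specMap_gmAct, specMap_chart] at h1
  have h2 : Units.map (τ : DualNumber (LaurentPolynomial ℂ) →* DualNumber A)
      (Units.map (dualInl (LaurentPolynomial ℂ) : LaurentPolynomial ℂ →* _) (laurentT ℂ)) =
      oneSubEps A := by
    rw [← hσ, ← dualLift_comp_dualInl σ _ he']
    rfl
  have h3 : τ.comp ((dualMap (Algebra.ofId ℂ (LaurentPolynomial ℂ)) 1).comp w) =
      (dualInl A).comp ψ := by
    ext1 f
    simp only [AlgHom.comp_apply, τ, dualLift_apply, fst_dualMap, snd_dualMap, one_mul,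
      Algebra.ofId_apply, AlgHom.commutes, hψ, map_add, map_mul]
  rw [h2, h3, gmAct_oneSubEps hU a hD] at h1
  have h4 := congrArg TrivSqZeroExt.snd (DFunLike.congr_fun (chart_injective hU h1) f)
  rw [snd_expHom] at h4
  rw [h4, AlgHom.comp_apply, dualLift_apply, hφ1, hφ2, map_mul, laurentEval_zpow, AlgHom.commutes,
    AlgHom.commutes]
  simp [snd_oneSubEps_zpow, fst_oneSubEps_zpow]
  ring

/-- The `ε`-part of a weight vector serves as `θ`. The sign comes from `T` acting on functions
through inverses. -/
lemma exists_of_isTangentWeight {D : Vect X}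
    (hD : IsDifferential a D) {χ : Γ(X.left, U) →ₐ[ℂ] ℂ} (hχ : chart hU χ ∈ a.fixedPoints)
    {n : ℤ} (hn : IsTangentWeight a (chart hU χ) n) :
    ∃ θ : Γ(X.left, U) →ₗ[ℂ] ℂ, (∀ f g, θ (f * g) = χ f * θ g + χ g * θ f) ∧ θ ≠ 0 ∧
      ∀ f, θ (D.1 U f) = -(n : ℂ) * θ f := by
  obtain ⟨v, hv, hv0, hvn⟩ := hn
  obtain ⟨w, rfl, hw⟩ := exists_eq_chart_of_nilpotent hU v (dualFst ℂ) dualFst_surjective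
    (fun _ ↦ isNilpotent_of_dualFst_eq_zero) χ hv
  have hw1 (f) : (w f).fst = χ f := DFunLike.congr_fun hw f
  let L := LaurentPolynomial ℂ
  let t : (DualNumber L)ˣ := Units.map (dualInl L : L →* _) (laurentT ℂ)
  obtain ⟨φ, hφ, hφw⟩ := exists_eq_chart_of_nilpotent hU
    (gmAct a t (chart hU ((dualMap (Algebra.ofId ℂ L) 1).comp w))) (dualFst L)
    dualFst_surjective (fun _ ↦ isNilpotent_of_dualFst_eq_zero) ((Algebra.ofId ℂ L).comp χ) (by
      have h1 : Units.map (dualFst L : DualNumber L →* L) t = laurentT ℂ := rfl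
      have h2 : (dualFst L).comp ((dualMap (Algebra.ofId ℂ L) 1).comp w) =
        (Algebra.ofId ℂ L).comp χ := by ext1 f; simp [hw1]
      rw [specMap_gmAct, specMap_chart, h1, h2, gmAct_const_eq hU a hχ])
  -- The weight condition is given at `ℂ`-points of the torus only; these suffice because `ℂ[T,
  -- T⁻¹]` is reduced.
  have hs (f) : (φ f).snd = algebraMap ℂ L (w f).snd * (laurentT ℂ ^ n : Lˣ) := by
    rw [← sub_eq_zero]
    refine eq_zero_of_forall_algHom fun r ↦ ?_
    let s : ℂˣ := Units.map (r : L →* ℂ) (laurentT ℂ)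
    have h1 := hvn s
    rw [smulConst_eq_gmAct] at h1
    have h2 := congrArg (specMap (dualMap r 1) ≫ ·) hφ
    simp only [specMap_gmAct, specMap_chart] at h2
    have h3 : (dualMap r 1).comp ((dualMap (Algebra.ofId ℂ L) 1).comp w) = w := by
      apply algHom_dual_ext <;> intro f <;> simp
    have h4 : Units.map (dualMap r 1 : DualNumber L →* DualNumber ℂ) t =
        Units.map (algebraMap ℂ (DualNumber ℂ) : _ →* _) s := by
      apply Units.ext
      change dualMap r 1 (dualInl L (laurentT ℂ : L)) = dualInl ℂ (r (laurentT ℂ : L))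
      ext <;> simp
    rw [h3, h4] at h2
    have h5 := h2.symm.trans (h1.trans (specMap_chart hU _ _))
    have h6 := congrArg TrivSqZeroExt.snd (DFunLike.congr_fun (chart_injective hU h5) f)
    have h7 : r ((laurentT ℂ ^ n : Lˣ) : L) = ((s ^ n : ℂˣ) : ℂ) := by
      rw [← map_zpow]; rfl
    rw [map_sub, map_mul, AlgHom.commutes, h7, sub_eq_zero]
    simp only [AlgHom.comp_apply, snd_dualMap, one_mul] at h6
    rw [h6, scaleEps, TrivSqZeroExt.snd_map, mul_comm]
    rfl
  let θ : Γ(X.left, U) →ₗ[ℂ] ℂ :=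
    { toFun := fun f ↦ (w f).snd
      map_add' := fun f g ↦ by rw [map_add]; rfl
      map_smul' := fun c f ↦ by rw [map_smul]; rfl }
  refine ⟨θ, ?_, ?_, ?_⟩
  · intro f g
    simp [θ, hw1, mul_comm]
  · intro h
    apply hv0
    rw [zeroTangent]
    refine Eq.trans ?_ (specMap_chart hU (dualInl ℂ) χ).symm
    congr 1
    refine algHom_dual_ext (fun f ↦ by simp [hw1]) fun f ↦ ?_
    rw [AlgHom.comp_apply, snd_dualInl]
    exact DFunLike.congr_fun h f
  · intro f
    have h := apply_field_of_universal_translate hU a hD hφ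
      (fun f ↦ (DFunLike.congr_fun hφw f).trans (congrArg (algebraMap ℂ L) (hw1 f).symm)) hs
      (e := (DualNumber.eps : DualNumber ℂ)) (ψ := w) (by simp) (fun f ↦ by ext <;> simp) f
    change (w (D.1 U f)).snd = -(n : ℂ) * (w f).snd
    rw [h]
    simp

end Torus

end SLTwoVariety

/-! ### Zeros of the torus vector field are fixed points -/

namespace SLTwoVariety

section PowerSeries

open PowerSeries

/-- The unit `1 + X` of `ℂ⟦X⟧`. -/
def oneAddX : (PowerSeries ℂ)ˣ :=
  (PowerSeries.isUnit_iff_constantCoeff.mpr (by simp) : IsUnit (1 + X : PowerSeries ℂ)).unit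

/-- Evaluation at `0`. -/
def evalZero : PowerSeries ℂ →ₐ[ℂ] ℂ :=
  { PowerSeries.constantCoeff (R := ℂ) with
    commutes' := fun c ↦ by
      change PowerSeries.constantCoeff (algebraMap ℂ (PowerSeries ℂ) c) = c
      simp }

lemma map_evalZero_oneAddX : Units.map (evalZero : PowerSeries ℂ →* ℂ) oneAddX = 1 := by
  ext
  change PowerSeries.constantCoeff (1 + PowerSeries.X : PowerSeries ℂ) = 1
  simp

/-- A power of `T` clears denominators, and the shift by 1 is invertible on polynomials.
Geometrically, the formal neighbourhood of 1 is dense in the torus. -/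
lemma laurentEval_oneAddX_injective :
    Function.Injective (laurentEval (Algebra.ofId ℂ (PowerSeries ℂ)) oneAddX) := by
  rw [injective_iff_map_eq_zero]
  intro p hp
  obtain ⟨n, q, hq⟩ := p.exists_T_pow
  have h1 : laurentEval (Algebra.ofId ℂ (PowerSeries ℂ)) oneAddX (Polynomial.toLaurent q) =
      ((q.comp (1 + Polynomial.X) : Polynomial ℂ) : PowerSeries ℂ) := by
    clear hq
    induction q using Polynomial.induction_on' with
    | add q r hq hr => simp [hq, hr]
    | monomial n c =>
      rw [← Polynomial.C_mul_X_pow_eq_monomial, Polynomial.toLaurent_C_mul_X_pow,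
        laurentEval_C_mul_T]
      have : ((oneAddX ^ (n : ℤ) : (PowerSeries ℂ)ˣ) : PowerSeries ℂ) = (1 + X) ^ n := by
        rw [zpow_natCast, Units.val_pow_eq_pow_val]; rfl
      rw [this]
      simp [Algebra.ofId_apply]
  rw [hq, map_mul, hp, zero_mul] at h1
  have h2 : q.comp (1 + Polynomial.X) = 0 := by
    exact_mod_cast h1.symm
  have h3 : q = 0 := by
    have := congrArg (fun r ↦ r.comp (Polynomial.X - 1)) h2
    simpa [Polynomial.comp_assoc] using this
  rw [h3, map_zero] at hq
  exact ((LaurentPolynomial.isUnit_T n).mul_left_eq_zero).mp hq.symm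

variable {X : Sch} {U : X.left.Opens} (hU : IsAffineOpen U) (a : GroupAction Gm X)

/-- A point at which the vector field of a `𝔾ₘ`-action vanishes is fixed. -/
lemma mem_fixedPoints_of_field_eq_zero [IsSeparated X.hom] {D : Vect X}
    (hD : IsDifferential a D) {η : Γ(X.left, U) →ₐ[ℂ] ℂ} (hη : ∀ f, η (D.1 U f) = 0) :
    chart hU η ∈ a.fixedPoints := by
  let c : Γ(X.left, U) →ₐ[ℂ] PowerSeries ℂ := (Algebra.ofId ℂ (PowerSeries ℂ)).comp η
  obtain ⟨q, hq⟩ := exists_eq_chart_of_isLocalRing hU (gmAct a oneAddX (chart hU c)) evalZero (by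
    rw [specMap_gmAct, map_evalZero_oneAddX, gmAct_one, specMap_chart]
    exact pos_chart_mem hU _)
  -- `E` is the infinitesimal rescaling in the coordinate `1 + X`, so that `s` sends `1 + X` to `(1
  -- - ε) (1 + X)`.
  let E : Derivation ℂ (PowerSeries ℂ) (PowerSeries ℂ) :=
    -((1 + PowerSeries.X : PowerSeries ℂ) • PowerSeries.derivative ℂ)
  let s : PowerSeries ℂ →ₐ[ℂ] DualNumber (PowerSeries ℂ) := expHom (AlgHom.id ℂ _) E
  have h1 := gmAct_oneSubEps hU a hD q
  have hs : Units.map (s : PowerSeries ℂ →* DualNumber (PowerSeries ℂ)) oneAddX =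
      oneSubEps (PowerSeries ℂ) *
        Units.map (dualInl (PowerSeries ℂ) : PowerSeries ℂ →* _) oneAddX := by
    apply Units.ext
    change s (1 + PowerSeries.X) = (1 - DualNumber.eps) * dualInl _ (1 + PowerSeries.X)
    ext1
    · simp [s]
    · simp [s, E]
  rw [← specMap_chart, ← hq, specMap_gmAct, ← gmAct_mul, specMap_chart] at h1
  have h2 := congrArg (specMap s ≫ ·) hq
  simp only [specMap_gmAct, specMap_chart] at h2
  have hc : s.comp c = (dualInl _).comp c := by
    ext1 f
    exact (AlgHom.commutes s _).trans (AlgHom.commutes (dualInl (PowerSeries ℂ)) _).symm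
  rw [hs, hc, h1] at h2
  -- The formal orbit map `q` satisfies the differential equation of the flow, which the constant
  -- `c` also solves; the coefficient induction below is uniqueness of the solution.
  have hd (f) : q (D.1 U f) = E (q f) := by
    have := congrArg TrivSqZeroExt.snd (DFunLike.congr_fun (chart_injective hU h2) f)
    simpa only [AlgHom.comp_apply, snd_expHom, s, AlgHom.id_apply] using this
  have hq0 (f) : PowerSeries.constantCoeff (q f) = η f := by
    have h5 := congrArg (specMap evalZero ≫ ·) hq
    simp only [specMap_gmAct, specMap_chart] at h5
    rw [map_evalZero_oneAddX, gmAct_one, ← AlgHom.comp_assoc,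
      Subsingleton.elim (evalZero.comp _) (AlgHom.id ℂ ℂ), AlgHom.id_comp] at h5
    exact (DFunLike.congr_fun (chart_injective hU h5) f).symm
  -- The induction runs over all `f` at once, since the coefficients of `q f` are controlled by
  -- lower ones of `q (D f)`.
  have hqc (j : ℕ) : ∀ f, ∀ i, i ≠ 0 → i ≤ j → PowerSeries.coeff i (q f) = 0 := by
    induction j with
    | zero => intro f i hi hi'; omega
    | succ j ih =>
      intro f i hi hij
      have h5 : (PowerSeries.X : PowerSeries ℂ) ^ (j + 1) ∣ q (D.1 U f) := by
        rw [PowerSeries.X_pow_dvd_iff]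
        intro m hm
        rcases eq_or_ne m 0 with rfl | hm0
        · rw [PowerSeries.coeff_zero_eq_constantCoeff_apply, hq0, hη]
        · exact ih _ m hm0 (by omega)
      have h6 : q (D.1 U f) = -(oneAddX * PowerSeries.derivative ℂ (q f)) := hd f
      rw [h6, dvd_neg, Units.dvd_mul_left, PowerSeries.X_pow_dvd_iff] at h5
      obtain ⟨m, rfl⟩ := Nat.exists_eq_succ_of_ne_zero hi
      have h7 := h5 m (by omega)
      rw [PowerSeries.coeff_derivative] at h7
      exact (mul_eq_zero.mp h7).resolve_right (by exact_mod_cast Nat.succ_ne_zero m)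
  have hqc' : q = c := by
    ext f i
    have h5 : c f = PowerSeries.C (η f) := rfl
    rw [h5, PowerSeries.coeff_C]
    split_ifs with hi
    · rw [hi, PowerSeries.coeff_zero_eq_constantCoeff_apply, hq0]
    · exact hqc i f i hi le_rfl
  -- The equality over `ℂ⟦X⟧` descends to the whole torus by density and separatedness; it is then
  -- specialized at each `t`.
  have h3 : gmAct a (laurentT ℂ) (chart hU ((Algebra.ofId ℂ (LaurentPolynomial ℂ)).comp η)) =
      chart hU ((Algebra.ofId ℂ (LaurentPolynomial ℂ)).comp η) := by
    refine eq_of_injective_of_isSeparated _ laurentEval_oneAddX_injective ?_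
    rw [specMap_gmAct, map_laurentEval_T, specMap_chart, ← AlgHom.comp_assoc,
      Subsingleton.elim ((laurentEval _ _).comp _) (Algebra.ofId ℂ (PowerSeries ℂ)), hq, hqc']
  rw [GroupAction.mem_fixedPoints]
  intro (t : ℂˣ)
  change gmAct a t _ = _
  have h4 := congrArg (specMap (laurentEval (AlgHom.id ℂ ℂ) t) ≫ ·) h3
  simp only [specMap_gmAct, specMap_chart] at h4
  rw [map_laurentEval_T, ← AlgHom.comp_assoc, Subsingleton.elim ((laurentEval _ _).comp _)
    (AlgHom.id ℂ ℂ), AlgHom.id_comp] at h4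
  exact h4

end PowerSeries

end SLTwoVariety

/-! ### Derivations on infinitesimal neighbourhoods of a point -/

namespace SLTwoVariety

section CotangentAlgebra

variable {B : Type} [CommRing B] [Algebra ℂ B] (χ : B →ₐ[ℂ] ℂ)

/-- The quotients by powers of the ideal of a `ℂ`-point are finite dimensional. -/
lemma finite_quotient_ker_pow [Algebra.FiniteType ℂ B] (k : ℕ) :
    Module.Finite ℂ (B ⧸ RingHom.ker χ ^ k) := by
  have hm : (RingHom.ker χ).IsMaximal :=
    RingHom.ker_isMaximal_of_surjective χ.toRingHom fun c ↦ ⟨algebraMap ℂ B c, by simp⟩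
  rw [Module.finite_iff_krullDimLE_zero, Ring.krullDimLE_zero_iff]
  intro P hP
  have h1 : RingHom.ker χ ≤ P.comap (Ideal.Quotient.mk (RingHom.ker χ ^ k)) := by
    intro f hf
    have : (Ideal.Quotient.mk (RingHom.ker χ ^ k) f) ^ k = 0 := by
      rw [← map_pow]
      exact Ideal.Quotient.eq_zero_iff_mem.mpr (Ideal.pow_mem_pow hf k)
    exact hP.mem_of_pow_mem k (this ▸ P.zero_mem)
  have h2 := hm.eq_of_le (Ideal.comap_ne_top _ hP.ne_top) h1
  have h3 := Ideal.map_eq_top_or_isMaximal_of_surjective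
    (Ideal.Quotient.mk (RingHom.ker χ ^ k)) Ideal.Quotient.mk_surjective (h2 ▸ hm)
  rw [Ideal.map_comap_of_surjective _ Ideal.Quotient.mk_surjective] at h3
  exact h3.resolve_left hP.ne_top

lemma sub_mem_ker (f : B) : f - algebraMap ℂ B (χ f) ∈ RingHom.ker χ := by
  simp [RingHom.mem_ker]

variable {χ} in
lemma map_sq_eq_zero_of_derivation {θ : B →ₗ[ℂ] ℂ}
    (hθ : ∀ f g, θ (f * g) = χ f * θ g + χ g * θ f) {f : B} (hf : f ∈ RingHom.ker χ ^ 2) :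
    θ f = 0 := by
  rw [pow_two] at hf
  induction hf using Submodule.mul_induction_on' with
  | mem_mul_mem a ha b hb =>
    rw [hθ, (show χ a = 0 from ha), (show χ b = 0 from hb)]
    simp
  | add a _ b _ ha hb => rw [map_add, ha, hb, add_zero]

variable {χ} in
lemma map_one_eq_zero_of_derivation {θ : B →ₗ[ℂ] ℂ}
    (hθ : ∀ f g, θ (f * g) = χ f * θ g + χ g * θ f) : θ 1 = 0 := by
  have := hθ 1 1
  simpa using this

variable {χ} in
-- Expand the product of `f - χ f` and `g - χ g`, which lies in `𝔪²`.
lemma derivation_of_map_sq_eq_zero {θ : B →ₗ[ℂ] ℂ} (h1 : θ 1 = 0)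
    (h2 : ∀ f ∈ RingHom.ker χ ^ 2, θ f = 0) (f g : B) :
    θ (f * g) = χ f * θ g + χ g * θ f := by
  have h := h2 _ (pow_two (RingHom.ker χ) ▸ Ideal.mul_mem_mul (sub_mem_ker χ f) (sub_mem_ker χ g))
  have e : (f - algebraMap ℂ B (χ f)) * (g - algebraMap ℂ B (χ g)) =
      f * g - (χ f) • g - (χ g) • f + (χ f * χ g) • 1 := by
    simp only [Algebra.smul_def, map_mul]
    ring
  rw [e] at h
  simp only [map_add, map_sub, map_smul, h1, smul_eq_mul] at h
  linear_combination h

variable {χ}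

/-- A derivation that maps the ideal of a point to itself preserves its powers. -/
lemma derivation_mem_pow {D : Derivation ℂ B B} (hD : ∀ f, χ f = 0 → χ (D f) = 0) (k : ℕ) {f : B}
    (hf : f ∈ RingHom.ker χ ^ k) : D f ∈ RingHom.ker χ ^ k := by
  induction k generalizing f with
  | zero => simp
  | succ k ih =>
    rw [pow_succ] at hf
    induction hf using Submodule.mul_induction_on' with
    | mem_mul_mem a ha b hb =>
      rw [D.leibniz, smul_eq_mul, smul_eq_mul, pow_succ, mul_comm b]
      exact Ideal.add_mem _ (Ideal.mul_mem_mul ha (hD b hb)) (Ideal.mul_mem_mul (ih ha) hb)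
    | add a _ b _ ha hb => rw [map_add]; exact Ideal.add_mem _ ha hb

/-- The endomorphism of `B ⧸ 𝔪ᵏ` induced by a derivation. -/
def quotientDerivation (D : Derivation ℂ B B) (hD : ∀ f, χ f = 0 → χ (D f) = 0) (k : ℕ) :
    Module.End ℂ (B ⧸ RingHom.ker χ ^ k) :=
  ((RingHom.ker χ ^ k).restrictScalars ℂ).mapQ ((RingHom.ker χ ^ k).restrictScalars ℂ)
    D.toLinearMap (fun _ hf ↦ derivation_mem_pow hD k hf)

lemma quotientDerivation_mk (D : Derivation ℂ B B) (hD : ∀ f, χ f = 0 → χ (D f) = 0) (k : ℕ)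
    (f : B) : quotientDerivation D hD k (Ideal.Quotient.mk _ f) = Ideal.Quotient.mk _ (D f) := rfl

/-- For a semisimple derivation `D` of `B ⧸ 𝔪ᵏ`, every element is the sum of an element of the
kernel of `D` and an element of its range. -/
lemma exists_sub_sub_mem [Algebra.FiniteType ℂ B] {D : Derivation ℂ B B}
    (hD : ∀ f, χ f = 0 → χ (D f) = 0) {k : ℕ}
    (hs : ∀ g, D (D g) ∈ RingHom.ker χ ^ k → D g ∈ RingHom.ker χ ^ k) (f : B) :
    ∃ g u, D g ∈ RingHom.ker χ ^ k ∧ f - g - D u ∈ RingHom.ker χ ^ k := by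
  have := finite_quotient_ker_pow χ k
  let T := quotientDerivation D hD k
  obtain ⟨n, hn⟩ := (LinearMap.eventually_isCompl_ker_pow_range_pow T).exists_forall_of_atTop
  -- Semisimplicity collapses the generalized kernel in the Fitting decomposition to the kernel.
  have hT : ∀ j v, (T ^ (j + 1)) v = 0 → T v = 0 := by
    intro j
    induction j with
    | zero => intro v hv; simpa using hv
    | succ j ih =>
      intro v hv
      have h1 : T (T v) = 0 := ih (T v) (by rw [pow_succ] at hv; exact hv)
      obtain ⟨g, rfl⟩ := Ideal.Quotient.mk_surjective v
      exact Ideal.Quotient.eq_zero_iff_mem.mpr (hs g (Ideal.Quotient.eq_zero_iff_mem.mp h1))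
  have h := (hn (n + 1) (by omega)).sup_eq_top
  have hf : Ideal.Quotient.mk (RingHom.ker χ ^ k) f ∈
    LinearMap.ker (T ^ (n + 1)) ⊔ LinearMap.range (T ^ (n + 1)) := h ▸ Submodule.mem_top
  obtain ⟨v, hv, _, ⟨w, rfl⟩, hvw⟩ := Submodule.mem_sup.mp hf
  obtain ⟨g, rfl⟩ := Ideal.Quotient.mk_surjective v
  obtain ⟨u, hu⟩ := Ideal.Quotient.mk_surjective ((T ^ n) w)
  refine ⟨g, u, Ideal.Quotient.eq_zero_iff_mem.mp (hT n _ hv), ?_⟩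
  rw [← Ideal.Quotient.eq_zero_iff_mem, map_sub, map_sub, ← hvw, pow_succ', Module.End.mul_apply,
    ← hu]
  rw [add_sub_cancel_left]
  exact sub_self _

end CotangentAlgebra

end SLTwoVariety

/-! ### Truncated arcs annihilated by a semisimple derivation -/

namespace SLTwoVariety

/-- The truncated polynomial ring `ℂ[s] ⧸ (sᵏ)`. -/
def Trunc (k : ℕ) : Type := Polynomial ℂ ⧸ Ideal.span {(Polynomial.X : Polynomial ℂ) ^ k}

instance (k : ℕ) : CommRing (Trunc k) :=
  inferInstanceAs (CommRing (Polynomial ℂ ⧸ Ideal.span {(Polynomial.X : Polynomial ℂ) ^ k}))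

instance (k : ℕ) : Algebra ℂ (Trunc k) :=
  inferInstanceAs (Algebra ℂ (Polynomial ℂ ⧸ Ideal.span {(Polynomial.X : Polynomial ℂ) ^ k}))

/-- The quotient map. -/
def truncMk (k : ℕ) : Polynomial ℂ →ₐ[ℂ] Trunc k :=
  Ideal.Quotient.mkₐ ℂ (Ideal.span {(Polynomial.X : Polynomial ℂ) ^ k})

lemma truncMk_surjective (k : ℕ) : Function.Surjective (truncMk k) :=
  Ideal.Quotient.mkₐ_surjective _ _

lemma truncMk_eq_zero {k : ℕ} {p : Polynomial ℂ} : truncMk k p = 0 ↔ Polynomial.X ^ k ∣ p :=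
  Ideal.Quotient.eq_zero_iff_mem.trans Ideal.mem_span_singleton

/-- The class of the variable. -/
def truncX (k : ℕ) : Trunc k := truncMk k Polynomial.X

/-- The truncation map. -/
def truncMap (k : ℕ) : Trunc (k + 1) →ₐ[ℂ] Trunc k :=
  Ideal.Quotient.factorₐ ℂ (Ideal.span_singleton_le_span_singleton.mpr (pow_dvd_pow _ k.le_succ))

lemma truncMap_mk (k : ℕ) (p : Polynomial ℂ) : truncMap k (truncMk (k + 1) p) = truncMk k p := rfl

/-- The constant coefficient. -/
def truncEval (k : ℕ) : Trunc (k + 1) →ₐ[ℂ] ℂ :=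
  Ideal.Quotient.liftₐ _ (Polynomial.aeval 0) (by
    intro p hp
    obtain ⟨q, rfl⟩ := Ideal.mem_span_singleton.mp hp
    simp)

lemma truncEval_mk (k : ℕ) (p : Polynomial ℂ) :
    truncEval k (truncMk (k + 1) p) = Polynomial.aeval 0 p := rfl

lemma truncEval_truncX (k : ℕ) : truncEval k (truncX (k + 1)) = 0 := by
  rw [truncX, truncEval_mk, Polynomial.aeval_X]

/-- The leading coefficient. -/
def truncCoeff (k : ℕ) : Trunc (k + 1) →ₗ[ℂ] ℂ :=
  ((Ideal.span {(Polynomial.X : Polynomial ℂ) ^ (k + 1)}).restrictScalars ℂ).liftQ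
    (Polynomial.lcoeff ℂ k) (by
      intro p hp
      obtain ⟨q, rfl⟩ := Ideal.mem_span_singleton.mp hp
      rw [LinearMap.mem_ker, Polynomial.lcoeff_apply, Polynomial.coeff_X_pow_mul']
      simp)

lemma truncCoeff_mk (k : ℕ) (p : Polynomial ℂ) : truncCoeff k (truncMk (k + 1) p) = p.coeff k := rfl

lemma truncCoeff_truncX_pow (k : ℕ) : truncCoeff k (truncX (k + 1) ^ k) = 1 := by
  rw [truncX, ← map_pow, truncCoeff_mk]
  simp

lemma truncMap_truncX (k : ℕ) : truncMap k (truncX (k + 1)) = truncX k := rfl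

lemma truncX_pow_self (k : ℕ) : truncX k ^ k = 0 := by
  rw [truncX, ← map_pow, truncMk_eq_zero]

lemma truncX_dvd_iff (k : ℕ) (p : Trunc (k + 1)) : truncX (k + 1) ∣ p ↔ truncEval k p = 0 := by
  refine ⟨fun ⟨q, hq⟩ ↦ by rw [hq, map_mul, truncEval_truncX, zero_mul], fun h ↦ ?_⟩
  obtain ⟨q, rfl⟩ := truncMk_surjective _ p
  rw [truncEval_mk, ← Polynomial.coeff_zero_eq_aeval_zero] at h
  exact map_dvd _ (Polynomial.X_dvd_iff.mpr h)

lemma eq_truncCoeff_smul (k : ℕ) {p : Trunc (k + 1)} (hp : truncMap k p = 0) :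
    p = truncCoeff k p • truncX (k + 1) ^ k := by
  obtain ⟨q, rfl⟩ := truncMk_surjective _ p
  rw [truncMap_mk, truncMk_eq_zero] at hp
  obtain ⟨r, rfl⟩ := hp
  rw [truncCoeff_mk, Polynomial.coeff_X_pow_mul', if_pos le_rfl, Nat.sub_self, truncX, ← map_pow,
    ← map_smul, ← sub_eq_zero, ← map_sub, truncMk_eq_zero]
  refine ⟨r.divX, ?_⟩
  conv_lhs => rw [← Polynomial.X_mul_divX_add r]
  rw [Polynomial.smul_eq_C_mul]
  simp only [Polynomial.coeff_add, Polynomial.mul_coeff_zero, Polynomial.coeff_X_zero, zero_mul,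
    Polynomial.coeff_C_zero, zero_add]
  ring

lemma mul_truncX_pow (k : ℕ) (p : Trunc (k + 1)) :
    p * truncX (k + 1) ^ k = truncEval k p • truncX (k + 1) ^ k := by
  have h1 : truncX (k + 1) ∣ p - algebraMap ℂ _ (truncEval k p) := by
    rw [truncX_dvd_iff, map_sub, AlgHom.commutes, Algebra.algebraMap_self_apply, sub_self]
  obtain ⟨q, hq⟩ := h1
  have h2 := truncX_pow_self (k + 1)
  rw [pow_succ] at h2
  rw [Algebra.smul_def, ← sub_eq_zero, ← sub_mul, hq, mul_right_comm, mul_comm (truncX _), h2,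
    zero_mul]

lemma truncEval_truncMap (k : ℕ) (p : Trunc (k + 2)) :
    truncEval k (truncMap (k + 1) p) = truncEval (k + 1) p := by
  obtain ⟨q, rfl⟩ := truncMk_surjective _ p
  rw [truncMap_mk, truncEval_mk, truncEval_mk]

lemma truncMap_surjective (k : ℕ) : Function.Surjective (truncMap k) :=
  Ideal.Quotient.factor_surjective
    (Ideal.span_singleton_le_span_singleton.mpr (pow_dvd_pow _ k.le_succ))

lemma isNilpotent_ker_truncMap (k : ℕ) (hk : k ≠ 0) : IsNilpotent (RingHom.ker (truncMap k)) := by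
  have h1 : RingHom.ker (truncMap k) ≤ Ideal.span {truncX (k + 1) ^ k} := fun p hp ↦ by
    rw [eq_truncCoeff_smul k hp]
    exact Submodule.smul_of_tower_mem _ _ (Ideal.mem_span_singleton_self _)
  refine ⟨2, le_bot_iff.mp ((Ideal.pow_right_mono h1 2).trans ?_)⟩
  rw [Ideal.span_singleton_pow, ← pow_mul,
    pow_eq_zero_of_le (show k + 1 ≤ k * 2 by omega) (truncX_pow_self (k + 1))]
  simp

variable {B : Type} [CommRing B] [Algebra ℂ B] {χ : B →ₐ[ℂ] ℂ}

/-- By duality, a functional factors through the map induced by `D` to `B ⧸ (ℂ + 𝔪²)` once it kills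
the kernel. Since `D f` lies in `𝔪`, that kernel consists of the `f` with `D f ∈ 𝔪²`. -/
lemma exists_functional_comp_eq {D : Derivation ℂ B B} {δ : B →ₗ[ℂ] ℂ}
    (hδ : ∀ f, χ (D f) = 0 → D f ∈ RingHom.ker χ ^ 2 → δ f = 0)
    (hD : ∀ f, χ (D f) = 0) :
    ∃ θ : B →ₗ[ℂ] ℂ, (∀ f g, θ (f * g) = χ f * θ g + χ g * θ f) ∧ ∀ f, θ (D f) = δ f := by
  let W : Submodule ℂ B := Submodule.span ℂ {1} ⊔ (RingHom.ker χ ^ 2).restrictScalars ℂ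
  let T : B →ₗ[ℂ] B ⧸ W := W.mkQ ∘ₗ D.toLinearMap
  have h : δ ∈ LinearMap.range T.dualMap := by
    rw [LinearMap.range_dualMap_eq_dualAnnihilator_ker, Submodule.mem_dualAnnihilator]
    intro f hf
    have h1 : D f ∈ W := (Submodule.Quotient.mk_eq_zero W).mp hf
    obtain ⟨_, h2, g, hg, h3⟩ := Submodule.mem_sup.mp h1
    obtain ⟨c, rfl⟩ := Submodule.mem_span_singleton.mp h2
    have h4 : χ g = 0 := Ideal.pow_le_self two_ne_zero hg
    have h5 := congrArg χ h3
    rw [map_add, map_smul, map_one, h4, hD] at h5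
    have h6 : c = 0 := by simpa using h5
    rw [h6, zero_smul, zero_add] at h3
    exact hδ f (hD f) (h3 ▸ hg)
  obtain ⟨θ, rfl⟩ := h
  refine ⟨θ ∘ₗ W.mkQ, derivation_of_map_sq_eq_zero ?_ fun f hf ↦ ?_, fun f ↦ rfl⟩
  · have : W.mkQ 1 = 0 := (Submodule.Quotient.mk_eq_zero W).mpr
      (Submodule.mem_sup_left (Submodule.mem_span_singleton_self 1))
    rw [LinearMap.comp_apply, this, map_zero]
  · have : W.mkQ f = 0 := (Submodule.Quotient.mk_eq_zero W).mpr (Submodule.mem_sup_right hf)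
    rw [LinearMap.comp_apply, this, map_zero]

/-- Lifting a truncated curve that is killed by a semisimple derivation. -/
lemma exists_lift_trunc [Algebra.FormallySmooth ℂ B] [Algebra.FiniteType ℂ B]
    {D : Derivation ℂ B B} (hD : ∀ f, χ (D f) = 0)
    (hs : ∀ k g, D (D g) ∈ RingHom.ker χ ^ k → D g ∈ RingHom.ker χ ^ k) {k : ℕ}
    (φ : B →ₐ[ℂ] Trunc (k + 1)) (hφ : (truncEval k).comp φ = χ) (hφD : ∀ f, φ (D f) = 0) :
    ∃ φ' : B →ₐ[ℂ] Trunc (k + 2), (truncMap (k + 1)).comp φ' = φ ∧ ∀ f, φ' (D f) = 0 := by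
  let ψ : B →ₐ[ℂ] Trunc (k + 2) := Algebra.FormallySmooth.liftOfSurjective φ (truncMap (k + 1))
    (truncMap_surjective _) (isNilpotent_ker_truncMap _ k.succ_ne_zero)
  have hψ (f) : truncMap (k + 1) (ψ f) = φ f :=
    Algebra.FormallySmooth.liftOfSurjective_apply φ _ _ _ f
  let x : Trunc (k + 2) := truncX (k + 2)
  -- The lift `ψ` from formal smoothness need not kill the image of `D`; `δ` measures the defect and
  -- is a `χ`-derivation.
  let δ : B →ₗ[ℂ] ℂ := truncCoeff (k + 1) ∘ₗ ψ.toLinearMap ∘ₗ D.toLinearMap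
  have hδ (f) : ψ (D f) = δ f • x ^ (k + 1) :=
    eq_truncCoeff_smul (k + 1) (by rw [hψ, hφD])
  have hψ0 (f) : truncEval (k + 1) (ψ f) = χ f := by
    rw [← truncEval_truncMap, hψ]
    exact DFunLike.congr_fun hφ f
  have hψx (f) : ψ f * x ^ (k + 1) = χ f • x ^ (k + 1) := by rw [mul_truncX_pow, hψ0]
  have hx : x ^ (k + 1) * x ^ (k + 1) = 0 := by
    have := pow_eq_zero_of_le (show k + 2 ≤ k + 1 + (k + 1) by omega) (truncX_pow_self (k + 2))
    rwa [pow_add] at this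
  have hx0 : x ^ (k + 1) ≠ 0 := fun h ↦ by
    have := truncCoeff_truncX_pow (k + 1)
    rw [show truncX (k + 1 + 1) ^ (k + 1) = 0 from h, map_zero] at this
    exact zero_ne_one this
  have hδd (f g) : δ (f * g) = χ f * δ g + χ g * δ f := by
    apply smul_left_injective ℂ hx0
    change δ (f * g) • x ^ (k + 1) = (χ f * δ g + χ g * δ f) • x ^ (k + 1)
    rw [← hδ, D.leibniz, smul_eq_mul, smul_eq_mul, map_add, map_mul, map_mul, hδ, hδ, mul_smul_comm,
      mul_smul_comm, hψx, hψx, smul_smul, smul_smul, ← add_smul, mul_comm (δ g), mul_comm (δ f)]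
  have hψk (f) (hf : f ∈ RingHom.ker χ ^ (k + 2)) : ψ f = 0 := by
    have h1 : (RingHom.ker χ).map ψ ≤ Ideal.span {x} := by
      rw [Ideal.map_le_iff_le_comap]
      intro g hg
      rw [Ideal.mem_comap, Ideal.mem_span_singleton, truncX_dvd_iff, hψ0]
      exact hg
    have h2 := Ideal.pow_right_mono h1 (k + 2)
      (Ideal.map_pow ψ _ (k + 2) ▸ Ideal.mem_map_of_mem ψ hf)
    rw [Ideal.span_singleton_pow, show x ^ (k + 2) = 0 from truncX_pow_self _] at h2
    simpa using h2
  -- Subtracting `θ f • x ^ (k + 1)` repairs the lift exactly when `θ ∘ D = δ`.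
  obtain ⟨θ, hθ, hθD⟩ : ∃ θ : B →ₗ[ℂ] ℂ, (∀ f g, θ (f * g) = χ f * θ g + χ g * θ f) ∧
      ∀ f, θ (D f) = δ f := by
    refine exists_functional_comp_eq (fun f _ hf ↦ ?_) hD
    -- Write `f` as `g + D u` modulo `𝔪ᵏ⁺²`. Then `δ g = 0` because `ψ` kills `D g`, and `D u ∈ 𝔪²`
    -- by semisimplicity modulo `𝔪²`, where `δ` vanishes.
    obtain ⟨g, u, hg, hu⟩ := exists_sub_sub_mem (fun f _ ↦ hD f) (hs (k + 2)) f
    have h1 : D u ∈ RingHom.ker χ ^ 2 := by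
      refine hs 2 u ?_
      have h2 : D (f - g - D u) ∈ RingHom.ker χ ^ 2 :=
        derivation_mem_pow (fun f _ ↦ hD f) 2 (Ideal.pow_le_pow_right (by omega) hu)
      have h3 : D g ∈ RingHom.ker χ ^ 2 := Ideal.pow_le_pow_right (by omega) hg
      have h4 : D (D u) = D f - D g - D (f - g - D u) := by
        rw [map_sub, map_sub]; ring
      rw [h4]
      exact Ideal.sub_mem _ (Ideal.sub_mem _ hf h3) h2
    have h2 : δ (f - g) = 0 := by
      apply map_sq_eq_zero_of_derivation hδd
      have : f - g = (f - g - D u) + D u := by ring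
      rw [this]
      exact Ideal.add_mem _ (Ideal.pow_le_pow_right (by omega) hu) h1
    have h3 : δ g = 0 := by
      apply smul_left_injective ℂ hx0
      change δ g • x ^ (k + 1) = (0 : ℂ) • x ^ (k + 1)
      rw [← hδ, hψk _ hg, zero_smul]
    rwa [map_sub, h3, sub_zero] at h2
  refine ⟨AlgHom.ofLinearMap (ψ.toLinearMap - (LinearMap.toSpanSingleton ℂ _ (x ^ (k + 1))) ∘ₗ θ)
    ?_ ?_, ?_, ?_⟩
  · simp [map_one_eq_zero_of_derivation hθ]
  · intro f g
    have h1 : (ψ f - θ f • x ^ (k + 1)) * (ψ g - θ g • x ^ (k + 1)) =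
        ψ f * ψ g - θ g • (ψ f * x ^ (k + 1)) - θ f • (ψ g * x ^ (k + 1)) +
          (θ f * θ g) • (x ^ (k + 1) * x ^ (k + 1)) := by
      simp only [Algebra.smul_def, map_mul]
      ring
    change ψ (f * g) - θ (f * g) • x ^ (k + 1) =
      (ψ f - θ f • x ^ (k + 1)) * (ψ g - θ g • x ^ (k + 1))
    rw [h1, hx, hψx, hψx, hθ, map_mul, smul_zero, add_zero, smul_smul, smul_smul, add_smul,
      mul_comm (θ g), mul_comm (θ f)]
    abel
  · ext1 f
    change truncMap (k + 1) (ψ f - θ f • x ^ (k + 1)) = φ f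
    rw [map_sub, map_smul, map_pow, truncMap_truncX, truncX_pow_self, smul_zero, sub_zero, hψ]
  · intro f
    change ψ (D f) - θ (D f) • x ^ (k + 1) = 0
    rw [hδ, hθD, sub_self]

/-- A derivation that annihilates a nonzero cotangent functional, and is semisimple at a point,
does not vanish there in isolation. -/
lemma not_ker_pow_le_span_range [Algebra.FormallySmooth ℂ B] [Algebra.FiniteType ℂ B]
    {D : Derivation ℂ B B} (hD : ∀ f, χ (D f) = 0)
    (hs : ∀ k g, D (D g) ∈ RingHom.ker χ ^ k → D g ∈ RingHom.ker χ ^ k)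
    {θ : B →ₗ[ℂ] ℂ} (hθ : ∀ f g, θ (f * g) = χ f * θ g + χ g * θ f) (hθ0 : θ ≠ 0)
    (hθD : ∀ f, θ (D f) = 0) (N : ℕ) :
    ¬ RingHom.ker χ ^ N ≤ Ideal.span (Set.range D) := by
  intro hN
  -- Arcs modulo `s ^ (k + 2)` through the point, with velocity `θ`, along which `D` vanishes.
  have key (k : ℕ) : ∃ φ : B →ₐ[ℂ] Trunc (k + 2), (truncEval (k + 1)).comp φ = χ ∧
      (∀ f, φ (D f) = 0) ∧ ∀ f, χ f = 0 → truncX (k + 2) ^ 2 ∣ φ f - θ f • truncX (k + 2) := by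
    induction k with
    | zero =>
      refine ⟨AlgHom.ofLinearMap ((Algebra.linearMap ℂ (Trunc 2)) ∘ₗ χ.toLinearMap +
        (LinearMap.toSpanSingleton ℂ _ (truncX 2)) ∘ₗ θ) ?_ ?_, ?_, ?_, ?_⟩
      · simp [map_one_eq_zero_of_derivation hθ]
      · intro f g
        have h := truncX_pow_self 2
        simp only [LinearMap.add_apply, LinearMap.comp_apply, AlgHom.toLinearMap_apply,
          Algebra.linearMap_apply, LinearMap.toSpanSingleton_apply, hθ, map_mul, Algebra.smul_def,
          map_add]
        linear_combination (-(algebraMap ℂ (Trunc 2) (θ f) * algebraMap ℂ (Trunc 2) (θ g))) * h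
      · ext f
        change truncEval 1 (algebraMap ℂ (Trunc 2) (χ f) + θ f • truncX 2) = χ f
        rw [map_add, map_smul, truncEval_truncX, smul_zero, add_zero, AlgHom.commutes,
          Algebra.algebraMap_self_apply]
      · intro f
        change algebraMap ℂ (Trunc 2) (χ (D f)) + θ (D f) • truncX 2 = 0
        rw [hD, hθD, map_zero, zero_smul, add_zero]
      · intro f hf
        change _ ∣ algebraMap ℂ (Trunc 2) (χ f) + θ f • truncX 2 - θ f • truncX 2
        simp [hf]
    | succ k ih =>
      obtain ⟨φ, h1, h2, h3⟩ := ih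
      obtain ⟨φ', h4, h5⟩ := exists_lift_trunc hD hs φ h1 h2
      have h6 (f) : truncMap (k + 2) (φ' f) = φ f := DFunLike.congr_fun h4 f
      refine ⟨φ', ?_, h5, fun f hf ↦ ?_⟩
      · ext f
        change truncEval (k + 2) (φ' f) = χ f
        rw [← truncEval_truncMap, h6]
        exact DFunLike.congr_fun h1 f
      · obtain ⟨a, ha⟩ := h3 f hf
        obtain ⟨b, rfl⟩ := truncMap_surjective (k + 2) a
        have h7 : truncMap (k + 2) (φ' f - θ f • truncX (k + 3) - truncX (k + 3) ^ 2 * b) = 0 := by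
          rw [map_sub, map_sub, map_smul, map_mul, map_pow, truncMap_truncX, h6, ha, sub_self]
        have h8 := eq_truncCoeff_smul _ h7
        rw [sub_eq_iff_eq_add] at h8
        rw [show φ' f - θ f • truncX (k + 1 + 2) = _ from h8]
        refine dvd_add ?_ (Dvd.intro _ rfl)
        rw [Algebra.smul_def]
        exact dvd_mul_of_dvd_right (pow_dvd_pow _ (by omega)) _
  obtain ⟨f, hf⟩ : ∃ f, θ f ≠ 0 := by
    by_contra! h
    exact hθ0 (LinearMap.ext h)
  obtain ⟨φ, h1, h2, h3⟩ := key N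
  let g := f - algebraMap ℂ B (χ f)
  have hg : χ g = 0 := by simp [g]
  have hθg : θ g ≠ 0 := by
    have : θ (algebraMap ℂ B (χ f)) = 0 := by
      rw [Algebra.algebraMap_eq_smul_one, map_smul, map_one_eq_zero_of_derivation hθ, smul_zero]
    rwa [map_sub, this, sub_zero]
  obtain ⟨a, ha⟩ := h3 g hg
  have h4 : φ (g ^ N) = 0 := by
    have : Ideal.span (Set.range D) ≤ RingHom.ker φ :=
      Ideal.span_le.mpr (by rintro _ ⟨f, rfl⟩; exact h2 f)
    exact this (hN (Ideal.pow_mem_pow hg N))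
  have h5 : φ g = truncX (N + 2) * (algebraMap ℂ _ (θ g) + truncX (N + 2) * a) := by
    rw [Algebra.smul_def] at ha
    linear_combination ha
  -- The image of `g ^ N` has leading term `θ g ^ N • s ^ N`; a further factor `s` removes all
  -- higher terms modulo `s ^ (N + 2)`.
  have h6 : truncX (N + 2) ^ (N + 1) = 0 := by
    have h7 := congrArg (truncX (N + 2) * ·) h4
    simp only [map_pow, h5, mul_zero] at h7
    have h8 := mul_truncX_pow (N + 1) ((algebraMap ℂ _ (θ g) + truncX (N + 2) * a) ^ N)
    have h9 : truncEval (N + 1) ((algebraMap ℂ _ (θ g) + truncX (N + 2) * a) ^ N) = θ g ^ N := by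
      rw [map_pow, map_add, map_mul, truncEval_truncX, zero_mul, add_zero, AlgHom.commutes,
        Algebra.algebraMap_self_apply]
    rw [h9] at h8
    have h10 : θ g ^ N • truncX (N + 2) ^ (N + 1) = 0 := by
      rw [← h8, ← h7, mul_pow]
      ring
    exact (smul_eq_zero.mp h10).resolve_left (pow_ne_zero _ hθg)
  have := truncCoeff_truncX_pow (N + 1)
  rw [show truncX (N + 1 + 1) ^ (N + 1) = 0 from h6, map_zero] at this
  exact zero_ne_one this

end SLTwoVariety

namespace SLTwoVariety

/-! ### Geometry of smooth quasi-projective varieties -/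

lemma smooth_section {X : Sch} (h : AlgebraicGeometry.Smooth X.hom) {U : X.left.Opens}
    (hU : IsAffineOpen U) : Algebra.Smooth ℂ Γ(X.left, U) := by
  have h1 := h.smooth_appLE (isAffineOpen_top _) hU le_top
  have h2 : (X.hom.appLE ⊤ U le_top).hom.comp (Scheme.ΓSpecIso (CommRingCat.of ℂ)).inv.hom =
      algebraMap ℂ Γ(X.left, U) := by
    change ((Scheme.ΓSpecIso (CommRingCat.of ℂ)).inv ≫ X.hom.app ⊤ ≫ _).hom = _
    rw [← Category.assoc]
    rfl
  have h3 := RingHom.Smooth.respectsIso.2 _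
    (Scheme.ΓSpecIso (CommRingCat.of ℂ)).commRingCatIsoToRingEquiv.symm h1
  have h4 : (algebraMap ℂ Γ(X.left, U)).Smooth := h2 ▸ h3
  exact (RingHom.smooth_algebraMap).mp h4

lemma IsQuasiProjective.isSeparated {X : Sch} (h : IsQuasiProjective X) : IsSeparated X.hom := by
  obtain ⟨n, i, hi⟩ := h
  rw [← Over.w i]
  have : IsSeparated (projectiveSpace n).hom := by
    let := MvPolynomial.gradedAlgebra (σ := Fin (n + 1)) (R := ℂ)
    change IsSeparated (Proj.toSpecZero (MvPolynomial.homogeneousSubmodule (Fin (n + 1)) ℂ) ≫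
      Spec.map (CommRingCat.ofHom (algebraMap ℂ
        (MvPolynomial.homogeneousSubmodule (Fin (n + 1)) ℂ 0))))
    infer_instance
  infer_instance

/-! ### The Lie algebra `𝔰𝔩₂` -/

attribute [local instance] LieRing.ofAssociativeRing

/-- The element `E` of `𝔰𝔩₂`. -/
def slE : slTwo := ⟨!![0, 1; 0, 0], by simp [LieAlgebra.SpecialLinear.sl, Matrix.trace_fin_two]⟩

/-- The element `F` of `𝔰𝔩₂`. -/
def slF : slTwo := ⟨!![0, 0; 1, 0], by simp [LieAlgebra.SpecialLinear.sl, Matrix.trace_fin_two]⟩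

lemma lie_slE_slF : ⁅slE, slF⁆ = slH := by
  apply Subtype.ext
  rw [LieSubalgebra.coe_bracket, Ring.lie_def]
  simp [slE, slF, slH]

lemma lie_slH_slE : ⁅slH, slE⁆ = 2 • slE := by
  apply Subtype.ext
  rw [LieSubalgebra.coe_bracket, Ring.lie_def]
  ext i j
  fin_cases i <;> fin_cases j <;> (simp [slE, slH]; try norm_num)

lemma lie_slH_slF : ⁅slH, slF⁆ = -(2 • slF) := by
  apply Subtype.ext
  rw [LieSubalgebra.coe_bracket, Ring.lie_def]
  ext i j
  fin_cases i <;> fin_cases j <;> (simp [slF, slH]; try norm_num)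

lemma slTwo_eq (ξ : slTwo) : ξ = ξ.1 0 0 • slH + ξ.1 0 1 • slE + ξ.1 1 0 • slF := by
  have h : Matrix.trace ξ.1 = 0 := ξ.2
  rw [Matrix.trace_fin_two] at h
  apply Subtype.ext
  ext i j
  fin_cases i <;> fin_cases j <;> simp [slE, slF, slH]
  linear_combination h

/-- Raising a weight vector gives a primitive vector. -/
lemma exists_hasPrimitiveVectorWith {V : Type*} [AddCommGroup V] [Module ℂ V] [Module.Finite ℂ V]
    {h e f : Module.End ℂ V} (t : IsSl2Triple h e f) {μ : ℂ} {v : V} (hv : v ≠ 0)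
    (hhv : h v = μ • v) : ∃ k : ℕ, t.HasPrimitiveVectorWith ((e ^ k) v) (μ + 2 * k) := by
  have h1 (k : ℕ) : h ((e ^ k) v) = (μ + 2 * k) • (e ^ k) v := by
    induction k with
    | zero => simpa using hhv
    | succ k ih =>
      rw [pow_succ', Module.End.mul_apply]
      have h2 := LinearMap.congr_fun t.lie_h_e_nsmul ((e ^ k) v)
      rw [Ring.lie_def, LinearMap.sub_apply, Module.End.mul_apply, Module.End.mul_apply, ih,
        map_smul, sub_eq_iff_eq_add] at h2
      rw [h2, LinearMap.smul_apply, ← Nat.cast_smul_eq_nsmul ℂ, ← add_smul]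
      congr 1
      push_cast
      ring
  have h2 : ∃ k, (e ^ k) v = 0 := by
    -- Otherwise the vectors `(e ^ k) v` have infinitely many distinct eigenvalues.
    by_contra! hc
    have hs : (Set.range fun k : ℕ ↦ μ + 2 * k).Infinite :=
      Set.infinite_range_of_injective fun i j hij ↦ by simpa using hij
    refine hs (h.eigenvectors_linearIndependent _ (fun s ↦ (e ^ Classical.choose s.2) v)
      fun s ↦ ⟨?_, hc _⟩).finite
    have h3 : μ + 2 * (Classical.choose s.2 : ℕ) = s := Classical.choose_spec s.2
    rw [Module.End.mem_eigenspace_iff, h1, h3]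
  obtain ⟨k, hk, hk'⟩ := Nat.exists_not_and_succ_of_not_zero_of_exists (p := fun k ↦ (e ^ k) v = 0)
    hv h2
  exact ⟨k, hk, h1 k, by rw [pow_succ', Module.End.mul_apply] at hk'; exact hk'⟩

/-- If an `𝔰𝔩₂`-module has an even weight then it has the weight zero. -/
lemma exists_weight_zero {V : Type*} [AddCommGroup V] [Module ℂ V] [Module.Finite ℂ V]
    {h e f : Module.End ℂ V} (hef : ⁅e, f⁆ = h) (hhe : ⁅h, e⁆ = 2 • e) (hhf : ⁅h, f⁆ = -(2 • f))
    {n : ℤ} (hn : Even n) {v : V} (hv : v ≠ 0) (hhv : h v = (n : ℂ) • v) :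
    ∃ w ≠ 0, h w = 0 := by
  -- `IsSl2Triple` requires `h ≠ 0`; for `h = 0` the vector `v` itself has weight zero.
  rcases eq_or_ne h 0 with rfl | h0
  · exact ⟨v, hv, rfl⟩
  obtain ⟨k, P⟩ := exists_hasPrimitiveVectorWith ⟨h0, hef, hhe, hhf⟩ hv hhv
  obtain ⟨m, hm⟩ := P.exists_nat
  obtain ⟨j, hj⟩ : Even (m : ℤ) := by
    have : (m : ℤ) = n + 2 * k := by exact_mod_cast hm.symm
    rw [this]
    exact hn.add (even_two_mul _)
  -- Lowering the highest weight `m = 2 j` exactly `j` times reaches weight zero, with a nonzero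
  -- vector because `j ≤ m`.
  have hjm : j.toNat ≤ m := by omega
  refine ⟨_, P.pow_toEnd_f_ne_zero_of_eq_nat hm hjm, ?_⟩
  refine (P.lie_h_pow_toEnd_f j.toNat).trans ?_
  have : (n : ℂ) + 2 * k - 2 * j.toNat = 0 := by
    rw [hm]
    have : (m : ℤ) = 2 * j.toNat := by omega
    have h3 : (m : ℂ) = 2 * (j.toNat : ℂ) := by exact_mod_cast this
    rw [h3, sub_self]
  rw [this, zero_smul]

/-! ### Cotangent functionals -/

section
variable {B : Type} [CommRing B] [Algebra ℂ B] (χ : B →ₐ[ℂ] ℂ)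

/-- The space of `χ`-derivations `B → ℂ`. -/
def tangentFunctionals : Submodule ℂ (Module.Dual ℂ B) where
  carrier := {θ | ∀ f g, θ (f * g) = χ f * θ g + χ g * θ f}
  add_mem' {θ η} hθ hη f g := by
    rw [LinearMap.add_apply, hθ, hη, LinearMap.add_apply, LinearMap.add_apply]; ring
  zero_mem' f g := by simp
  smul_mem' c θ hθ f g := by
    rw [LinearMap.smul_apply, hθ, LinearMap.smul_apply, LinearMap.smul_apply]
    simp only [smul_eq_mul]; ring

/-- A `χ`-derivation kills `𝔪²`, hence is a functional on the finite-dimensional `B ⧸ 𝔪²`. -/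
instance [Algebra.FiniteType ℂ B] : Module.Finite ℂ (tangentFunctionals χ) := by
  have := finite_quotient_ker_pow χ 2
  let W := (RingHom.ker χ ^ 2).restrictScalars ℂ
  have : Module.Finite ℂ (B ⧸ W) := this
  have : Module.Finite ℂ W.dualAnnihilator := Module.Finite.equiv W.dualQuotEquivDualAnnihilator
  refine Submodule.finiteDimensional_of_le (S₂ := W.dualAnnihilator) fun θ hθ ↦ ?_
  rw [Submodule.mem_dualAnnihilator]
  exact fun f hf ↦ map_sq_eq_zero_of_derivation hθ hf

variable {χ}

/-- The contragredient action of a derivation that vanishes at a point on the tangent space. -/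
def tangentAction (D : Derivation ℂ B B) (hD : ∀ f, χ (D f) = 0) :
    Module.End ℂ (tangentFunctionals χ) where
  toFun θ := ⟨-(θ.1 ∘ₗ D.toLinearMap), fun f g ↦ by
    change -θ.1 (D (f * g)) = χ f * -θ.1 (D g) + χ g * -θ.1 (D f)
    rw [D.leibniz, smul_eq_mul, smul_eq_mul, map_add, θ.2, θ.2, hD, hD]
    ring⟩
  map_add' θ η := Subtype.ext (by ext f; simp; ring)
  map_smul' c θ := Subtype.ext (by ext f; simp)

lemma tangentAction_apply (D : Derivation ℂ B B) (hD : ∀ f, χ (D f) = 0)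
    (θ : tangentFunctionals χ) (f : B) : (tangentAction D hD θ).1 f = -θ.1 (D f) := rfl

/-- The minus sign offsets the reversal of order under precomposition, so brackets are preserved. -/
lemma tangentAction_lie (D D' : Derivation ℂ B B) (hD : ∀ f, χ (D f) = 0)
    (hD' : ∀ f, χ (D' f) = 0) (h : ∀ f, χ (⁅D, D'⁆ f) = 0) :
    ⁅tangentAction D hD, tangentAction D' hD'⁆ = tangentAction ⁅D, D'⁆ h := by
  ext θ f
  rw [tangentAction_apply, Derivation.commutator_apply, map_sub, neg_sub]
  change (tangentAction D hD (tangentAction D' hD' θ)).1 f -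
    (tangentAction D' hD' (tangentAction D hD θ)).1 f = _
  simp only [tangentAction_apply, neg_neg]

end

/-! ### Isolated fixed points in the zero locus -/

namespace SLTwoTAction

variable {X : Sch} (a : SLTwoTAction X) {U : X.left.Opens}

/-- The derivation of the regular functions on `U` given by an element of `𝔰𝔩₂`. -/
def der (U : X.left.Opens) (ξ : slTwo) : Derivation ℂ Γ(X.left, U) Γ(X.left, U) :=
  (a.lieHom ξ).1 U

lemma der_lie (ξ η : slTwo) : a.der U ⁅ξ, η⁆ = ⁅a.der U ξ, a.der U η⁆ := by
  rw [der, LieHom.map_lie]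
  rfl

lemma der_add (ξ η : slTwo) : a.der U (ξ + η) = a.der U ξ + a.der U η := by
  rw [der, map_add]
  rfl

lemma der_smul (c : ℂ) (ξ : slTwo) : a.der U (c • ξ) = c • a.der U ξ := by
  rw [der, map_smul]
  rfl

lemma der_eq_zero_of_mem_zeroLocus (hU : IsAffineOpen U) {χ : Γ(X.left, U) →ₐ[ℂ] ℂ}
    (hx : chart hU χ ∈ a.zeroLocus) (ξ : slTwo) (f : Γ(X.left, U)) : χ (a.der U ξ f) = 0 := by
  have := hx ξ U f (pos_chart_mem hU χ)
  rw [pos_chart_mem_basicOpen] at this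
  exact not_not.mp this

/-- An even weight would produce a tangent vector of weight zero, and by smoothness the fixed locus
would be positive-dimensional in its direction. -/
theorem odd_of_mem_zeroLocus (hs : AlgebraicGeometry.Smooth X.hom) [IsSeparated X.hom] {x : Pt X}
    (hx : a.torusAction.IsIsolatedFixedPoint x) (hx0 : x ∈ a.zeroLocus) {n : ℤ}
    (hn : IsTangentWeight a.torusAction x n) : Odd n := by
  rw [← Int.not_even_iff_odd]
  intro hev
  obtain ⟨hxf, W, hxW, hW⟩ := hx
  obtain ⟨U, hU, hxU, hUW⟩ := exists_affine_nhds x.pos W hxW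
  obtain ⟨χ, rfl⟩ := exists_pt_eq_chart hU x hxU
  have := smooth_section hs hU
  have hft : Algebra.FiniteType ℂ Γ(X.left, U) := inferInstance
  have h0 (ξ) (f) := a.der_eq_zero_of_mem_zeroLocus hU hx0 ξ f
  obtain ⟨θ, hθ, hθ0, hθn⟩ := exists_of_isTangentWeight hU a.torusAction a.differential hxf hn
  let ρ (ξ : slTwo) := tangentAction (a.der U ξ) (h0 ξ)
  have hρ (ξ η : slTwo) : ⁅ρ ξ, ρ η⁆ = ρ ⁅ξ, η⁆ := by
    simp only [ρ, a.der_lie]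
    exact tangentAction_lie _ _ _ _ _
  have hρ2 (ξ : slTwo) : ρ (2 • ξ) = 2 • ρ ξ := by
    ext θ f
    have : a.der U (2 • ξ) = (2 : ℂ) • a.der U ξ := by
      rw [← a.der_smul, ← Nat.cast_smul_eq_nsmul ℂ]; rfl
    simp only [ρ, tangentAction_apply, this]
    rw [two_smul ℕ]
    change _ = -θ.1 _ + -θ.1 _
    simp; ring
  have hρn (ξ : slTwo) : ρ (-ξ) = -ρ ξ := by
    ext θ f
    have : a.der U (-ξ) = (-1 : ℂ) • a.der U ξ := by rw [← a.der_smul, neg_one_smul]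
    simp only [ρ, tangentAction_apply, this]
    change _ = - -θ.1 _
    simp
  obtain ⟨⟨θ', hθ'⟩, hθ0', hH⟩ := exists_weight_zero (h := ρ slH) (e := ρ slE) (f := ρ slF)
    (by rw [hρ, lie_slE_slF]) (by rw [hρ, lie_slH_slE, hρ2])
    (by rw [hρ, lie_slH_slF, hρn, hρ2]) hev (v := ⟨θ, hθ⟩) (fun h ↦ hθ0 (congrArg Subtype.val h))
    (Subtype.ext (by
      ext f
      change -θ (a.der U slH f) = n * θ f
      rw [show θ (a.der U slH f) = _ from hθn f]
      ring))
  have hH' (f) : θ' (a.der U slH f) = 0 := by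
    have := LinearMap.congr_fun (congrArg Subtype.val hH) f
    exact neg_eq_zero.mp this
  let I := Ideal.span (Set.range (a.der U slH))
  have hJ : IsJacobsonRing Γ(X.left, U) := isJacobsonRing_of_finiteType (A := ℂ)
  -- By the Nullstellensatz it suffices to look at `ℂ`-points killing `I`. The field vanishes there,
  -- so they are torus-fixed, and isolation leaves only `χ`.
  have hrad : RingHom.ker χ ≤ I.radical := by
    rw [← hJ.out (I.radical_isRadical)]
    refine le_sInf fun J ⟨hIJ, hJm⟩ ↦ ?_
    obtain ⟨η, rfl⟩ := exists_ker_eq_of_isMaximal J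
    have h1 := mem_fixedPoints_of_field_eq_zero hU a.torusAction a.differential (η := η)
      fun f ↦ hIJ (Ideal.le_radical (Ideal.subset_span ⟨f, rfl⟩))
    rw [chart_injective hU (hW _ h1 (hUW (pos_chart_mem hU η)))]
  have : IsNoetherianRing Γ(X.left, U) := Algebra.FiniteType.isNoetherianRing ℂ _
  obtain ⟨N, hN⟩ := Ideal.exists_pow_le_of_le_radical_of_fg hrad
    (IsNoetherian.noetherian (RingHom.ker χ))
  refine not_ker_pow_le_span_range (h0 slH) (fun k g hg ↦ ?_) hθ'
    (fun h ↦ hθ0' (Subtype.ext h)) hH' N hN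
  exact apply_field_mem_pow hU a.torusAction a.differential hxf k hg

end SLTwoTAction

end SLTwoVariety

/-! ### Odd weights force the vector fields to vanish -/

namespace SLTwoVariety

section

variable {A : Type} [CommRing A] [Algebra ℂ A] {X Y : Sch}

lemma GroupAction.smulConst_smulConst_inv {G : CommRingCat.{0} ⥤ GrpCat.{0}}
    (a : GroupAction G X) (g : G.obj (CommRingCat.of ℂ)) (z : specOver A ⟶ X) :
    a.smulConst g (a.smulConst g⁻¹ z) = z := by
  rw [smulConst_eq, smulConst_eq, ← smulAlg_mul, ← map_mul, mul_inv_cancel, map_one, smulAlg_one]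

/-- The comorphism of a morphism, in terms of affine charts. -/
lemma exists_comorphism {U : Y.left.Opens} (hU : IsAffineOpen U) {W : X.left.Opens}
    (hW : IsAffineOpen W) (τ : X ⟶ Y) (h : W ≤ τ.left ⁻¹ᵁ U) :
    ∃ σ : Γ(Y.left, U) →ₐ[ℂ] Γ(X.left, W),
      (∀ f, σ f = X.left.presheaf.map (homOfLE h).op (τ.left.app U f)) ∧
      ∀ {A : Type} [CommRing A] [Algebra ℂ A] (ψ : Γ(X.left, W) →ₐ[ℂ] A),
        chart hW ψ ≫ τ = chart hU (ψ.comp σ) := by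
  obtain ⟨σ, hσ⟩ := exists_eq_chart hU (affineIncl hW ≫ τ) fun s ↦ by
    have h1 : hW.fromSpec s ∈ W := by
      change _ ∈ (W : Set X.left)
      rw [← hW.range_fromSpec]
      exact ⟨_, rfl⟩
    exact h h1
  refine ⟨σ, fun f ↦ apply_eq_of_app_eq hU hσ f ?_, fun ψ ↦ ?_⟩
  · have key : (hW.fromSpec ≫ τ.left).app U = (τ.left.app U ≫
      X.left.presheaf.map (homOfLE h).op) ≫ (Scheme.ΓSpecIso (CommRingCat.of Γ(X.left, W))).inv ≫
        (Spec (CommRingCat.of Γ(X.left, W))).presheaf.map (homOfLE le_top).op := by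
      rw [Scheme.Hom.comp_app, hW.fromSpec_app_of_le _ h, Category.assoc]
      rfl
    exact congrArg (fun h : Γ(Y.left, U) ⟶ _ ↦ h.hom f) key
  · rw [chart, Category.assoc, hσ, specMap_chart]

lemma exists_restriction {U W : X.left.Opens} (hU : IsAffineOpen U) (hW : IsAffineOpen W)
    (h : W ≤ U) : ∃ σ : Γ(X.left, U) →ₐ[ℂ] Γ(X.left, W),
      (∀ f, σ f = X.left.presheaf.map (homOfLE h).op f) ∧
      ∀ {A : Type} [CommRing A] [Algebra ℂ A] (ψ : Γ(X.left, W) →ₐ[ℂ] A),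
        chart hW ψ = chart hU (ψ.comp σ) := by
  obtain ⟨σ, h1, h2⟩ := exists_comorphism hU hW (𝟙 X) h
  refine ⟨σ, fun f ↦ (h1 f).trans rfl, fun ψ ↦ ?_⟩
  rw [← h2, Category.comp_id]

lemma expHom_comp {B C : Type} [CommRing B] [Algebra ℂ B] [CommRing C] [Algebra ℂ C]
    (ψ : C →ₐ[ℂ] A) (σ : B →ₐ[ℂ] C) {D : Derivation ℂ B B} {D' : Derivation ℂ C C}
    (h : ∀ f, D' (σ f) = σ (D f)) : (expHom ψ D').comp σ = expHom (ψ.comp σ) D := by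
  apply algHom_dual_ext <;> simp [h]

/-- The value of a vector field at a point does not depend on the chart. -/
lemma chart_expHom_eq {U V : X.left.Opens} (hU : IsAffineOpen U) (hV : IsAffineOpen V)
    (D : Vect X) {χ : Γ(X.left, U) →ₐ[ℂ] ℂ} {η : Γ(X.left, V) →ₐ[ℂ] ℂ}
    (h : chart hU χ = chart hV η) :
    chart hU (expHom χ (D.1 U)) = chart hV (expHom η (D.1 V)) := by
  have hx : Pt.pos (chart hU χ) ∈ U ⊓ V := ⟨pos_chart_mem hU χ, h ▸ pos_chart_mem hV η⟩
  obtain ⟨W, hW, hxW, hWle⟩ := exists_affine_nhds _ _ hx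
  obtain ⟨ψ, hψ⟩ := exists_pt_eq_chart hW _ hxW
  obtain ⟨σ, hσ, hσ'⟩ := exists_restriction hU hW (hWle.trans inf_le_left)
  obtain ⟨τ, hτ, hτ'⟩ := exists_restriction hV hW (hWle.trans inf_le_right)
  have e1 : chart hW (expHom ψ (D.1 W)) = chart hU (expHom χ (D.1 U)) := by
    rw [hσ', expHom_comp (D := D.1 U) ψ σ fun f ↦ by rw [hσ, hσ, D.2],
      ← chart_injective hU (hψ.trans (hσ' ψ))]
  have e2 : chart hW (expHom ψ (D.1 W)) = chart hV (expHom η (D.1 V)) := by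
    rw [hτ', expHom_comp (D := D.1 V) ψ τ fun f ↦ by rw [hτ, hτ, D.2],
      ← chart_injective hV (h.symm.trans (hψ.trans (hτ' ψ)))]
  rw [← e1, e2]

/-- Equivariance of fields becomes equivariance of their values in `T_xX`, because the fixed point
`x` does not move. -/
lemma smulConst_chart_expHom (a : GroupAction Gm X) {U : X.left.Opens} (hU : IsAffineOpen U)
    {χ : Γ(X.left, U) →ₐ[ℂ] ℂ} (hx : chart hU χ ∈ a.fixedPoints) {t : ℂˣ} {D D' : Vect X}
    (h : IsTranslate (G := Gm) a t D D') :
    a.smulConst (G := Gm) t⁻¹ (chart hU (expHom χ (D'.1 U))) =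
      chart hU (expHom χ (D.1 U)) := by
  have hfix : chart hU χ ≫ a.translate (G := Gm) t⁻¹ = chart hU χ := by
    rw [a.comp_translate (G := Gm)]
    exact hx _
  have hmem : Pt.pos (chart hU χ) ∈ (a.translate (G := Gm) t⁻¹).left ⁻¹ᵁ U := by
    have := pos_chart_mem hU χ
    rw [← hfix] at this
    exact this
  obtain ⟨W, hW, hxW, hWle⟩ := exists_affine_nhds _ _ hmem
  obtain ⟨ψ, hψ⟩ := exists_pt_eq_chart hW _ hxW
  obtain ⟨σ, hσ, hσ'⟩ := exists_comorphism hU hW _ hWle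
  have e : ψ.comp σ = χ := chart_injective hU (by rw [← hσ', ← hψ, hfix])
  rw [← a.comp_translate (G := Gm), chart_expHom_eq hU hW D' hψ, hσ',
    expHom_comp (D := D.1 U) ψ σ fun f ↦ ?_, e]
  rw [hσ, hσ, ← D'.2]
  exact congrArg _ (h U f)

end

namespace SLTwoTAction

variable {X : Sch} (a : SLTwoTAction X)

/-- If `ξ` has weight `n` in `𝔰𝔩₂`, the value of its field at `x` has weight `n` in `T_xX`; a
nonzero value would make the even number `n` odd. -/
lemma der_eq_zero_of_conj {U : X.left.Opens} (hU : IsAffineOpen U)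
    {χ : Γ(X.left, U) →ₐ[ℂ] ℂ} (hx : chart hU χ ∈ a.torusAction.fixedPoints)
    (hodd : ∀ n : ℤ, IsTangentWeight a.torusAction (chart hU χ) n → Odd n) {ξ : slTwo} {n : ℤ}
    (hn : Even n) (hξ : ∀ t : ℂˣ, conj t ξ = ((t ^ n : ℂˣ) : ℂ) • ξ) (f : Γ(X.left, U)) :
    χ (a.der U ξ f) = 0 := by
  have hv : chart hU (expHom χ (a.der U ξ)) = zeroTangent (chart hU χ) := by
    by_contra hv
    refine Int.not_even_iff_odd.mpr (hodd n ⟨_, ?_, hv, fun t ↦ ?_⟩) hn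
    · exact (specMap_chart hU (dualFst ℂ) _).trans (congrArg _ (by ext; simp))
    · have h1 := smulConst_chart_expHom a.torusAction hU hx (a.equivariant t ξ)
      rw [hξ] at h1
      have h2 := congrArg (a.torusAction.smulConst (G := Gm) t) h1
      refine h2.symm.trans ?_
      refine (a.torusAction.smulConst_smulConst_inv (G := Gm) t _).trans ?_
      refine Eq.trans (congrArg _ ?_) (specMap_chart hU (scaleEps _) _).symm
      refine algHom_dual_ext (fun f ↦ ?_) fun f ↦ ?_
      · simp [scaleEps]
      · have h3 (p : DualNumber ℂ) :
            (scaleEps ((t ^ n : ℂˣ) : ℂ) p).snd = (t ^ n : ℂˣ) * p.snd := by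
          simp [scaleEps]
        rw [AlgHom.comp_apply, h3, snd_expHom, snd_expHom]
        change χ (a.der U _ f) = _
        rw [der_smul, Derivation.smul_apply, map_smul, smul_eq_mul]
  have h0 : expHom χ (a.der U ξ) = (dualInl ℂ).comp χ :=
    chart_injective hU (hv.trans (specMap_chart hU (dualInl ℂ) χ))
  have := congrArg TrivSqZeroExt.snd (DFunLike.congr_fun h0 f)
  simpa using this

lemma conj_slH (t : ℂˣ) : conj t slH = slH := by
  apply Subtype.ext
  ext i j
  fin_cases i <;> fin_cases j <;> simp [conj, slH, torus]

lemma conj_slE (t : ℂˣ) : conj t slE = ((t ^ (2 : ℤ) : ℂˣ) : ℂ) • slE := by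
  apply Subtype.ext
  ext i j
  fin_cases i <;> fin_cases j <;> simp [conj, slE, torus, sq]

lemma conj_slF (t : ℂˣ) : conj t slF = ((t ^ (-2 : ℤ) : ℂˣ) : ℂ) • slF := by
  apply Subtype.ext
  ext i j
  fin_cases i <;> fin_cases j <;> simp [conj, slF, torus, sq]

theorem mem_zeroLocus_of_odd {x : Pt X} (hx : x ∈ a.torusAction.fixedPoints)
    (hodd : ∀ n : ℤ, IsTangentWeight a.torusAction x n → Odd n) : x ∈ a.zeroLocus := by
  intro ξ U f hxU
  obtain ⟨W, hW, hxW, hWU⟩ := exists_affine_nhds x.pos U hxU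
  obtain ⟨χ, rfl⟩ := exists_pt_eq_chart hW x hxW
  have h0 (g) : χ (a.der W ξ g) = 0 := by
    rw [slTwo_eq ξ]
    simp only [der_add, der_smul, Derivation.add_apply, Derivation.smul_apply, map_add, map_smul]
    rw [a.der_eq_zero_of_conj hW hx hodd Even.zero (fun t ↦ by simp [conj_slH]),
      a.der_eq_zero_of_conj hW hx hodd even_two conj_slE,
      a.der_eq_zero_of_conj hW hx hodd even_two.neg conj_slF]
    simp
  intro hmem
  have h1 : Pt.pos (chart hW χ) ∈ X.left.basicOpen
      (X.left.presheaf.map (homOfLE hWU).op (applyField (a.lieHom ξ) U f)) := by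
    rw [Scheme.basicOpen_res]
    exact ⟨hxW, hmem⟩
  have h2 : X.left.presheaf.map (homOfLE hWU).op (applyField (a.lieHom ξ) U f) =
    a.der W ξ (X.left.presheaf.map (homOfLE hWU).op f) := (a.lieHom ξ).2 hWU f
  rw [h2, pos_chart_mem_basicOpen] at h1
  exact h1 (h0 _)

end SLTwoTAction

end SLTwoVariety

/-! ### The Casimir operator and lifting of invariants -/

namespace SLTwoVariety

attribute [local instance] LieRing.ofAssociativeRing

/-- The characteristic polynomial is a power of the variable, so Cayley–Hamilton applies. -/
lemma isNilpotent_of_forall_eigenvalue {V : Type*} [AddCommGroup V] [Module ℂ V]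
    [Module.Finite ℂ V] {h : Module.End ℂ V} (hh : ∀ μ : ℂ, ∀ v ≠ 0, h v = μ • v → μ = 0) :
    IsNilpotent h := by
  have h1 : ∀ μ ∈ h.charpoly.roots, μ = 0 := fun μ hμ ↦ by
    have := (Module.End.hasEigenvalue_iff_isRoot_charpoly h μ).mpr
      (Polynomial.isRoot_of_mem_roots hμ)
    obtain ⟨v, hv⟩ := this.exists_hasEigenvector
    exact hh μ v hv.2 hv.apply_eq_smul
  have h2 := (IsAlgClosed.splits h.charpoly).eq_prod_roots_of_monic h.charpoly_monic
  rw [Multiset.eq_replicate_card.mpr h1] at h2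
  refine ⟨h.charpoly.roots.card, ?_⟩
  have h3 := h.aeval_self_charpoly
  rw [h2] at h3
  simpa using h3

section
variable {V : Type*} [AddCommGroup V] [Module ℂ V] {h e f : Module.End ℂ V}

/-- The Casimir operator. -/
def casimir (h e f : Module.End ℂ V) : Module.End ℂ V := h ^ 2 + 2 * h + 4 * (f * e)

lemma casimir_apply (h e f : Module.End ℂ V) (v : V) :
    casimir h e f v = h (h v) + (2 : ℂ) • h v + (4 : ℂ) • f (e v) := by
  have : casimir h e f = h * h + (2 : ℂ) • h + (4 : ℂ) • (f * e) := by
    rw [casimir, pow_two, two_smul, show (4 : ℂ) = 2 + 2 by norm_num, add_smul, two_smul]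
    noncomm_ring
  rw [this]
  rfl

/-- The two expressions differ by `4 ([e, f] - h)`. The symmetry transfers statements about `e` to
`f`. -/
lemma casimir_symm (hef : ⁅e, f⁆ = h) : casimir (-h) f e = casimir h e f := by
  rw [Ring.lie_def] at hef
  rw [casimir, casimir, ← sub_eq_zero]
  calc _ = 4 * (e * f - f * e) - 4 * h := by noncomm_ring
    _ = 0 := by rw [hef, sub_self]

lemma commute_casimir (hef : ⁅e, f⁆ = h) (hhe : ⁅h, e⁆ = 2 • e) :
    casimir h e f * e = e * casimir h e f := by
  rw [Ring.lie_def] at hef hhe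
  have h1 : h * e = e * h + 2 * e := by
    rw [sub_eq_iff_eq_add] at hhe
    rw [hhe, add_comm, two_mul, two_smul]
  have h2 : f * e = e * f - h := by rw [← hef]; noncomm_ring
  simp only [casimir, mul_add, add_mul, pow_two]
  have h3 : h * h * e = e * h * h + 4 * (e * h) + 4 * e := by
    rw [mul_assoc, h1, mul_add, ← mul_assoc, h1]
    rw [show h * (2 * e) = 2 * (h * e) by noncomm_ring, h1]
    noncomm_ring
  have h4 : 4 * (f * e) * e = e * (4 * (f * e)) - 4 * (h * e) := by
    rw [show 4 * (f * e) * e = 4 * ((f * e) * e) by noncomm_ring]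
    conv_lhs => rw [h2]
    noncomm_ring
  rw [h3, h4, h1, show 2 * h * e = 2 * (h * e) by noncomm_ring, h1]
  noncomm_ring

/-- The relation gives `(h - s)ⁿ e = e hⁿ`, and `h - s` is invertible when `h` is nilpotent. -/
lemma eq_zero_of_isNilpotent_of_lie {s : ℂ} (hs : s ≠ 0) (hh : IsNilpotent h)
    (hhe : ⁅h, e⁆ = s • e) : e = 0 := by
  obtain ⟨n, hn⟩ := hh
  have h1 (k : ℕ) : (h - s • 1) ^ k * e = e * h ^ k := by
    induction k with
    | zero => simp
    | succ k ih =>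
      rw [pow_succ, mul_assoc, pow_succ, ← mul_assoc e, ← ih, mul_assoc]
      congr 1
      rw [Ring.lie_def, sub_eq_iff_eq_add] at hhe
      rw [sub_mul, hhe, smul_mul_assoc, one_mul, add_sub_cancel_left]
  have h2 : IsUnit (h - s • (1 : Module.End ℂ V)) := by
    have : IsUnit (-(s • (1 : Module.End ℂ V))) := by
      rw [← Algebra.algebraMap_eq_smul_one, ← map_neg]
      exact (IsUnit.mk0 _ (neg_ne_zero.mpr hs)).map _
    rw [sub_eq_neg_add]
    refine IsNilpotent.isUnit_add_left_of_commute ⟨n, hn⟩ this ?_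
    exact ((Commute.one_right h).smul_right s).neg_right
  have h3 := h1 n
  rw [hn, mul_zero] at h3
  exact (h2.pow n).mul_right_eq_zero.mp h3

/-- An `𝔰𝔩₂`-module on which the Casimir operator is nilpotent is trivial. -/
lemma eq_zero_of_isNilpotent_casimir [Module.Finite ℂ V] (hef : ⁅e, f⁆ = h) (hhe : ⁅h, e⁆ = 2 • e)
    (hhf : ⁅h, f⁆ = -(2 • f)) (hc : IsNilpotent (casimir h e f)) : e = 0 ∧ f = 0 ∧ h = 0 := by
  have prim {h e f : Module.End ℂ V} (t : IsSl2Triple h e f) (hc : IsNilpotent (casimir h e f))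
      {μ : ℂ} {v : V} (hv : v ≠ 0) (hhv : h v = μ • v) : ∃ k : ℕ, μ + 2 * k = 0 := by
    obtain ⟨k, P⟩ := exists_hasPrimitiveVectorWith t hv hhv
    refine ⟨k, ?_⟩
    obtain ⟨m, hm⟩ := P.exists_nat
    have h1 : h ((e ^ k) v) = (m : ℂ) • (e ^ k) v := hm ▸ P.lie_h
    have h2 : e ((e ^ k) v) = 0 := P.lie_e
    have h3 : casimir h e f ((e ^ k) v) = ((m : ℂ) ^ 2 + 2 * m) • (e ^ k) v := by
      simp only [casimir_apply, h1, h2,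
        map_zero, smul_zero, add_zero, map_smul, smul_smul, ← add_smul]
      congr 1
      ring
    obtain ⟨n, hn⟩ := hc
    have h5 (j : ℕ) : (casimir h e f ^ j) ((e ^ k) v) = ((m : ℂ) ^ 2 + 2 * m) ^ j • (e ^ k) v := by
      induction j with
      | zero => simp
      | succ j ih => 
        rw [pow_succ', Module.End.mul_apply, ih, map_smul, h3, smul_smul,
          pow_succ (_ + _)]
    have h6 := h5 n
    rw [hn, LinearMap.zero_apply, eq_comm, smul_eq_zero_iff_left P.ne_zero] at h6
    -- The Casimir operator acts on a primitive vector of weight `m` by `m (m + 2)`, so nilpotence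
    -- leaves `m = 0`.
    have h7 : (m : ℂ) * (m + 2) = 0 := by
      have := eq_zero_of_pow_eq_zero h6
      rw [← this]
      ring
    rw [hm]
    rcases mul_eq_zero.mp h7 with h8 | h8
    · exact h8
    · exact absurd (by exact_mod_cast h8 : m + 2 = 0) (by omega)
  have hh0 : IsNilpotent h := by
    by_cases h0 : h = 0
    · exact h0 ▸ IsNilpotent.zero
    have t : IsSl2Triple h e f := ⟨h0, hef, hhe, hhf⟩
    refine isNilpotent_of_forall_eigenvalue fun μ v hv hμ ↦ ?_
    obtain ⟨k, hk⟩ := prim t hc hv hμ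
    -- Raising gives `μ = -2 k` and lowering gives `μ = 2 j`, so both are zero.
    obtain ⟨j, hj⟩ := prim t.symm (by rwa [casimir_symm hef]) hv (μ := -μ) (by simp [hμ])
    have h1 : (2 * (k + j) : ℂ) = 0 := by linear_combination hk + hj
    have h2 : 2 * (k + j) = 0 := by exact_mod_cast h1
    have h3 : k = 0 := by omega
    simpa [h3] using hk
  have he : e = 0 := eq_zero_of_isNilpotent_of_lie two_ne_zero hh0 (by rw [hhe, two_smul, two_smul])
  have hf : f = 0 := eq_zero_of_isNilpotent_of_lie (s := -2) (by norm_num) hh0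
    (by rw [hhf, neg_smul, two_smul, two_smul])
  refine ⟨he, hf, ?_⟩
  rw [← hef, he, hf, Ring.lie_def]
  simp

lemma restrict_lie {h e x : Module.End ℂ V} {W : Submodule ℂ V} (hh : ∀ v ∈ W, h v ∈ W)
    (he : ∀ v ∈ W, e v ∈ W) (hx : ∀ v ∈ W, x v ∈ W) (h1 : ⁅h, e⁆ = x) :
    ⁅h.restrict hh, e.restrict he⁆ = x.restrict hx := by
  subst h1
  ext v
  simp only [Ring.lie_def]
  rfl

/-- The Casimir operator commutes with the action, so `ker cᴺ` is a submodule on which it is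
nilpotent. -/
lemma apply_eq_zero_of_casimir_pow [Module.Finite ℂ V] (hef : ⁅e, f⁆ = h) (hhe : ⁅h, e⁆ = 2 • e)
    (hhf : ⁅h, f⁆ = -(2 • f)) {N : ℕ} {v : V} (hv : (casimir h e f ^ N) v = 0) :
    e v = 0 ∧ f v = 0 ∧ h v = 0 := by
  let c := casimir h e f
  let W := LinearMap.ker (c ^ N)
  have hmem {x : Module.End ℂ V} (hx : Commute c x) : ∀ v ∈ W, x v ∈ W := fun v hv ↦ by
    have h1 := LinearMap.congr_fun (hx.pow_left N).eq v
    rw [Module.End.mul_apply, Module.End.mul_apply, LinearMap.mem_ker.mp hv, map_zero] at h1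
    exact h1
  have hce : Commute c e := commute_casimir hef hhe
  have hcf : Commute c f := by
    have := commute_casimir (h := -h) (e := f) (f := e)
      (by rw [← hef, Ring.lie_def, Ring.lie_def]; simp)
      (by rw [Ring.lie_def] at hhf ⊢; rw [← neg_eq_iff_eq_neg] at hhf; rw [← hhf]; noncomm_ring)
    rw [casimir_symm hef] at this
    exact this
  have hch : Commute c h := by
    rw [← hef, Ring.lie_def]
    exact (hce.mul_right hcf).sub_right (hcf.mul_right hce)
  have h1 := eq_zero_of_isNilpotent_casimir (V := W) (h := h.restrict (hmem hch))
    (e := e.restrict (hmem hce)) (f := f.restrict (hmem hcf)) (restrict_lie _ _ _ hef)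
    ((restrict_lie _ _ (fun v hv ↦ W.smul_of_tower_mem 2 (hmem hce v hv)) hhe).trans rfl)
    ((restrict_lie _ _ (fun v hv ↦ W.neg_mem (W.smul_of_tower_mem 2 (hmem hcf v hv)))
      hhf).trans rfl)
    ⟨N, by
      have : casimir (h.restrict (hmem hch)) (e.restrict (hmem hce)) (f.restrict (hmem hcf)) =
          c.restrict (hmem (Commute.refl c)) := by
        ext v
        change ((casimir (h.restrict (hmem hch)) (e.restrict (hmem hce))
          (f.restrict (hmem hcf))) v : V) = casimir h e f v
        rw [casimir_apply, casimir_apply]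
        rfl
      rw [this, Module.End.pow_restrict]
      ext v
      exact v.2⟩
  have h2 {x : Module.End ℂ V} (hx : ∀ v ∈ W, x v ∈ W) (h0 : x.restrict hx = 0) : x v = 0 :=
    congrArg Subtype.val (LinearMap.congr_fun h0 ⟨v, hv⟩)
  exact ⟨h2 _ h1.1, h2 _ h1.2.1, h2 _ h1.2.2⟩

end

/-- Invariants lift along homomorphisms of `𝔰𝔩₂`-modules. -/
lemma exists_invariant_lift {V V' : Type*} [AddCommGroup V] [Module ℂ V] [Module.Finite ℂ V]
    [AddCommGroup V'] [Module ℂ V'] [Module.Finite ℂ V'] {h e f : Module.End ℂ V}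
    {h' e' f' : Module.End ℂ V'} (hef : ⁅e, f⁆ = h) (hhe : ⁅h, e⁆ = 2 • e)
    (hhf : ⁅h, f⁆ = -(2 • f)) (π : V →ₗ[ℂ] V') (πh : ∀ v, π (h v) = h' (π v))
    (πe : ∀ v, π (e v) = e' (π v)) (πf : ∀ v, π (f v) = f' (π v)) {v : V} (hv : h' (π v) = 0)
    (ev : e' (π v) = 0) : ∃ g, e g = 0 ∧ f g = 0 ∧ h g = 0 ∧ π g = π v := by
  have πc (v) : π (casimir h e f v) = casimir h' e' f' (π v) := by
    simp only [casimir_apply, map_add, map_smul, πh, πe, πf]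
  have πcn (n : ℕ) (v) : π ((casimir h e f ^ n) v) = (casimir h' e' f' ^ n) (π v) := by
    induction n with
    | zero => simp
    | succ n ih => rw [pow_succ', Module.End.mul_apply, πc, ih, pow_succ', Module.End.mul_apply]
  obtain ⟨N, ⟨h1, h2⟩, hN⟩ :=
    (((casimir h e f).eventually_isCompl_ker_pow_range_pow.and
    (casimir h' e' f').eventually_isCompl_ker_pow_range_pow).and
    (Filter.eventually_ge_atTop 1)).exists
  obtain ⟨g, hg, w, hw, hgw⟩ := Submodule.mem_sup.mp (h1.sup_eq_top ▸ Submodule.mem_top : v ∈ _)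
  obtain ⟨u, rfl⟩ := hw
  obtain ⟨eg, fg, hg'⟩ := apply_eq_zero_of_casimir_pow hef hhe hhf (LinearMap.mem_ker.mp hg)
  refine ⟨g, eg, fg, hg', ?_⟩
  -- The part of `v` in the range of `cᴺ` maps into both `ker c'` and the range of `c'ᴺ`, which meet
  -- only in zero since `N ≥ 1`.
  have h5 : casimir h' e' f' (π ((casimir h e f ^ N) u)) = 0 := by
    have h6 : (casimir h e f ^ N) u = v - g := by rw [← hgw, add_sub_cancel_left]
    rw [h6, map_sub, map_sub, ← πc g, casimir_apply h, casimir_apply h', hv, ev, eg, hg']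
    simp
  have h7 : π ((casimir h e f ^ N) u) = 0 := by
    refine Submodule.disjoint_def.mp h2.disjoint _ ?_ ⟨π u, (πcn N u).symm⟩
    obtain ⟨n, rfl⟩ := Nat.exists_eq_add_of_le' hN
    rw [LinearMap.mem_ker, pow_succ, Module.End.mul_apply, h5, map_zero]
  rw [← hgw, map_add, h7, add_zero]

end SLTwoVariety

/-! ### The infinitesimal action of `SL₂` -/

namespace SLTwoVariety

attribute [local instance] LieRing.ofAssociativeRing

section

variable {A B : Type} [CommRing A] [Algebra ℂ A] [CommRing B] [Algebra ℂ B] {X : Sch}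
  (b : GroupAction SLTwo X)

/-- The action of `SL₂(A)` on `A`-valued points. -/
def slAct (g : Matrix.SpecialLinearGroup (Fin 2) A) (z : specOver A ⟶ X) : specOver A ⟶ X :=
  GroupAction.smulAlg (G := SLTwo) (A := A) b g z

lemma slAct_mul (g h : Matrix.SpecialLinearGroup (Fin 2) A) (z : specOver A ⟶ X) :
    slAct b (g * h) z = slAct b g (slAct b h z) := b.smulAlg_mul g h z

lemma slAct_one (z : specOver A ⟶ X) : slAct b 1 z = z := b.smulAlg_one z

lemma specMap_slAct (f : A →ₐ[ℂ] B) (g : Matrix.SpecialLinearGroup (Fin 2) A)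
    (z : specOver A ⟶ X) : specMap f ≫ slAct b g z =
      slAct b (Matrix.SpecialLinearGroup.map (f : A →+* B) g) (specMap f ≫ z) :=
  b.specMap_smulAlg f g z

/-- The element `1 + e ξ` of `SL₂(A)`, for `ξ ∈ 𝔰𝔩₂` and `e² = 0`. -/
def slExp (ξ : slTwo) (e : A) (he : e * e = 0) : Matrix.SpecialLinearGroup (Fin 2) A :=
  ⟨1 + e • ξ.1.map (algebraMap ℂ A), by
    have h : algebraMap ℂ A (Matrix.trace ξ.1) = 0 := by
      rw [show Matrix.trace ξ.1 = 0 from ξ.2, map_zero]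
    rw [Matrix.trace_fin_two, map_add] at h
    rw [Matrix.det_fin_two]
    simp only [Matrix.add_apply, Matrix.smul_apply, Matrix.map_apply, smul_eq_mul,
      Matrix.one_apply_eq, ne_eq, zero_ne_one, one_ne_zero, not_false_eq_true,
      Matrix.one_apply_ne, zero_add]
    linear_combination e * h + (algebraMap ℂ A (ξ.1 0 0) * algebraMap ℂ A (ξ.1 1 1) -
      algebraMap ℂ A (ξ.1 0 1) * algebraMap ℂ A (ξ.1 1 0)) * he⟩

lemma slExp_apply (ξ : slTwo) (e : A) (he : e * e = 0) (i j : Fin 2) :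
    slExp ξ e he i j = (1 : Matrix (Fin 2) (Fin 2) A) i j + e * algebraMap ℂ A (ξ.1 i j) := rfl

lemma map_slExp (f : A →ₐ[ℂ] B) (ξ : slTwo) (e : A) (he : e * e = 0) :
    Matrix.SpecialLinearGroup.map (f : A →+* B) (slExp ξ e he) =
      slExp ξ (f e) (by rw [← map_mul, he, map_zero]) := by
  ext i j
  rw [slExp_apply, Matrix.SpecialLinearGroup.map_apply_coe, RingHom.mapMatrix_apply,
    Matrix.map_apply, slExp_apply, Matrix.one_apply, Matrix.one_apply]
  split_ifs <;> simp

/-- The elementary matrix with entry `s` above the diagonal. -/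
def upper (s : A) : Matrix.SpecialLinearGroup (Fin 2) A := ⟨!![1, s; 0, 1], by simp⟩

/-- The elementary matrix with entry `s` below the diagonal. -/
def lower (s : A) : Matrix.SpecialLinearGroup (Fin 2) A := ⟨!![1, 0; s, 1], by simp⟩

lemma map_upper (f : A →ₐ[ℂ] B) (s : A) :
    Matrix.SpecialLinearGroup.map (f : A →+* B) (upper s) = upper (f s) := by
  refine Matrix.SpecialLinearGroup.ext _ _ fun i j ↦ ?_
  change f (!![1, s; 0, 1] i j) = !![1, f s; 0, 1] i j
  fin_cases i <;> fin_cases j <;> simp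

lemma map_lower (f : A →ₐ[ℂ] B) (s : A) :
    Matrix.SpecialLinearGroup.map (f : A →+* B) (lower s) = lower (f s) := by
  refine Matrix.SpecialLinearGroup.ext _ _ fun i j ↦ ?_
  change f (!![1, 0; s, 1] i j) = !![1, 0; f s, 1] i j
  fin_cases i <;> fin_cases j <;> simp

lemma upper_eq_slExp (e : A) (he : e * e = 0) : upper e = slExp slE e he := by
  refine Matrix.SpecialLinearGroup.ext _ _ fun i j ↦ ?_
  rw [slExp_apply]
  fin_cases i <;> fin_cases j <;> simp [slE, upper]

lemma lower_eq_slExp (e : A) (he : e * e = 0) : lower e = slExp slF e he := by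
  refine Matrix.SpecialLinearGroup.ext _ _ fun i j ↦ ?_
  rw [slExp_apply]
  fin_cases i <;> fin_cases j <;> simp [slF, lower]

lemma dual_eps_mul_eps (R : Type) [CommRing R] :
    (DualNumber.eps : DualNumber R) * DualNumber.eps = 0 := by simp

/-- The homomorphism `f ↦ φ f + φ (D f) e`, where `e² = 0`. -/
def expAlong (φ : B →ₐ[ℂ] A) (D : Derivation ℂ B B) (e : A) (he : e * e = 0) : B →ₐ[ℂ] A :=
  (dualLift φ e he).comp (expHom (AlgHom.id ℂ B) D)

lemma expAlong_apply (φ : B →ₐ[ℂ] A) (D : Derivation ℂ B B) (e : A) (he : e * e = 0) (f : B) :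
    expAlong φ D e he f = φ f + φ (D f) * e := by
  rw [expAlong, AlgHom.comp_apply, dualLift_apply, fst_expHom, snd_expHom]
  rfl

variable {U : X.left.Opens} (hU : IsAffineOpen U)

/-- Modulo `ε` the element `1 + ε ξ` is trivial, so the translated tautological point stays in `U`;
its `ε`-part is a derivation. -/
lemma exists_slDer (ξ : slTwo) : ∃ D : Derivation ℂ Γ(X.left, U) Γ(X.left, U),
    slAct b (slExp ξ DualNumber.eps (dual_eps_mul_eps Γ(X.left, U)))
      (chart hU (dualInl Γ(X.left, U))) =
      chart hU (expHom (AlgHom.id ℂ Γ(X.left, U)) D) := by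
  obtain ⟨φ, hφ, h1⟩ := exists_eq_chart_of_nilpotent hU
    (slAct b (slExp ξ DualNumber.eps (dual_eps_mul_eps Γ(X.left, U)))
      (chart hU (dualInl Γ(X.left, U))))
    (dualFst Γ(X.left, U)) dualFst_surjective (fun _ ↦ isNilpotent_of_dualFst_eq_zero)
    (AlgHom.id ℂ _) (by
      rw [specMap_slAct, map_slExp, specMap_chart]
      have : slExp ξ (dualFst Γ(X.left, U) DualNumber.eps) (by simp) = 1 := by
        ext i j
        rw [slExp_apply]
        simp
      rw [this, slAct_one]
      rfl)
  have h2 (f) : (φ f).fst = f := DFunLike.congr_fun h1 f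
  refine ⟨Derivation.mk' ((TrivSqZeroExt.sndHom Γ(X.left, U) Γ(X.left, U)).restrictScalars ℂ ∘ₗ
    φ.toLinearMap) fun f g ↦ ?_, hφ.trans (congrArg _ ?_)⟩
  · change (φ (f * g)).snd = f * (φ g).snd + g * (φ f).snd
    rw [map_mul, DualNumber.snd_mul, h2, h2]
    ring
  · refine algHom_dual_ext (fun f ↦ ?_) fun f ↦ ?_
    · rw [h2, fst_expHom]
      rfl
    · rw [snd_expHom]
      rfl

/-- The derivation by which `ξ ∈ 𝔰𝔩₂` acts on the regular functions on `U`. -/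
def slDer (ξ : slTwo) : Derivation ℂ Γ(X.left, U) Γ(X.left, U) := (exists_slDer b hU ξ).choose

lemma slAct_slExp (ξ : slTwo) (e : A) (he : e * e = 0) (φ : Γ(X.left, U) →ₐ[ℂ] A) :
    slAct b (slExp ξ e he) (chart hU φ) = chart hU (expAlong φ (slDer b hU ξ) e he) := by
  have h := congrArg (specMap (dualLift φ e he) ≫ ·) (exists_slDer b hU ξ).choose_spec
  simp only [specMap_slAct, specMap_chart, map_slExp] at h
  refine Eq.trans ?_ h
  congr 2
  · have : dualLift φ e he DualNumber.eps = e := by simp [dualLift_apply]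
    simp only [this]
  · exact (dualLift_comp_dualInl φ e he).symm

lemma slDer_smul (c : ℂ) (ξ : slTwo) : slDer b hU (c • ξ) = c • slDer b hU ξ := by
  let A := DualNumber Γ(X.left, U)
  have he : (c • DualNumber.eps : A) * (c • DualNumber.eps) = 0 := by
    rw [smul_mul_smul_comm, dual_eps_mul_eps, smul_zero]
  have h1 : slExp (c • ξ) (DualNumber.eps : A) (dual_eps_mul_eps _) =
      slExp ξ (c • DualNumber.eps) he := by
    refine Matrix.SpecialLinearGroup.ext _ _ fun i j ↦ ?_
    rw [slExp_apply, slExp_apply]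
    refine congrArg (_ + ·) ?_
    change DualNumber.eps * algebraMap ℂ A (c * ξ.1 i j) =
      c • (DualNumber.eps : A) * algebraMap ℂ A (ξ.1 i j)
    rw [map_mul, Algebra.smul_def]
    ring
  have h2 := slAct_slExp b hU (c • ξ) (DualNumber.eps : A) (dual_eps_mul_eps _) (dualInl _)
  rw [h1, slAct_slExp] at h2
  ext f
  have h3 := congrArg TrivSqZeroExt.snd (DFunLike.congr_fun (chart_injective hU h2) f)
  rw [expAlong_apply, expAlong_apply] at h3
  simpa using h3.symm

/-- Apply `(1 + e₁ ξ)(1 + e₂ η) = (1 + e₁ e₂ [ξ, η])(1 + e₂ η)(1 + e₁ ξ)` to `σ`. Pullback of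
functions is contravariant, which reverses the commutator. -/
lemma slDer_lie_mul (ξ η : slTwo) (σ : Γ(X.left, U) →ₐ[ℂ] A) {e₁ e₂ : A} (h₁ : e₁ * e₁ = 0)
    (h₂ : e₂ * e₂ = 0) (f : Γ(X.left, U)) :
    σ (slDer b hU ⁅ξ, η⁆ f) * (e₁ * e₂) =
      σ (slDer b hU η (slDer b hU ξ f) - slDer b hU ξ (slDer b hU η f)) * (e₁ * e₂) := by
  have h12 : e₁ * e₂ * (e₁ * e₂) = 0 := by linear_combination e₂ * e₂ * h₁
  have h : slExp ξ e₁ h₁ * slExp η e₂ h₂ =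
      slExp ⁅ξ, η⁆ (e₁ * e₂) h12 * (slExp η e₂ h₂ * slExp ξ e₁ h₁) := by
    let P := ξ.1.map (algebraMap ℂ A)
    let Q := η.1.map (algebraMap ℂ A)
    have hb : (⁅ξ, η⁆ : slTwo).1.map (algebraMap ℂ A) = P * Q - Q * P := by
      rw [LieSubalgebra.coe_bracket, Ring.lie_def]
      change (algebraMap ℂ A).mapMatrix _ = _
      rw [map_sub, map_mul, map_mul]
      rfl
    apply Subtype.ext
    change (1 + e₁ • P) * (1 + e₂ • Q) =
      (1 + (e₁ * e₂) • (⁅ξ, η⁆ : slTwo).1.map (algebraMap ℂ A)) * ((1 + e₂ • Q) * (1 + e₁ • P))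
    have k1 : e₁ * e₁ * e₂ = 0 := by linear_combination e₂ * h₁
    have k2 : e₂ * e₁ * e₂ = 0 := by linear_combination e₁ * h₂
    have k4 : e₁ * e₂ * e₁ * e₂ = 0 := by linear_combination e₂ ^ 2 * h₁
    have k3 (Z : Matrix (Fin 2) (Fin 2) A) :
        (e₁ * e₂) • Z * ((1 + e₂ • Q) * (1 + e₁ • P)) = (e₁ * e₂) • Z := by
      simp only [mul_add, add_mul, mul_one, one_mul, smul_mul_assoc, mul_smul_comm, smul_smul,
        smul_add, k1, k2, k4, zero_smul, add_zero, ← mul_assoc]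
    rw [hb, add_mul (1 : Matrix (Fin 2) (Fin 2) A) ((e₁ * e₂) • _), k3, one_mul]
    simp only [mul_add, add_mul, mul_one, one_mul, smul_mul_assoc, mul_smul_comm, smul_sub]
    module
  have h3 := congrArg (slAct b · (chart hU σ)) h
  simp only [slAct_mul, slAct_slExp] at h3
  have h4 := DFunLike.congr_fun (chart_injective hU h3) f
  simp only [expAlong_apply] at h4
  rw [map_sub]
  linear_combination -h4 - (e₂ * σ (slDer b hU ξ (slDer b hU ⁅ξ, η⁆ f)) +
    e₂ ^ 2 * σ (slDer b hU ξ (slDer b hU η (slDer b hU ⁅ξ, η⁆ f)))) * h₁ -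
      e₁ * σ (slDer b hU η (slDer b hU ⁅ξ, η⁆ f)) * h₂

lemma slDer_lie (ξ η : slTwo) : slDer b hU ⁅ξ, η⁆ = -⁅slDer b hU ξ, slDer b hU η⁆ := by
  ext f
  -- Iterated dual numbers supply two independent infinitesimals, so the coefficient of `e₁ e₂` can
  -- be read off.
  have h := slDer_lie_mul b hU ξ η ((dualInl (DualNumber Γ(X.left, U))).comp (dualInl _))
    (e₁ := DualNumber.eps) (e₂ := dualInl (DualNumber Γ(X.left, U)) DualNumber.eps)
    (dual_eps_mul_eps (DualNumber Γ(X.left, U)))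
    (by rw [← map_mul, dual_eps_mul_eps, map_zero]) f
  have h2 (z : Γ(X.left, U)) :
      (((dualInl (DualNumber Γ(X.left, U))).comp (dualInl _) z *
        (DualNumber.eps * dualInl _ DualNumber.eps)).snd).snd = z := by
    simp
  have h3 := congrArg (fun z ↦ z.snd.snd) h
  simp only [h2] at h3
  rw [h3, Derivation.neg_apply, Derivation.commutator_apply, neg_sub]

/-! ### Fixed points -/

variable {χ : Γ(X.left, U) →ₐ[ℂ] ℂ}

/-- The ring `ℂ[s]` is reduced, so a polynomial curve in the group fixes `x` identically;
restricting to `s = ε` gives its velocity. -/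
lemma slDer_eq_zero_of_curve (hx : chart hU χ ∈ b.fixedPoints) {ξ : slTwo}
    (g : Matrix.SpecialLinearGroup (Fin 2) (Polynomial ℂ))
    (hg : Matrix.SpecialLinearGroup.map ((Polynomial.aeval (DualNumber.eps : DualNumber ℂ) :
      Polynomial ℂ →ₐ[ℂ] _) : Polynomial ℂ →+* _) g = slExp ξ DualNumber.eps (dual_eps_mul_eps ℂ))
    (f : Γ(X.left, U)) : χ (slDer b hU ξ f) = 0 := by
  have h1 : slAct b g (specMap (Algebra.ofId ℂ (Polynomial ℂ)) ≫ chart hU χ) = _ :=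
    b.smulAlg_const_eq hx g
  have h2 := congrArg (specMap (Polynomial.aeval (DualNumber.eps : DualNumber ℂ)) ≫ ·) h1
  simp only [specMap_slAct, specMap_chart, hg, slAct_slExp] at h2
  have h3 := congrArg TrivSqZeroExt.snd (DFunLike.congr_fun (chart_injective hU h2) f)
  rw [expAlong_apply] at h3
  simp only [AlgHom.comp_apply, Algebra.ofId_apply, AlgHom.commutes] at h3
  simpa using h3

lemma slDer_slE_eq_zero (hx : chart hU χ ∈ b.fixedPoints) (f : Γ(X.left, U)) :
    χ (slDer b hU slE f) = 0 := by
  refine slDer_eq_zero_of_curve b hU hx (upper Polynomial.X) ?_ f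
  rw [map_upper, Polynomial.aeval_X, upper_eq_slExp]

lemma slDer_slF_eq_zero (hx : chart hU χ ∈ b.fixedPoints) (f : Γ(X.left, U)) :
    χ (slDer b hU slF f) = 0 := by
  refine slDer_eq_zero_of_curve b hU hx (lower Polynomial.X) ?_ f
  rw [map_lower, Polynomial.aeval_X, lower_eq_slExp]

lemma slDer_slH_eq_zero (hx : chart hU χ ∈ b.fixedPoints) (f : Γ(X.left, U)) :
    χ (slDer b hU slH f) = 0 := by
  rw [← lie_slE_slF, slDer_lie, Derivation.neg_apply, Derivation.commutator_apply, map_neg, map_sub,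
    slDer_slE_eq_zero b hU hx, slDer_slF_eq_zero b hU hx, sub_self, neg_zero]

end

end SLTwoVariety

/-! ### Invariant cotangent vectors and isolated zeros -/

namespace SLTwoVariety

attribute [local instance] LieRing.ofAssociativeRing

section
variable {B : Type} [CommRing B] [Algebra ℂ B] {χ : B →ₐ[ℂ] ℂ}

lemma isNilpotent_derivation (D : Derivation ℂ B B) {f : B} (hf : IsNilpotent f) :
    IsNilpotent (D f) := by
  obtain ⟨k, hk⟩ := hf
  -- Differentiating the relation and multiplying by `D f` trades one factor `f` for two factors `D
  -- f`; the integer coefficient is invertible over `ℂ`.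
  have h (i : ℕ) (hi : i ≤ k) : f ^ (k - i) * D f ^ (2 * i) = 0 := by
    induction i with
    | zero => simp [hk]
    | succ i ih =>
      obtain ⟨j, rfl⟩ := Nat.exists_eq_add_of_lt (Nat.lt_of_succ_le hi)
      have h1 := ih (by omega)
      rw [show i + j + 1 - i = j + 1 by omega] at h1
      rw [show i + j + 1 - (i + 1) = j by omega]
      have h2 := congrArg (D · * D f) h1
      simp only [D.leibniz, D.leibniz_pow, smul_eq_mul, nsmul_eq_mul, map_zero, zero_mul] at h2
      have h3 : ((j + 1 : ℕ) : B) * (f ^ j * D f ^ (2 * (i + 1))) = 0 := by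
        rcases i.eq_zero_or_pos with rfl | hi0
        · simp only [mul_zero, pow_zero, Nat.cast_zero, zero_mul, add_tsub_cancel_right,
            zero_add, one_mul] at h2 ⊢
          linear_combination h2
        · obtain ⟨l, rfl⟩ := Nat.exists_eq_add_of_le' hi0
          rw [show 2 * (l + 1) - 1 = 2 * l + 1 by omega, show j + 1 - 1 = j by omega] at h2
          linear_combination h2 - (2 * (l + 1) : ℕ) * D (D f) * h1
      have h4 : IsUnit ((j + 1 : ℕ) : B) := by
        rw [← map_natCast (algebraMap ℂ B)]
        exact (IsUnit.mk0 _ (by exact_mod_cast j.succ_ne_zero)).map _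
      exact h4.mul_right_eq_zero.mp h3
  exact ⟨2 * k, by simpa using h k le_rfl⟩

/-- On a smooth variety, a function that does not vanish to second order at a point is
differentiated to a nonzero value at this point by some vector field. -/
lemma exists_derivation_of_notMem_sq [Algebra.FormallySmooth ℂ B] {v : B} (hv : χ v = 0)
    (hv2 : v ∉ RingHom.ker χ ^ 2) : ∃ D : Derivation ℂ B B, χ (D v) ≠ 0 := by
  have h1 : v ∉ Submodule.span ℂ {(1 : B)} ⊔ (RingHom.ker χ ^ 2).restrictScalars ℂ := fun h ↦ by
    obtain ⟨_, h2, g, hg, h3⟩ := Submodule.mem_sup.mp h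
    obtain ⟨c, rfl⟩ := Submodule.mem_span_singleton.mp h2
    have h4 : χ g = 0 := Ideal.pow_le_self two_ne_zero hg
    have h5 := congrArg χ h3
    rw [map_add, map_smul, map_one, h4, hv] at h5
    have h6 : c = 0 := by simpa using h5
    rw [h6, zero_smul, zero_add] at h3
    exact hv2 (h3 ▸ hg)
  obtain ⟨θ, hθv, hθ⟩ := Submodule.exists_le_ker_of_notMem h1
  have hθd := derivation_of_map_sq_eq_zero (χ := χ) (θ := θ)
    (hθ (Submodule.mem_sup_left (Submodule.mem_span_singleton_self 1)))
    fun f hf ↦ hθ (Submodule.mem_sup_right hf)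
  let : Module B ℂ := Module.compHom ℂ χ.toRingHom
  have hsmul (f : B) (c : ℂ) : f • c = χ f * c := rfl
  have : IsScalarTower ℂ B ℂ := ⟨fun c f z ↦ by
    rw [hsmul, hsmul, map_smul, smul_eq_mul, smul_eq_mul, mul_assoc]⟩
  let d : Derivation ℂ B ℂ := Derivation.mk' θ fun f g ↦ hθd f g
  let π : B →ₗ[B] ℂ :=
    { toFun := χ
      map_add' := map_add χ
      map_smul' := fun f g ↦ map_mul χ f g }
  -- Differentials of a formally smooth algebra are projective, so the functional on them lifts
  -- along `χ : B → ℂ` to a derivation into `B`.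
  obtain ⟨l, hl⟩ := Module.projective_lifting_property π d.liftKaehlerDifferential
    fun c ↦ ⟨algebraMap ℂ B c, χ.commutes c⟩
  refine ⟨l.compDer (KaehlerDifferential.D ℂ B), ?_⟩
  have h2 := LinearMap.congr_fun hl (KaehlerDifferential.D ℂ B v)
  rw [Derivation.liftKaehlerDifferential_comp_D] at h2
  exact fun h3 ↦ hθv (h2.symm.trans h3)

/-- The relations of the standard basis of `𝔰𝔩₂`, for derivations. -/
structure IsSlTwoTriple (H E F : Derivation ℂ B B) : Prop where
  lie_e_f : ⁅E, F⁆ = H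
  lie_h_e : ⁅H, E⁆ = (2 : ℂ) • E
  lie_h_f : ⁅H, F⁆ = -((2 : ℂ) • F)

variable {H E F : Derivation ℂ B B}

lemma lie_quotientDerivation {D D' D'' : Derivation ℂ B B} (hD : ∀ f, χ f = 0 → χ (D f) = 0)
    (hD' : ∀ f, χ f = 0 → χ (D' f) = 0) (hD'' : ∀ f, χ f = 0 → χ (D'' f) = 0)
    (h : ⁅D, D'⁆ = D'') (k : ℕ) :
    ⁅quotientDerivation D hD k, quotientDerivation D' hD' k⁆ = quotientDerivation D'' hD'' k := by
  refine LinearMap.ext fun f ↦ ?_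
  obtain ⟨f, rfl⟩ := Ideal.Quotient.mk_surjective f
  rw [quotientDerivation_mk, ← h, Derivation.commutator_apply, map_sub]
  rfl

variable (ht : IsSlTwoTriple H E F) (hH : ∀ f, χ (H f) = 0) (hE : ∀ f, χ (E f) = 0)
  (hF : ∀ f, χ (F f) = 0)

include ht in
lemma IsSlTwoTriple.quotient (k : ℕ) :
    ⁅quotientDerivation E (fun f _ ↦ hE f) k, quotientDerivation F (fun f _ ↦ hF f) k⁆ =
      quotientDerivation H (fun f _ ↦ hH f) k ∧
    ⁅quotientDerivation H (fun f _ ↦ hH f) k, quotientDerivation E (fun f _ ↦ hE f) k⁆ =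
      2 • quotientDerivation E (fun f _ ↦ hE f) k ∧
    ⁅quotientDerivation H (fun f _ ↦ hH f) k, quotientDerivation F (fun f _ ↦ hF f) k⁆ =
      -(2 • quotientDerivation F (fun f _ ↦ hF f) k) := by
  refine ⟨lie_quotientDerivation _ _ _ ht.lie_e_f k,
    (lie_quotientDerivation _ _ (fun f _ ↦ by simp [hE]) ht.lie_h_e k).trans ?_,
    (lie_quotientDerivation _ _ (fun f _ ↦ by simp [hF]) ht.lie_h_f k).trans ?_⟩
  · refine LinearMap.ext fun f ↦ ?_
    obtain ⟨f, rfl⟩ := Ideal.Quotient.mk_surjective f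
    rw [quotientDerivation_mk, Derivation.smul_apply, two_smul ℂ (E f), map_add, two_smul ℕ]
    rfl
  · refine LinearMap.ext fun f ↦ ?_
    obtain ⟨f, rfl⟩ := Ideal.Quotient.mk_surjective f
    rw [quotientDerivation_mk, Derivation.neg_apply, Derivation.smul_apply, two_smul ℂ (F f),
      map_neg, map_add, two_smul ℕ]
    rfl

include ht hH hE hF in
-- Lift the class of `v` along `B ⧸ 𝔪ᵏ → B ⧸ 𝔪²` by `exists_invariant_lift`.
lemma exists_invariant_mod_pow [Algebra.FiniteType ℂ B] {v : B} (hHv : H v ∈ RingHom.ker χ ^ 2)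
    (hEv : E v ∈ RingHom.ker χ ^ 2) {k : ℕ} (hk : 2 ≤ k) :
    ∃ g, H g ∈ RingHom.ker χ ^ k ∧ E g ∈ RingHom.ker χ ^ k ∧ F g ∈ RingHom.ker χ ^ k ∧
      g - v ∈ RingHom.ker χ ^ 2 := by
  have := finite_quotient_ker_pow χ k
  have := finite_quotient_ker_pow χ 2
  obtain ⟨h1, h2, h3⟩ := ht.quotient hH hE hF k
  have hle : RingHom.ker χ ^ k ≤ RingHom.ker χ ^ 2 := Ideal.pow_le_pow_right hk
  let π : (B ⧸ RingHom.ker χ ^ k) →ₗ[ℂ] (B ⧸ RingHom.ker χ ^ 2) :=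
    (Ideal.Quotient.factorₐ ℂ hle).toLinearMap
  have hπ {D : Derivation ℂ B B} (hD : ∀ f, χ f = 0 → χ (D f) = 0) (f) :
      π (quotientDerivation D hD k f) = quotientDerivation D hD 2 (π f) := by
    obtain ⟨f, rfl⟩ := Ideal.Quotient.mk_surjective f
    rfl
  have hπv : π (Ideal.Quotient.mk _ v) = Ideal.Quotient.mk _ v := rfl
  have hv {D : Derivation ℂ B B} (hD : ∀ f, χ f = 0 → χ (D f) = 0)
      (h : D v ∈ RingHom.ker χ ^ 2) :
      quotientDerivation D hD 2 (π (Ideal.Quotient.mk _ v)) = 0 := by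
    rw [hπv, quotientDerivation_mk, Ideal.Quotient.eq_zero_iff_mem.mpr h]
  obtain ⟨g, e1, e2, e3, e4⟩ := exists_invariant_lift h1 h2 h3 π (hπ _) (hπ _) (hπ fun f _ ↦ hF f)
    (hv _ hHv) (hv _ hEv)
  obtain ⟨g, rfl⟩ := Ideal.Quotient.mk_surjective g
  rw [quotientDerivation_mk, Ideal.Quotient.eq_zero_iff_mem] at e1 e2 e3
  exact ⟨g, e3, e1, e2, Ideal.Quotient.eq.mp (e4.trans hπv)⟩

include ht hH hE hF in
/-- If `𝔪 ⧸ 𝔪²` has no invariants then the point is an isolated point of the zero locus. -/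
lemma exists_sub_one_mem_smul_le [Algebra.FiniteType ℂ B]
    (hinv : ∀ v, χ v = 0 → H v ∈ RingHom.ker χ ^ 2 → E v ∈ RingHom.ker χ ^ 2 →
      F v ∈ RingHom.ker χ ^ 2 → v ∈ RingHom.ker χ ^ 2) :
    ∃ r, r - 1 ∈ RingHom.ker χ ∧ ∀ f, χ f = 0 →
      r * f ∈ Ideal.span (Set.range H ∪ Set.range E ∪ Set.range F) := by
  let I := Ideal.span (Set.range H ∪ Set.range E ∪ Set.range F)
  have hIH (f) : H f ∈ I := Ideal.subset_span (.inl (.inl ⟨f, rfl⟩))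
  have hIE (f) : E f ∈ I := Ideal.subset_span (.inl (.inr ⟨f, rfl⟩))
  have hIF (f) : F f ∈ I := Ideal.subset_span (.inr ⟨f, rfl⟩)
  have hIm : I ≤ RingHom.ker χ := by
    refine Ideal.span_le.mpr ?_
    rintro _ ((⟨f, rfl⟩ | ⟨f, rfl⟩) | ⟨f, rfl⟩)
    exacts [hH f, hE f, hF f]
  have : IsNoetherianRing B := Algebra.FiniteType.isNoetherianRing ℂ B
  have := finite_quotient_ker_pow χ 2
  obtain ⟨h1, h2, h3⟩ := ht.quotient hH hE hF 2
  let c := casimir (quotientDerivation H (fun f _ ↦ hH f) 2)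
    (quotientDerivation E (fun f _ ↦ hE f) 2) (quotientDerivation F (fun f _ ↦ hF f) 2)
  obtain ⟨N, hN, hN1⟩ := (c.eventually_isCompl_ker_pow_range_pow.and
    (Filter.eventually_ge_atTop 1)).exists
  -- Modulo `𝔪²`, the Fitting decomposition splits `f` into an invariant part, which is zero by
  -- hypothesis, and a value of the Casimir operator, which is represented by an element of `I`.
  have key : RingHom.ker χ ≤ I ⊔ RingHom.ker χ • RingHom.ker χ := by
    intro f hf
    obtain ⟨g, hg, w, ⟨u, rfl⟩, hgw⟩ := Submodule.mem_sup.mp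
      (hN.sup_eq_top ▸ Submodule.mem_top : Ideal.Quotient.mk (RingHom.ker χ ^ 2) f ∈ _)
    obtain ⟨g, rfl⟩ := Ideal.Quotient.mk_surjective g
    obtain ⟨g1, g2, g3⟩ := apply_eq_zero_of_casimir_pow h1 h2 h3 (LinearMap.mem_ker.mp hg)
    obtain ⟨n, rfl⟩ := Nat.exists_eq_add_of_le' hN1
    obtain ⟨y, hy⟩ := Ideal.Quotient.mk_surjective ((c ^ n) u)
    have hw : (c ^ (n + 1)) u = Ideal.Quotient.mk (RingHom.ker χ ^ 2)
        (H (H y) + (2 : ℂ) • H y + (4 : ℂ) • F (E y)) := by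
      rw [pow_succ' c, Module.End.mul_apply, ← hy, casimir_apply]
      rfl
    have hwI : H (H y) + (2 : ℂ) • H y + (4 : ℂ) • F (E y) ∈ I :=
      I.add_mem (I.add_mem (hIH _) (Submodule.smul_of_tower_mem I _ (hIH _)))
        (Submodule.smul_of_tower_mem I _ (hIF _))
    rw [hw, ← map_add] at hgw
    have hgw' := Ideal.Quotient.eq.mp hgw
    have hχg : χ g = 0 := by
      have h4 : χ _ = 0 := Ideal.pow_le_self two_ne_zero hgw'
      have h5 : χ _ = 0 := hIm hwI
      rw [map_sub, map_add, h5, hf] at h4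
      simpa using h4
    have hg2 := hinv g hχg (Ideal.Quotient.eq_zero_iff_mem.mp g3)
      (Ideal.Quotient.eq_zero_iff_mem.mp g1) (Ideal.Quotient.eq_zero_iff_mem.mp g2)
    refine Submodule.mem_sup.mpr ⟨_, hwI, _, ?_, add_sub_cancel _ f⟩
    rw [smul_eq_mul, ← pow_two]
    have := Ideal.sub_mem _ hg2 hgw'
    convert this using 1
    ring
  -- Nakayama's lemma, in the form with `r ∈ 1 + 𝔪`.
  obtain ⟨r, hr, hr'⟩ := Submodule.exists_sub_one_mem_and_smul_le_of_fg_of_le_sup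
    (IsNoetherian.noetherian (RingHom.ker χ)) le_rfl key
  exact ⟨r, hr, fun f hf ↦ hr' (Submodule.smul_mem_pointwise_smul f r _ hf)⟩

end

end SLTwoVariety

/-! ### Generic relations between vector fields and Krull's intersection theorem -/

namespace SLTwoVariety

/-- Here `C` will be `L[ε]` with the `K`-structure twisted by a derivation, so the data are plain
ring homomorphisms. -/
lemma exists_section_of_formallySmooth {K L C : Type} [Field K] [Field L] [Algebra K L]
    [Algebra.FormallySmooth K L] [CommRing C] (g : K →+* C) (π : C →+* L)
    (hπ : ∀ k, π (g k) = algebraMap K L k) (hs : Function.Surjective π)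
    (hn : IsNilpotent (RingHom.ker π)) :
    ∃ σ : L →+* C, (∀ y, π (σ y) = y) ∧ ∀ k, σ (algebraMap K L k) = g k := by
  let := g.toAlgebra
  let π' : C →ₐ[K] L := { π with commutes' := hπ }
  let σ := Algebra.FormallySmooth.liftOfSurjective (AlgHom.id K L) π' hs hn
  exact ⟨σ, Algebra.FormallySmooth.liftOfSurjective_apply (AlgHom.id K L) π' hs hn, σ.commutes⟩

section
variable {Q L : Type} [CommRing Q] [IsDomain Q] [Algebra ℂ Q] [Field L] [Algebra ℂ L]
  (j : Q →ₐ[ℂ] L) (hj : Function.Injective j)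

include hj in
/-- Derivations along an inclusion into a finitely generated field extension extend. -/
lemma exists_extension_dual [Algebra.EssFiniteType ℂ L] (g : Q →ₐ[ℂ] DualNumber L)
    (hg : ∀ f, (g f).fst = j f) :
    ∃ τ : L →ₐ[ℂ] DualNumber L, (∀ y, (τ y).fst = y) ∧ ∀ f, τ (j f) = g f := by
  let : Algebra Q L := j.toRingHom.toAlgebra
  have : IsScalarTower ℂ Q L := .of_algebraMap_eq fun c ↦ (j.commutes c).symm
  have : FaithfulSMul Q L := (faithfulSMul_iff_algebraMap_injective Q L).mpr hj
  let : Algebra (FractionRing Q) L := FractionRing.liftAlgebra Q L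
  have : IsScalarTower Q (FractionRing Q) L := FractionRing.isScalarTower_liftAlgebra Q L
  have : IsScalarTower ℂ (FractionRing Q) L := .to₁₃₄ ℂ Q (FractionRing Q) L
  have : CharZero (FractionRing Q) := charZero_of_injective_algebraMap
    (algebraMap ℂ (FractionRing Q)).injective
  have : Algebra.EssFiniteType (FractionRing Q) L := .of_comp ℂ (FractionRing Q) L
  have hu (y : nonZeroDivisors Q) : IsUnit (g y) := by
    rw [TrivSqZeroExt.isUnit_iff_isUnit_fst, hg]
    exact IsUnit.mk0 _ fun h ↦ nonZeroDivisors.ne_zero y.2 (hj (h.trans (map_zero j).symm))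
  let G : FractionRing Q →+* DualNumber L :=
    IsLocalization.lift (M := nonZeroDivisors Q) (g := g.toRingHom) hu
  have hG (f : Q) : G (algebraMap Q (FractionRing Q) f) = g f := IsLocalization.lift_eq _ _
  have hfst : (dualFst L).toRingHom.comp G = algebraMap (FractionRing Q) L := by
    refine IsLocalization.ringHom_ext (nonZeroDivisors Q) (RingHom.ext fun f ↦ ?_)
    rw [RingHom.comp_apply, RingHom.comp_apply, RingHom.comp_apply, hG,
      ← IsScalarTower.algebraMap_apply]
    exact hg f
  obtain ⟨σ, h1, h2⟩ := exists_section_of_formallySmooth G (dualFst L).toRingHom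
    (fun k ↦ DFunLike.congr_fun hfst k) dualFst_surjective
    ⟨2, by
      rw [pow_two, Ideal.zero_eq_bot, eq_bot_iff, Ideal.mul_le]
      intro a ha b hb
      have ha' : a.fst = 0 := ha
      have hb' : b.fst = 0 := hb
      ext <;> simp [ha', hb']⟩
  have h3 (f : Q) : σ (j f) = g f := by
    rw [← hG, ← h2, ← IsScalarTower.algebraMap_apply]
    rfl
  refine ⟨{ σ with commutes' := fun c ↦ ?_ }, h1, h3⟩
  have := h3 (algebraMap ℂ Q c)
  rw [j.commutes, g.commutes] at this
  exact this

include hj in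
/-- Linear relations over an extension field descend to the ring. -/
lemma exists_relation {ι : Type} [Fintype ι] (c : ι → L) :
    ∃ (s : Q) (a : ι → Q), s ≠ 0 ∧ ∀ (y : Q) (x : ι → Q), j y = ∑ i, c i * j (x i) →
      s * y = ∑ i, a i * x i := by
  let : Algebra Q L := j.toRingHom.toAlgebra
  have : FaithfulSMul Q L := (faithfulSMul_iff_algebraMap_injective Q L).mpr hj
  let K := FractionRing Q
  let : Algebra K L := FractionRing.liftAlgebra Q L
  have : IsScalarTower Q K L := FractionRing.isScalarTower_liftAlgebra Q L
  -- A `K`-linear retraction `L → K` moves the coefficients into the fraction field, where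
  -- denominators can be cleared.
  obtain ⟨l, hl⟩ := (Algebra.linearMap K L).exists_leftInverse_of_injective
    (LinearMap.ker_eq_bot.mpr (algebraMap K L).injective)
  have hl' (k : K) : l (algebraMap K L k) = k := LinearMap.congr_fun hl k
  have hj' (y : Q) : j y = algebraMap K L (algebraMap Q K y) :=
    IsScalarTower.algebraMap_apply Q K L y
  obtain ⟨s, hs⟩ := IsLocalization.exist_integer_multiples_of_finite (nonZeroDivisors Q)
    (fun i ↦ l (c i))
  choose a ha using hs
  refine ⟨s, a, nonZeroDivisors.ne_zero s.2, fun y x h ↦ ?_⟩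
  have h1 := congrArg l h
  rw [hj', hl', map_sum] at h1
  apply IsFractionRing.injective Q K
  rw [map_mul, h1, map_sum, Finset.mul_sum]
  refine Finset.sum_congr rfl fun i _ ↦ ?_
  have h2 : l (c i * j (x i)) = algebraMap Q K (x i) * l (c i) := by
    rw [hj', mul_comm, ← Algebra.smul_def, map_smul, smul_eq_mul]
  rw [map_mul (algebraMap Q K), ha, h2]
  have h3 : (s : Q) • l (c i) = algebraMap Q K s * l (c i) := Algebra.smul_def _ _
  rw [h3]
  ring

end

section
variable {B : Type} [CommRing B] [Algebra ℂ B] {χ : B →ₐ[ℂ] ℂ} {H E F : Derivation ℂ B B}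

/-- If `𝔰𝔩₂` generates the tangent space generically, then a fixed point has no invariant
cotangent vectors. -/
lemma mem_sq_of_generic [Algebra.FiniteType ℂ B] [Algebra.FormallySmooth ℂ B]
    (ht : IsSlTwoTriple H E F) (hH : ∀ f, χ (H f) = 0) (hE : ∀ f, χ (E f) = 0)
    (hF : ∀ f, χ (F f) = 0) {L : Type} [Field L] [Algebra ℂ L] (q : B →ₐ[ℂ] L)
    (hq : ∀ f, q f = 0 → IsNilpotent f)
    (hgen : ∀ D : Derivation ℂ B B, ∃ c : Fin 3 → L, ∀ f,
      q (D f) = c 0 * q (H f) + c 1 * q (E f) + c 2 * q (F f))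
    {v : B} (hv : χ v = 0) (hHv : H v ∈ RingHom.ker χ ^ 2) (hEv : E v ∈ RingHom.ker χ ^ 2) :
    v ∈ RingHom.ker χ ^ 2 := by
  by_contra hv2
  obtain ⟨D, hD⟩ := exists_derivation_of_notMem_sq hv hv2
  obtain ⟨c, hc⟩ := hgen D
  have hprime : (RingHom.ker q).IsPrime := RingHom.ker_isPrime q
  let Q := B ⧸ RingHom.ker q
  let p : B →ₐ[ℂ] Q := Ideal.Quotient.mkₐ ℂ (RingHom.ker q)
  let j : Q →ₐ[ℂ] L := Ideal.kerLiftAlg q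
  have hp : Function.Surjective p := Ideal.Quotient.mkₐ_surjective _ _
  have hjp (f) : j (p f) = q f := rfl
  have hj : Function.Injective j := Ideal.kerLiftAlg_injective q
  obtain ⟨s, a, hs, hsa⟩ := exists_relation j hj c
  obtain ⟨δ, rfl⟩ := hp s
  have h1 (f) : p δ * p (D f) = a 0 * p (H f) + a 1 * p (E f) + a 2 * p (F f) := by
    have := hsa (p (D f)) ![p (H f), p (E f), p (F f)] (by
      simp only [Fin.sum_univ_three, hjp, hc]
      rfl)
    rw [this, Fin.sum_univ_three]
    rfl
  have hker : RingHom.ker q ≤ RingHom.ker χ := fun f hf ↦ by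
    exact ((hq f hf).map χ).eq_zero
  let J := (RingHom.ker χ).map p
  have hJ : J ≠ ⊤ := fun h ↦ by
    let χ' : Q →ₐ[ℂ] ℂ := Ideal.Quotient.liftₐ (RingHom.ker q) χ hker
    have h2 : J ≤ RingHom.ker χ' := Ideal.map_le_iff_le_comap.mpr fun f hf ↦ hf
    have h3 : χ' 1 = 0 := h2 (h ▸ Submodule.mem_top)
    rw [map_one] at h3
    exact one_ne_zero h3
  have hnoeth : IsNoetherianRing B := Algebra.FiniteType.isNoetherianRing ℂ B
  -- For `g` invariant modulo `𝔪ᵏ⁺²`, the relation gives `δ · D g ∈ Jᵏ⁺²`. As `D g` is nonzero at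
  -- the point, it is a unit modulo `𝔪ᵏ⁺²` and can be cancelled.
  have hmem (k : ℕ) : p δ ∈ J ^ (k + 2) := by
    obtain ⟨g, hHg, hEg, hFg, hgv⟩ := exists_invariant_mod_pow ht hH hE hF hHv hEv
      (Nat.le_add_left 2 k)
    have h3 : χ (D g) ≠ 0 := by
      have h4 : χ (D (g - v)) = 0 := by
        refine map_sq_eq_zero_of_derivation (θ := χ.toLinearMap ∘ₗ D.toLinearMap) ?_ hgv
        intro f g
        simp
      rw [map_sub, map_sub, sub_eq_zero] at h4
      rwa [h4]
    have hm {f} (hf : f ∈ RingHom.ker χ ^ (k + 2)) : p f ∈ J ^ (k + 2) := by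
      rw [← Ideal.map_pow]
      exact Ideal.mem_map_of_mem p hf
    have h5 : p δ * p (D g) ∈ J ^ (k + 2) := by
      rw [h1]
      exact Ideal.add_mem _ (Ideal.add_mem _ (Ideal.mul_mem_left _ _ (hm hHg))
        (Ideal.mul_mem_left _ _ (hm hEg))) (Ideal.mul_mem_left _ _ (hm hFg))
    obtain ⟨y, hy, u, hu, hyu⟩ : ∃ y ∈ Ideal.span {D g}, ∃ u ∈ RingHom.ker χ ^ (k + 2),
        y + u = 1 := by
      refine Submodule.mem_sup.mp ?_
      rw [Ideal.sup_pow_eq_top]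
      · exact Submodule.mem_top
      · rw [Ideal.eq_top_iff_one]
        refine Submodule.mem_sup.mpr ⟨(χ (D g))⁻¹ • D g, ?_, 1 - (χ (D g))⁻¹ • D g, ?_,
          add_sub_cancel _ _⟩
        · exact Submodule.smul_of_tower_mem _ _ (Ideal.mem_span_singleton_self _)
        · rw [RingHom.mem_ker, map_sub, map_one, map_smul, smul_eq_mul, inv_mul_cancel₀ h3,
            sub_self]
    obtain ⟨w, rfl⟩ := Ideal.mem_span_singleton'.mp hy
    have h6 : p δ = p w * (p δ * p (D g)) + p δ * p u := by
      have := congrArg p hyu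
      rw [map_add, map_mul, map_one] at this
      linear_combination (-p δ) * this
    rw [h6]
    exact Ideal.add_mem _ (Ideal.mul_mem_left _ _ h5) (Ideal.mul_mem_left _ _ (hm hu))
  have hbot := Ideal.iInf_pow_eq_bot_of_isDomain J hJ
  apply hs
  rw [← Ideal.mem_bot, ← hbot, Ideal.mem_iInf]
  exact fun k ↦ Ideal.pow_le_pow_right (Nat.le_add_right k 2) (hmem k)

end

end SLTwoVariety

namespace SLTwoVariety

attribute [local instance] LieRing.ofAssociativeRing

/-! ### Factorizations in `SL₂` -/

lemma lower_mul_lower_neg (s : ℂ) : lower s * lower (-s) = 1 := by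
  refine Matrix.SpecialLinearGroup.ext _ _ fun i j ↦ ?_
  change ((!![1, 0; s, 1] : Matrix (Fin 2) (Fin 2) ℂ) * !![1, 0; -s, 1]) i j =
    (1 : Matrix (Fin 2) (Fin 2) ℂ) i j
  fin_cases i <;> fin_cases j <;> simp

lemma eq_upper_mul_lower_mul_upper (M : Matrix.SpecialLinearGroup (Fin 2) ℂ) (hM : M 1 0 ≠ 0) :
    M = upper ((M 0 0 - 1) / M 1 0) * lower (M 1 0) * upper ((M 1 1 - 1) / M 1 0) := by
  have hdet := M.det_coe
  rw [Matrix.det_fin_two] at hdet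
  refine Matrix.SpecialLinearGroup.ext _ _ fun i j ↦ ?_
  change M i j = ((!![1, (M 0 0 - 1) / M 1 0; 0, 1] : Matrix (Fin 2) (Fin 2) ℂ) *
    !![1, 0; M 1 0, 1] * !![1, (M 1 1 - 1) / M 1 0; 0, 1]) i j
  fin_cases i <;> fin_cases j <;> simp [Matrix.mul_apply, Fin.sum_univ_two] <;> field_simp
  · ring
  · linear_combination -hdet
  · ring

/-- A right factor `lower c` makes the lower left entry nonzero, and then three factors suffice.
Thus affine 4-space maps onto `SL₂(ℂ)`, and an orbit is parametrized by a polynomial ring, a domain.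
-/
lemma exists_eq_upper_lower (M : Matrix.SpecialLinearGroup (Fin 2) ℂ) :
    ∃ s : Fin 4 → ℂ, M = upper (s 0) * lower (s 1) * upper (s 2) * lower (s 3) := by
  obtain ⟨c, hc⟩ : ∃ c : ℂ, (M * lower c : Matrix.SpecialLinearGroup (Fin 2) ℂ) 1 0 ≠ 0 := by
    have e (c : ℂ) : (M * lower c : Matrix.SpecialLinearGroup (Fin 2) ℂ) 1 0 =
        M 1 0 + M 1 1 * c := by
      change (M.1 * !![1, 0; c, 1]) 1 0 = _
      simp [Matrix.mul_apply, Fin.sum_univ_two]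
    by_contra! h
    have h0 : M 1 0 = 0 := by simpa using (e 0).symm.trans (h 0)
    have h1 : M 1 1 = 0 := by simpa [h0] using (e 1).symm.trans (h 1)
    have hdet := M.det_coe
    rw [Matrix.det_fin_two, h0, h1] at hdet
    simp at hdet
  have h := congrArg (· * lower (-c)) (eq_upper_mul_lower_mul_upper _ hc)
  simp only [mul_assoc M, lower_mul_lower_neg, mul_one] at h
  exact ⟨![_, _, _, -c], h⟩

lemma eps_mul_self {A : Type} [CommRing A] (c : A) :
    (TrivSqZeroExt.inr c : DualNumber A) * TrivSqZeroExt.inr c = 0 := by simp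

/-- The kernel of `SL₂(A[ε]) → SL₂(A)`. -/
lemma eq_slExp_of_map_fst {A : Type} [CommRing A] [Algebra ℂ A]
    (h : Matrix.SpecialLinearGroup (Fin 2) (DualNumber A))
    (hh : Matrix.SpecialLinearGroup.map (dualFst A : DualNumber A →+* A) h = 1) :
    h = slExp slH (TrivSqZeroExt.inr (h 0 0).snd) (eps_mul_self _) *
      slExp slE (TrivSqZeroExt.inr (h 0 1).snd) (eps_mul_self _) *
      slExp slF (TrivSqZeroExt.inr (h 1 0).snd) (eps_mul_self _) := by
  have hf (i j) : (h i j).fst = (1 : Matrix (Fin 2) (Fin 2) A) i j :=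
    congrFun (congrFun (congrArg Subtype.val hh) i) j
  have hdet := congrArg TrivSqZeroExt.snd h.det_coe
  rw [Matrix.det_fin_two] at hdet
  simp only [TrivSqZeroExt.snd_sub, DualNumber.snd_mul, hf] at hdet
  simp only [Matrix.one_apply, if_true, one_ne_zero, zero_ne_one, if_false, one_mul, mul_one,
    mul_zero, zero_mul, add_zero, sub_zero, TrivSqZeroExt.snd_one] at hdet
  refine Matrix.SpecialLinearGroup.ext _ _ fun i j ↦ ?_
  simp only [Matrix.SpecialLinearGroup.coe_mul, Matrix.mul_apply, Fin.sum_univ_two, slExp_apply]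
  refine TrivSqZeroExt.ext ?_ ?_
  · rw [hf]
    fin_cases i <;> fin_cases j <;> simp [slH, slE, slF, Matrix.one_apply]
  · fin_cases i <;> fin_cases j <;> simp [slH, slE, slF, Matrix.one_apply]
    linear_combination hdet

/-! ### The generic point of a dense family -/

section
variable {X : Sch} {U : X.left.Opens} (hU : IsAffineOpen U)

lemma isNilpotent_of_forall_algHom {A : Type} [CommRing A] [Algebra ℂ A] [Algebra.FiniteType ℂ A]
    {f : A} (h : ∀ r : A →ₐ[ℂ] ℂ, r f = 0) : IsNilpotent f := by
  have : IsJacobsonRing A := isJacobsonRing_of_finiteType (A := ℂ)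
  have hr : (nilradical A).IsRadical := Ideal.radical_isRadical _
  have h0 : f ∈ (nilradical A).jacobson := by
    rw [Ideal.jacobson, Ideal.mem_sInf]
    rintro n ⟨-, hn⟩
    obtain ⟨r, rfl⟩ := exists_ker_eq_of_isMaximal n
    exact h r
  rwa [this.out hr] at h0

variable {R L : Type} [CommRing R] [Algebra ℂ R] [Field L] [Algebra ℂ L]
  (ι : R →ₐ[ℂ] L) (hι : Function.Injective ι) (γ : specOver R ⟶ X)

include hι in
-- The generic point of `Spec R` specializes to each `ℂ`-point, and open sets are stable under
-- generization.
lemma ptAt_mem_of_pos_mem {W : X.left.Opens} (r : R →ₐ[ℂ] ℂ) (hr : Pt.pos (specMap r ≫ γ) ∈ W)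
    (s : PrimeSpectrum L) : ptAt (specMap ι ≫ γ) s ∈ W := by
  rw [pos_eq_ptAt _ ⊥, ptAt_specMap_comp] at hr
  rw [ptAt_specMap_comp]
  refine Specializes.mem_open (Specializes.map ?_ (continuous_ptAt γ)) W.2 hr
  rw [← PrimeSpectrum.le_iff_specializes]
  intro f hf
  have h1 : ι f ∈ s.asIdeal := hf
  have h2 : ι f = 0 := by
    by_contra h
    exact s.2.ne_top (Ideal.eq_top_of_isUnit_mem _ h1 (IsUnit.mk0 _ h))
  rw [hι (h2.trans (map_zero ι).symm)]
  exact Ideal.zero_mem _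

include hι in
-- If `f` is nonzero at some `ℂ`-point, the dense family meets the open set where `f ≠ 0`, hence so
-- does its generic point. Thus `q` kills only nilpotents.
lemma exists_generic_chart [Algebra.FiniteType ℂ Γ(X.left, U)]
    (hγ : Dense {y | ∃ r : R →ₐ[ℂ] ℂ, Pt.pos (specMap r ≫ γ) = y})
    (hne : (U : Set X.left).Nonempty) :
    ∃ q : Γ(X.left, U) →ₐ[ℂ] L, specMap ι ≫ γ = chart hU q ∧ ∀ f, q f = 0 → IsNilpotent f := by
  obtain ⟨_, hU0, r, rfl⟩ := hγ.inter_open_nonempty _ U.2 hne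
  obtain ⟨q, hq⟩ := exists_eq_chart hU _ (ptAt_mem_of_pos_mem ι hι γ r hU0)
  refine ⟨q, hq, fun f hf ↦ isNilpotent_of_forall_algHom fun η ↦ ?_⟩
  by_contra hη
  obtain ⟨_, h0, r, rfl⟩ := hγ.inter_open_nonempty _ (X.left.basicOpen f).2
    ⟨_, (pos_chart_mem_basicOpen hU η f).mpr hη⟩
  have h1 := ptAt_mem_of_pos_mem ι hι γ r h0 ⊥
  rw [hq, ptAt_chart_mem_basicOpen, hf] at h1
  exact h1 (Ideal.zero_mem _)

end

/-- `D` induces a derivation from the image of `q` to `L`, which extends to `L` by separability in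
characteristic zero. -/
lemma exists_dual_lift {B L : Type} [CommRing B] [Algebra ℂ B] [Field L] [Algebra ℂ L]
    [Algebra.EssFiniteType ℂ L] (q : B →ₐ[ℂ] L) (D : Derivation ℂ B B)
    (hD : ∀ f, q f = 0 → q (D f) = 0) :
    ∃ τ : L →ₐ[ℂ] DualNumber L, (dualFst L).comp τ = AlgHom.id ℂ L ∧ τ.comp q = expHom q D := by
  have hprime : (RingHom.ker q).IsPrime := RingHom.ker_isPrime q
  let g : (B ⧸ RingHom.ker q) →ₐ[ℂ] DualNumber L :=
    Ideal.Quotient.liftₐ (RingHom.ker q) (expHom q D)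
    fun f hf ↦ TrivSqZeroExt.ext (by simpa using hf) (by simpa using hD f hf)
  obtain ⟨τ, h1, h2⟩ := exists_extension_dual (Ideal.kerLiftAlg q) (Ideal.kerLiftAlg_injective q) g
    (fun f ↦ by
      obtain ⟨f, rfl⟩ := Ideal.Quotient.mk_surjective f
      exact fst_expHom q D f)
  exact ⟨τ, AlgHom.ext h1, AlgHom.ext fun f ↦ h2 (Ideal.Quotient.mk _ f)⟩

section
variable {X : Sch} (b : GroupAction SLTwo X) {U : X.left.Opens} (hU : IsAffineOpen U)

/-- Extend `D` to `τ : L → L[ε]`. As `x` is constant, `τ` moves `g x` to `τ(g) x = h g x` with `h =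
τ(g) g⁻¹`. Now `h` is trivial modulo `ε`, so it is an infinitesimal element of `𝔰𝔩₂` over `L`, whose
coordinates are the coefficients `c`. -/
lemma exists_eq_combination {L : Type} [Field L] [Algebra ℂ L] [Algebra.EssFiniteType ℂ L]
    (g : Matrix.SpecialLinearGroup (Fin 2) L) (x : Pt X) {q : Γ(X.left, U) →ₐ[ℂ] L}
    (hq : slAct b g (specMap (Algebra.ofId ℂ L) ≫ x) = chart hU q)
    (hnil : ∀ f, q f = 0 → IsNilpotent f) (D : Derivation ℂ Γ(X.left, U) Γ(X.left, U)) :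
    ∃ c : Fin 3 → L, ∀ f, q (D f) = c 0 * q (slDer b hU slH f) + c 1 * q (slDer b hU slE f) +
      c 2 * q (slDer b hU slF f) := by
  obtain ⟨τ, hτ, hτq⟩ := exists_dual_lift q D fun f hf ↦
    ((isNilpotent_derivation D (hnil f hf)).map q).eq_zero
  have h1 := congrArg (specMap τ ≫ ·) hq
  have h2 := congrArg (specMap (dualInl L) ≫ ·) hq
  have e (σ : L →ₐ[ℂ] DualNumber L) : σ.comp (Algebra.ofId ℂ L) = Algebra.ofId ℂ _ :=
    Subsingleton.elim _ _
  simp only [specMap_slAct, specMap_chart, specMap_comp_assoc, e, hτq] at h1 h2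
  let h := Matrix.SpecialLinearGroup.map (τ : L →+* DualNumber L) g *
    (Matrix.SpecialLinearGroup.map (dualInl L : L →+* DualNumber L) g)⁻¹
  have hh : Matrix.SpecialLinearGroup.map (dualFst L : DualNumber L →+* L) h = 1 := by
    have e (σ : L →ₐ[ℂ] DualNumber L) (hσ : (dualFst L).comp σ = AlgHom.id ℂ L) :
        Matrix.SpecialLinearGroup.map (dualFst L : DualNumber L →+* L)
          (Matrix.SpecialLinearGroup.map (σ : L →+* DualNumber L) g) = g :=
      Matrix.SpecialLinearGroup.ext _ _ fun i j ↦ DFunLike.congr_fun hσ (g i j)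
    rw [map_mul, map_inv, e τ hτ, e (dualInl L) rfl, mul_inv_cancel]
  have h3 : slAct b h (chart hU ((dualInl L).comp q)) = chart hU (expHom q D) := by
    rw [← h1, ← h2, ← slAct_mul, inv_mul_cancel_right]
  rw [eq_slExp_of_map_fst h hh] at h3
  simp only [slAct_mul, slAct_slExp] at h3
  refine ⟨![(h 0 0).snd, (h 0 1).snd, (h 1 0).snd], fun f ↦ ?_⟩
  have h4 := congrArg TrivSqZeroExt.snd (DFunLike.congr_fun (chart_injective hU h3) f)
  simp only [expAlong_apply, snd_expHom] at h4
  rw [← h4]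
  simp
  ring

end

end SLTwoVariety

namespace SLTwoVariety

attribute [local instance] LieRing.ofAssociativeRing

/-! ### Noetherian topology -/

/-- The topology is induced from `Spec A` by forgetting homogeneity. -/
lemma noetherianSpace_projectiveSpectrum {A σ : Type*} [CommRing A] [SetLike σ A]
    [AddSubmonoidClass σ A] (𝒜 : ℕ → σ) [GradedRing 𝒜] [IsNoetherianRing A] :
    TopologicalSpace.NoetherianSpace (ProjectiveSpectrum 𝒜) := by
  let i : ProjectiveSpectrum 𝒜 → PrimeSpectrum A :=
    fun x ↦ ⟨x.asHomogeneousIdeal.toIdeal, x.isPrime⟩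
  have hi : Topology.IsInducing i := by
    refine ⟨TopologicalSpace.ext_isClosed fun Z ↦ ?_⟩
    rw [ProjectiveSpectrum.isClosed_iff_zeroLocus, isClosed_induced_iff]
    constructor
    · rintro ⟨s, rfl⟩
      exact ⟨_, PrimeSpectrum.isClosed_zeroLocus s, rfl⟩
    · rintro ⟨_, ht, rfl⟩
      obtain ⟨s, rfl⟩ := (PrimeSpectrum.isClosed_iff_zeroLocus _).mp ht
      exact ⟨s, rfl⟩
  exact hi.noetherianSpace

lemma IsQuasiProjective.noetherianSpace {X : Sch} (h : IsQuasiProjective X) :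
    TopologicalSpace.NoetherianSpace X.left := by
  obtain ⟨n, i, hi⟩ := h
  let := MvPolynomial.gradedAlgebra (σ := Fin (n + 1)) (R := ℂ)
  have : TopologicalSpace.NoetherianSpace (projectiveSpace n).left :=
    noetherianSpace_projectiveSpectrum (MvPolynomial.homogeneousSubmodule (Fin (n + 1)) ℂ)
  exact i.left.isEmbedding.isInducing.noetherianSpace

lemma pos_injective {X : Sch} : Function.Injective (Pt.pos : Pt X → X.left) := by
  intro x y h
  obtain ⟨U, hU, hx, -⟩ := exists_affine_nhds x.pos ⊤ trivial
  obtain ⟨χ, rfl⟩ := exists_pt_eq_chart hU x hx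
  obtain ⟨η, rfl⟩ := exists_pt_eq_chart hU y (h ▸ hx)
  congr 1
  ext f
  have h1 : η (f - algebraMap ℂ _ (χ f)) = 0 := by
    by_contra h0
    rw [← ne_eq, ← pos_chart_mem_basicOpen hU, ← h, pos_chart_mem_basicOpen] at h0
    simp at h0
  rw [map_sub, AlgHom.commutes, sub_eq_zero] at h1
  exact h1.symm

/-- The points form a discrete subspace of a Noetherian space. -/
lemma finite_of_isolated {X : Sch} [TopologicalSpace.NoetherianSpace X.left] {S : Set (Pt X)}
    (h : ∀ x ∈ S, ∃ W : X.left.Opens, x.pos ∈ W ∧ ∀ y ∈ S, y.pos ∈ W → y = x) : S.Finite := by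
  refine Set.Finite.of_finite_image ?_ pos_injective.injOn
  have : DiscreteTopology (Pt.pos '' S) := by
    refine discreteTopology_iff_isOpen_singleton.mpr ?_
    rintro ⟨_, x, hx, rfl⟩
    obtain ⟨W, hxW, hW⟩ := h x hx
    refine ⟨W, W.2, ?_⟩
    ext ⟨_, y, hy, rfl⟩
    constructor
    · exact fun hyW ↦ Subtype.ext (congrArg Pt.pos (hW y hy hyW))
    · intro e
      obtain rfl := pos_injective (congrArg Subtype.val e)
      exact hxW
  exact TopologicalSpace.NoetherianSpace.finite

/-! ### Actions with a dense orbit -/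

section
variable {X : Sch} (b : GroupAction SLTwo X) {U : X.left.Opens} (hU : IsAffineOpen U)

/-- `slDer` reverses brackets, so its negative is the Lie algebra homomorphism. -/
lemma isSlTwoTriple_slDer :
    IsSlTwoTriple (-slDer b hU slH) (-slDer b hU slE) (-slDer b hU slF) where
  lie_e_f := by rw [neg_lie, lie_neg, neg_neg, ← lie_slE_slF, slDer_lie, neg_neg]
  lie_h_e := by
    have h : ⁅slH, slE⁆ = (2 : ℂ) • slE := by rw [lie_slH_slE, two_smul, two_smul]
    rw [neg_lie, lie_neg, neg_neg, smul_neg, ← slDer_smul, ← h, slDer_lie, neg_neg]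
  lie_h_f := by
    have h : ⁅slH, slF⁆ = (-2 : ℂ) • slF := by
      rw [lie_slH_slF, neg_smul, two_smul, two_smul]
    rw [neg_lie, lie_neg, neg_neg, smul_neg, neg_neg, ← neg_inj, ← neg_smul, ← slDer_smul, ← h,
      slDer_lie]

lemma exists_generic_combination [Algebra.FiniteType ℂ Γ(X.left, U)] (hb : b.HasDenseOrbit)
    (hne : (U : Set X.left).Nonempty) :
    ∃ q : Γ(X.left, U) →ₐ[ℂ] FractionRing (MvPolynomial (Fin 4) ℂ),
      (∀ f, q f = 0 → IsNilpotent f) ∧ ∀ D : Derivation ℂ Γ(X.left, U) Γ(X.left, U),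
        ∃ c : Fin 3 → FractionRing (MvPolynomial (Fin 4) ℂ), ∀ f,
          q (D f) = c 0 * q (slDer b hU slH f) + c 1 * q (slDer b hU slE f) +
            c 2 * q (slDer b hU slF f) := by
  obtain ⟨x, hx⟩ := hb
  let R := MvPolynomial (Fin 4) ℂ
  let L := FractionRing R
  let g : Matrix.SpecialLinearGroup (Fin 2) R := upper (.X 0) * lower (.X 1) * upper (.X 2) *
    lower (.X 3)
  let γ : specOver R ⟶ X := slAct b g (specMap (Algebra.ofId ℂ R) ≫ x)
  let ι : R →ₐ[ℂ] L := IsScalarTower.toAlgHom ℂ R L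
  have hγ : Dense {y | ∃ r : R →ₐ[ℂ] ℂ, Pt.pos (specMap r ≫ γ) = y} := by
    refine hx.mono ?_
    rintro _ ⟨M, rfl⟩
    obtain ⟨s, hs⟩ := exists_eq_upper_lower M
    refine ⟨MvPolynomial.aeval s, congrArg Pt.pos ?_⟩
    have e : (MvPolynomial.aeval s : R →ₐ[ℂ] ℂ).comp (Algebra.ofId ℂ R) = AlgHom.id ℂ ℂ :=
      Subsingleton.elim _ _
    have h : slAct b M x = slAct b (upper (s 0) * lower (s 1) * upper (s 2) * lower (s 3)) x := by
      rw [← hs]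
    refine Eq.trans ?_ (h.symm.trans (b.smulConst_eq_smulAlg M x).symm)
    rw [specMap_slAct, specMap_comp_assoc, e, specMap_id, Category.id_comp]
    have e' (i) : (MvPolynomial.aeval s : R →ₐ[ℂ] ℂ) (.X i) = s i := MvPolynomial.aeval_X s i
    simp only [g, map_mul, map_upper, map_lower, e']
  obtain ⟨q, hq, hnil⟩ := exists_generic_chart hU ι (IsFractionRing.injective R L) γ hγ hne
  have : Algebra.EssFiniteType ℂ L := .comp ℂ R L
  refine ⟨q, hnil, exists_eq_combination b hU (Matrix.SpecialLinearGroup.map (ι : R →+* L) g) x ?_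
    hnil⟩
  have e : ι.comp (Algebra.ofId ℂ R) = Algebra.ofId ℂ L := Subsingleton.elim _ _
  rw [← hq, specMap_slAct, specMap_comp_assoc, e]

/-- Fixed points are zeros of the three fields, and where `r ≠ 0` these fields cut out `x` alone. -/
theorem exists_isolating_open (hs : Smooth X.hom) (hb : b.HasDenseOrbit) {x : Pt X}
    (hx : x ∈ b.fixedPoints) :
    ∃ W : X.left.Opens, x.pos ∈ W ∧ ∀ y ∈ b.fixedPoints, y.pos ∈ W → y = x := by
  obtain ⟨U, hU, hxU, -⟩ := exists_affine_nhds x.pos ⊤ trivial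
  obtain ⟨χ, rfl⟩ := exists_pt_eq_chart hU x hxU
  have := smooth_section hs hU
  obtain ⟨q, hq, hgen⟩ := exists_generic_combination b hU hb ⟨_, hxU⟩
  have hH (f) : χ ((-slDer b hU slH) f) = 0 := by
    rw [Derivation.neg_apply, map_neg, slDer_slH_eq_zero b hU hx, neg_zero]
  have hE (f) : χ ((-slDer b hU slE) f) = 0 := by
    rw [Derivation.neg_apply, map_neg, slDer_slE_eq_zero b hU hx, neg_zero]
  have hF (f) : χ ((-slDer b hU slF) f) = 0 := by
    rw [Derivation.neg_apply, map_neg, slDer_slF_eq_zero b hU hx, neg_zero]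
  have ht := isSlTwoTriple_slDer b hU
  obtain ⟨r, hr1, hr⟩ := exists_sub_one_mem_smul_le ht hH hE hF fun v hv hHv hEv _ ↦
    mem_sq_of_generic ht hH hE hF q hq (fun D ↦ by
      obtain ⟨c, hc⟩ := hgen D
      refine ⟨-c, fun f ↦ ?_⟩
      simp only [hc, Pi.neg_apply, Derivation.neg_apply, map_neg]
      ring) hv hHv hEv
  have hχr : χ r = 1 := by
    rwa [RingHom.mem_ker, map_sub, map_one, sub_eq_zero] at hr1
  refine ⟨X.left.basicOpen r, (pos_chart_mem_basicOpen hU χ r).mpr (by simp [hχr]),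
    fun y hy hyr ↦ ?_⟩
  obtain ⟨η, rfl⟩ := exists_pt_eq_chart hU y (X.left.basicOpen_le r hyr)
  rw [pos_chart_mem_basicOpen] at hyr
  have hle : Ideal.span (Set.range (-slDer b hU slH) ∪ Set.range (-slDer b hU slE) ∪
      Set.range (-slDer b hU slF)) ≤ RingHom.ker η := by
    refine Ideal.span_le.mpr ?_
    rintro _ ((⟨f, rfl⟩ | ⟨f, rfl⟩) | ⟨f, rfl⟩)
    · exact (map_neg η _).trans (neg_eq_zero.mpr (slDer_slH_eq_zero b hU hy f))
    · exact (map_neg η _).trans (neg_eq_zero.mpr (slDer_slE_eq_zero b hU hy f))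
    · exact (map_neg η _).trans (neg_eq_zero.mpr (slDer_slF_eq_zero b hU hy f))
  congr 1
  ext f
  have h1 : r * (f - algebraMap ℂ _ (χ f)) ∈ RingHom.ker η := hle (hr _ (by simp))
  rw [RingHom.mem_ker, map_mul, map_sub, AlgHom.commutes, mul_eq_zero, sub_eq_zero] at h1
  exact h1.resolve_left hyr

theorem finite_fixedPoints (hs : Smooth X.hom) (hqp : IsQuasiProjective X)
    (hb : b.HasDenseOrbit) : b.fixedPoints.Finite := by
  have := hqp.noetherianSpace
  exact finite_of_isolated fun x hx ↦ exists_isolating_open b hs hb hx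

end

end SLTwoVariety
end

theorem mainTheorem8 (X : SLTwoVariety.Sch) (hsmooth : AlgebraicGeometry.Smooth X.hom)
    (hqp : SLTwoVariety.IsQuasiProjective X) :
    (∀ (a : SLTwoVariety.SLTwoTAction X) (x : SLTwoVariety.Pt X),
      a.torusAction.IsIsolatedFixedPoint x →
        (x ∈ a.zeroLocus ↔
          ∀ n : ℤ, SLTwoVariety.IsTangentWeight a.torusAction x n → Odd n)) ∧
    (∀ b : SLTwoVariety.GroupAction SLTwoVariety.SLTwo X,
      b.IsNontrivial → b.HasDenseOrbit → b.fixedPoints.Finite) := by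
  have := hqp.isSeparated
  exact ⟨fun a x hx ↦ ⟨fun h n hn ↦ a.odd_of_mem_zeroLocus hsmooth hx h hn,
    fun h ↦ a.mem_zeroLocus_of_odd hx.1 h⟩,
    fun b _ hb ↦ SLTwoVariety.finite_fixedPoints b hsmooth hqp hb⟩
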